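/- Let $\mathscr H$ be a separable complex Hilbert space (inner product linear in the second variable). Let $T$ be a non-negative self-adjoint operator on $\mathscr H$ with spectral measure $E(\cdot)$, put $E_0:=\inf\sigma(T)$, and let $g\in\mathscr H$. Assume: (1) $T$ is purely absolutely continuous, i.e. for every $f\in\mathscr H$ the measure $\|E(\cdot)f\|^2$ is absolutely continuous with respect to Lebesgue measure; (2) $g\in D((T-E_0)^{-1/2})\cap D(T^{1/2})$, and there is a conjugation $J$ (an antilinear isometric involution) on $\mathscr H$ with $JT\subset TJ$ and $Jg=g$; (3) the density $\psi_g$ of $\|E(\cdot)g\|^2$ (a suitable version of it) satisfies $\sup_{x>E_0}x^{\pm1}\psi_g(x)<\infty$ and $\psi_g(x)>0$ for all $x>E_0$; (4) $\psi_g\in C^1((E_0,\infty))$ and $\lim_{x\downarrow E_0}x^{-1}\psi_g'(x)=0=\lim_{x\to\infty}x^{-1}\psi_g'(x)$. Let $\lambda\in\mathbb R$ and $$\lambda_{\rm c}:=-\Bigl(\int_{[E_0,\infty)}\frac{\mu}{\mu^2-E_0^2}\,d\|E(\mu)g\|^2\Bigr)^{-1},\qquad D(z):=1+\lambda\int_{[E_0,\infty)}\frac{\mu}{\mu^2-E_0^2-z}\,d\|E(\mu)g\|^2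 .$$ Write $R_z(A)=(A-z)^{-1}$ for the resolvent. Suppose $\lambda\ne\lambda_{\rm c}$. Then the following hold. (a) For all $s\ge0$ the limits $D_\pm(s):=\lim_{\varepsilon\downarrow0}D(s\pm i\varepsilon)$ exist and are non-zero; for $\varepsilon>0$ and $f\in\mathscr H$ the integral $$R_\pm^{(\varepsilon)}f:=-\lambda\int_{[E_0,\infty)}\frac{R_{\mu^2\pm i\varepsilon}(T^2)\,T^{1/2}g}{D_\pm(\mu^2-E_0^2)}\,d\langle T^{1/2}g,E(\mu)f\rangle$$ converges absolutely; and there are bounded operators $R_\pm$ on $\mathscr H$ with $R_\pm f=\lim_{\varepsilon\downarrow0}R_\pm^{(\varepsilon)}f$ for all $f\in\mathscr H$. Put $\Omega_\pm:=I+R_\pm$. (b) If $\lambda<\lambda_{\rm c}$, then $D$ has exactly one zero $x_0$ in $\mathbb C\setminus[0,\infty)$, it satisfies $x_0<0$, and the vector $$U_{\rm b}:=\sqrt{\lambda/D'(x_0)}\;R_{E_0^2+x_0}(T^2)\,T^{1/2}g$$ has norm $1$. In this case let $P:=\langle U_{\rm b},\cdot\rangle U_{\rm b}$, the rank-one orthogonal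 projection onto $\mathbb C U_{\rm b}$. (c) $\Omega_\pm^*\Omega_\pm=I$ and $\Omega_\pm\Omega_\pm^*=I-\theta(\lambda_{\rm c}-\lambda)P$, where $\theta(t)=1$ for $t>0$ and $\theta(t)=0$ for $t<0$ (so that the last term is absent when $\lambda>\lambda_{\rm c}$). (d) Consequently $\Omega_\pm$ are unitary if $\lambda>\lambda_{\rm c}$, and they are partial isometries with final subspace $\operatorname{Ran}(I-P)$ if $\lambda<\lambda_{\rm c}$. -/

import Mathlib

open MeasureTheory Filter Topology Set

noncomputable section

namespace PairModel

variable {H : Type*} [NormedAddCommGroup H] [InnerProductSpace ℂ H]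

/-! ### Unbounded operators: square, resolvent, spectrum -/

/-- The square `A² = A ∘ A` on its natural domain `{f ∈ D(A) | A f ∈ D(A)}`. -/
def sq (A : H →ₗ.[ℂ] H) : H →ₗ.[ℂ] H where
  domain :=
    { carrier := {f | ∃ h : f ∈ A.domain, A ⟨f, h⟩ ∈ A.domain}
      add_mem' := by
        rintro a b ⟨ha, ha'⟩ ⟨hb, hb'⟩
        refine ⟨A.domain.add_mem ha hb, ?_⟩
        have : A ⟨a + b, A.domain.add_mem ha hb⟩ = A ⟨a, ha⟩ + A ⟨b, hb⟩ :=
          A.map_add ⟨a, ha⟩ ⟨b, hb⟩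
        rw [this]
        exact A.domain.add_mem ha' hb'
      zero_mem' := by
        refine ⟨A.domain.zero_mem, ?_⟩
        have : A ⟨0, A.domain.zero_mem⟩ = 0 := A.map_zero
        rw [this]
        exact A.domain.zero_mem
      smul_mem' := by
        rintro c a ⟨ha, ha'⟩
        refine ⟨A.domain.smul_mem c ha, ?_⟩
        have : A ⟨c • a, A.domain.smul_mem c ha⟩ = c • A ⟨a, ha⟩ := A.map_smul c ⟨a, ha⟩
        rw [this]
        exact A.domain.smul_mem c ha' }
  toFun :=
    { toFun := fun f => A ⟨A ⟨f.1, f.2.choose⟩, f.2.choose_spec⟩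
      map_add' := by
        intro f f'
        rw [← A.map_add]
        congr 1
        exact Subtype.ext (A.map_add ⟨f.1, f.2.choose⟩ ⟨f'.1, f'.2.choose⟩)
      map_smul' := by
        intro c f
        rw [RingHom.id_apply, ← A.map_smul]
        congr 1
        exact Subtype.ext (A.map_smul c ⟨f.1, f.2.choose⟩) }

/-- `R` is the bounded, everywhere defined inverse of `A - z`. -/
def IsResolvent (A : H →ₗ.[ℂ] H) (z : ℂ) (R : H →L[ℂ] H) : Prop :=
  (∀ f : H, ∃ h : R f ∈ A.domain, A ⟨R f, h⟩ - z • R f = f) ∧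
    ∀ v : A.domain, R (A v - z • (v : H)) = v

/-- The spectrum `σ(A)`, the complement of the resolvent set. -/
def spec (A : H →ₗ.[ℂ] H) : Set ℂ := {z | ¬ ∃ R : H →L[ℂ] H, IsResolvent A z R}

open Classical in
/-- The resolvent `R_z(A) = (A - z)⁻¹` (and `0` if `z` is in the spectrum of `A`). -/
def resolv (A : H →ₗ.[ℂ] H) (z : ℂ) : H →L[ℂ] H :=
  if h : ∃ R : H →L[ℂ] H, IsResolvent A z R then h.choose else 0

/-- The lowest energy `E₀(A) = inf σ(A)` of an operator with real spectrum. -/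
def lowestEnergy (A : H →ₗ.[ℂ] H) : ℝ := sInf {x : ℝ | (x : ℂ) ∈ spec A}

/-! ### Spectral measures -/

/-- Projection-valued measures on the Borel sets of `ℝ`. -/
structure PVM (H : Type*) [NormedAddCommGroup H] [InnerProductSpace ℂ H] [CompleteSpace H] where
  /-- The projection `E(B)`; only its values on Borel sets `B` matter. -/
  proj : Set ℝ → H →L[ℂ] H
  isStarProjection : ∀ B, MeasurableSet B → IsStarProjection (proj B)
  univ : proj univ = 1
  inter : ∀ A B, MeasurableSet A → MeasurableSet B → proj (A ∩ B) = proj A * proj B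
  iUnion : ∀ B : ℕ → Set ℝ, (∀ i, MeasurableSet (B i)) → Pairwise (Function.onFun Disjoint B) →
    ∀ f : H, HasSum (fun i => proj (B i) f) (proj (⋃ i, B i) f)

variable [CompleteSpace H]

namespace PVM

theorem empty (E : PVM H) : E.proj ∅ = 0 := by
  ext f
  have h := E.iUnion (fun _ => ∅) (fun _ => MeasurableSet.empty) (fun _ _ _ => by simp) f
  simpa using h.summable.tendsto_atTop_zero

theorem inner_self (E : PVM H) {B : Set ℝ} (hB : MeasurableSet B) (f : H) :
    inner ℂ f (E.proj B f) = ((‖E.proj B f‖ ^ 2 : ℝ) : ℂ) := by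
  have hp := E.isStarProjection B hB
  have h1 : E.proj B (E.proj B f) = E.proj B f := by
    have := congrArg (fun A : H →L[ℂ] H => A f) hp.isIdempotentElem.eq
    simpa using this
  have h2 : ContinuousLinearMap.adjoint (E.proj B) = E.proj B := hp.isSelfAdjoint
  calc inner ℂ f (E.proj B f) = inner ℂ f (E.proj B (E.proj B f)) := by rw [h1]
    _ = inner ℂ (E.proj B f) (E.proj B f) := by
      conv_rhs => rw [← ContinuousLinearMap.adjoint_inner_right, h2]
    _ = _ := by rw [inner_self_eq_norm_sq_to_K]; simp

/-- The finite positive Borel measure `‖E(·)f‖²`. -/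
def measure (E : PVM H) (f : H) : Measure ℝ :=
  Measure.ofMeasurable (fun B _ => ENNReal.ofReal (‖E.proj B f‖ ^ 2))
    (by simp [E.empty])
    (by
      intro B hB hd
      have h := (E.iUnion B hB hd f).mapL (innerSL ℂ f)
      simp only [innerSL_apply_apply, E.inner_self (hB _), E.inner_self (MeasurableSet.iUnion hB)]
        at h
      have h' := Complex.hasSum_ofReal.mp h
      rw [← h'.tsum_eq, ENNReal.ofReal_tsum_of_nonneg (fun _ => by positivity) h'.summable])

open Classical in
/-- The complex Borel measure `⟨u, E(·)f⟩`. -/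
def cmeasure (E : PVM H) (u f : H) : ComplexMeasure ℝ where
  measureOf' B := if MeasurableSet B then inner ℂ u (E.proj B f) else 0
  empty' := by simp [E.empty]
  not_measurable' := by
    intro B hB
    simp [hB]
  m_iUnion' := by
    intro B hB hd
    have h := (E.iUnion B hB hd f).mapL (innerSL ℂ u)
    simpa [hB, MeasurableSet.iUnion hB] using h

/-- `f` belongs to the domain of `F(T) = ∫ F dE`, that is, `∫ |F|² d‖E(·)f‖² < ∞`. -/
def MemDomain (E : PVM H) (F : ℝ → ℂ) (f : H) : Prop := MemLp F 2 (E.measure f)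

/-- `v = (∫ F dE) f` weakly: `⟨u, v⟩ = ∫ F d⟨u, E(·)f⟩` for all `u`. -/
def IsApply (E : PVM H) (F : ℝ → ℂ) (f v : H) : Prop :=
  ∀ u : H, inner ℂ u v = (E.cmeasure u f).integral F (ContinuousLinearMap.mul ℝ ℂ)

open Classical in
/-- The vector `F(T) f = (∫ F dE) f`, for `f` in the domain of `F(T)`. -/
def apply (E : PVM H) (F : ℝ → ℂ) (f : H) : H :=
  if h : ∃ v, E.IsApply F f v then h.choose else 0

/-- `E` is the spectral measure of `T`: `T = ∫ x dE(x)`, with equality of domains. -/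
def IsSpectralMeasureOf (E : PVM H) (T : H →ₗ.[ℂ] H) : Prop :=
  (∀ f, f ∈ T.domain ↔ E.MemDomain (fun x => (x : ℂ)) f) ∧
    ∀ f : T.domain, E.IsApply (fun x => (x : ℂ)) f (T f)

open Classical in
/-- The projection-valued measure concentrated at `0`. -/
def diracZero : PVM H where
  proj B := if (0 : ℝ) ∈ B then 1 else 0
  isStarProjection B _ := by
    by_cases h : (0 : ℝ) ∈ B
    · simp [h, IsStarProjection.one]
    · simp [h, IsStarProjection.zero]
  univ := by simp
  inter A B _ _ := by
    by_cases h : (0 : ℝ) ∈ A <;> by_cases h' : (0 : ℝ) ∈ B <;> simp [h, h']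
  iUnion B _ hd f := by
    by_cases h : ∃ i, (0 : ℝ) ∈ B i
    · obtain ⟨i, hi⟩ := h
      have h0 : (0 : ℝ) ∈ ⋃ i, B i := mem_iUnion.mpr ⟨i, hi⟩
      have := hasSum_single (f := fun j => (if (0 : ℝ) ∈ B j then (1 : H →L[ℂ] H) else 0) f) i
        (fun j hj => by
          have : (0 : ℝ) ∉ B j := fun h => Set.disjoint_left.mp (hd hj) h hi
          simp [this])
      simpa [h0, hi] using this
    · have h' : ∀ i, (0 : ℝ) ∉ B i := fun i hi => h ⟨i, hi⟩
      have h0 : (0 : ℝ) ∉ ⋃ i, B i := by simpa using h'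
      simp [h', h0, hasSum_zero]

end PVM

open Classical in
/-- The spectral measure `E` of a self-adjoint operator `T`. (By the spectral theorem it exists
and is unique; the second branch concerns only operators that are not self-adjoint.) -/
def spectralPVM (T : H →ₗ.[ℂ] H) : PVM H :=
  if h : ∃ E : PVM H, E.IsSpectralMeasureOf T then h.choose else PVM.diracZero

/-! ### The model -/

/-- The assumptions on the one-particle operator `T` and the vector `g`. -/
structure Assumption (T : H →ₗ.[ℂ] H) (g : H) : Prop where
  selfAdjoint : IsSelfAdjoint T
  nonneg : ∀ f : T.domain, 0 ≤ (inner ℂ (f : H) (T f)).re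
  /-- `T` is purely absolutely continuous. -/
  absCont : ∀ f : H, (spectralPVM T).measure f ≪ volume
  /-- `g ∈ D((T - E₀)^{-1/2})`. -/
  mem_invSqrt : (spectralPVM T).MemDomain (fun x => ((√(x - lowestEnergy T))⁻¹ : ℝ)) g
  /-- `g ∈ D(T^{1/2})`. -/
  mem_sqrt : (spectralPVM T).MemDomain (fun x => (√x : ℝ)) g
  /-- There is a conjugation commuting with `T` and fixing `g`. -/
  conj : ∃ J : H ≃ₗᵢ⋆[ℂ] H, (∀ f, J (J f) = f) ∧ J g = g ∧
    ∀ f : T.domain, ∃ h : J f ∈ T.domain, T ⟨J f, h⟩ = J (T f)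
  /-- The density `ψ` of `‖E(·)g‖²` (has a version which) is positive and `C¹` on `(E₀, ∞)`, with
  the stated bounds and limits. -/
  density : ∃ ψ : ℝ → ℝ,
    (ψ =ᵐ[volume] fun x => (((spectralPVM T).measure g).rnDeriv volume x).toReal) ∧
    BddAbove ((fun x => x * ψ x) '' Ioi (lowestEnergy T)) ∧
    BddAbove ((fun x => x⁻¹ * ψ x) '' Ioi (lowestEnergy T)) ∧
    (∀ x ∈ Ioi (lowestEnergy T), 0 < ψ x) ∧
    ContDiffOn ℝ 1 ψ (Ioi (lowestEnergy T)) ∧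
    Tendsto (fun x => x⁻¹ * deriv ψ x) (𝓝[>] (lowestEnergy T)) (𝓝 0) ∧
    Tendsto (fun x => x⁻¹ * deriv ψ x) atTop (𝓝 0)

/-- The vector `T^{1/2} g`. -/
def sqrtVec (T : H →ₗ.[ℂ] H) (g : H) : H := (spectralPVM T).apply (fun x => (√x : ℝ)) g

/-- The critical coupling `λ_c = -(∫_{[E₀,∞)} μ / (μ² - E₀²) d‖E(μ)g‖²)⁻¹`. -/
def lamC (T : H →ₗ.[ℂ] H) (g : H) : ℝ :=
  -(∫ x in Ici (lowestEnergy T), x / (x ^ 2 - lowestEnergy T ^ 2) ∂(spectralPVM T).measure g)⁻¹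

/-- `D(z) = 1 + λ ∫_{[E₀,∞)} μ / (μ² - E₀² - z) d‖E(μ)g‖²`. -/
def D (T : H →ₗ.[ℂ] H) (g : H) (lam : ℝ) (z : ℂ) : ℂ :=
  1 + lam * ∫ x in Ici (lowestEnergy T),
    (x : ℂ) / ((x : ℂ) ^ 2 - (lowestEnergy T : ℂ) ^ 2 - z) ∂(spectralPVM T).measure g

/-- `D_±(s) = lim_{ε ↓ 0} D(s ± iε)`; the sign is `σ = 1` or `σ = -1`. -/
def Dbdry (T : H →ₗ.[ℂ] H) (g : H) (lam σ s : ℝ) : ℂ :=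
  limUnder (𝓝[>] (0 : ℝ)) fun ε : ℝ => D T g lam (s + σ * ε * Complex.I)

/-- The integrand `R_{μ² ± iε}(T²) T^{1/2} g / D_±(μ² - E₀²)`. -/
def kernelVec (T : H →ₗ.[ℂ] H) (g : H) (lam σ ε x : ℝ) : H :=
  (Dbdry T g lam σ (x ^ 2 - lowestEnergy T ^ 2))⁻¹ •
    resolv (sq T) ((x : ℂ) ^ 2 + σ * ε * Complex.I) (sqrtVec T g)

/-- `R_±^{(ε)} f = -λ ∫_{[E₀,∞)} R_{μ² ± iε}(T²) T^{1/2} g / D_±(μ² - E₀²) d⟨T^{1/2} g, E(μ)f⟩`. -/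
def Reps (T : H →ₗ.[ℂ] H) (g : H) (lam σ ε : ℝ) (f : H) : H :=
  -(lam : ℂ) • (((spectralPVM T).cmeasure (sqrtVec T g) f).restrict
      (Ici (lowestEnergy T))).integral (kernelVec T g lam σ ε)
    (ContinuousLinearMap.lsmul ℝ ℂ : ℂ →L[ℝ] H →L[ℝ] H).flip

open Classical in
/-- The bounded operator `R_±`, the strong limit of `R_±^{(ε)}` as `ε ↓ 0`. -/
def Rop (T : H →ₗ.[ℂ] H) (g : H) (lam σ : ℝ) : H →L[ℂ] H :=
  if h : ∃ R : H →L[ℂ] H, ∀ f, Tendsto (fun ε => Reps T g lam σ ε f) (𝓝[>] 0) (𝓝 (R f))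
  then h.choose else 0

/-- `Ω_± = I + R_±`. -/
def Omega (T : H →ₗ.[ℂ] H) (g : H) (lam σ : ℝ) : H →L[ℂ] H := 1 + Rop T g lam σ

open Classical in
/-- The zero `x₀ < 0` of `D` (meaningful for `λ < λ_c`). -/
def xZero (T : H →ₗ.[ℂ] H) (g : H) (lam : ℝ) : ℝ :=
  if h : ∃ x : ℝ, x < 0 ∧ D T g lam x = 0 then h.choose else 0

/-- The bound state `U_b = √(λ / D'(x₀)) R_{E₀² + x₀}(T²) T^{1/2} g`. -/
def boundState (T : H →ₗ.[ℂ] H) (g : H) (lam : ℝ) : H :=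
  ((√(lam / (deriv (D T g lam) (xZero T g lam)).re) : ℝ) : ℂ) •
    resolv (sq T) ((lowestEnergy T : ℂ) ^ 2 + xZero T g lam) (sqrtVec T g)

/-- `P = ⟨U_b, ·⟩ U_b`. -/
def boundProj (T : H →ₗ.[ℂ] H) (g : H) (lam : ℝ) : H →L[ℂ] H :=
  InnerProductSpace.rankOne ℂ (boundState T g lam) (boundState T g lam)

open Classical in
/-- The Heaviside function (its value at `0` is immaterial). -/
def heaviside (t : ℝ) : ℝ := if 0 < t then 1 else 0

/-- `A` is isometric on the orthogonal complement of its kernel. -/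
def IsPartialIsometry (A : H →L[ℂ] H) : Prop := ∀ f ∈ (LinearMap.ker A.toLinearMap)ᗮ, ‖A f‖ = ‖f‖

end PairModel

end

noncomputable section

namespace CauchyTransform

open Complex
open scoped ComplexConjugate ENNReal

/-! ### The Cauchy kernel -/

theorem ofReal_sub_ne_zero {z : ℂ} (hz : z.im ≠ 0) (t : ℝ) : (t : ℂ) - z ≠ 0 := by
  intro h
  apply hz
  have := congrArg Complex.im h
  simpa using this

theorem continuous_kernel {z : ℂ} (hz : z.im ≠ 0) : Continuous fun t : ℝ => ((t : ℂ) - z)⁻¹ :=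
  Continuous.inv₀ (by fun_prop) (ofReal_sub_ne_zero hz)

theorem norm_kernel_le {z : ℂ} (hz : z.im ≠ 0) (t : ℝ) : ‖((t : ℂ) - z)⁻¹‖ ≤ |z.im|⁻¹ := by
  rw [norm_inv]
  apply inv_anti₀ (abs_pos.mpr hz)
  have := Complex.abs_im_le_norm ((t : ℂ) - z)
  simpa using this

theorem norm_kernel_sq {z : ℂ} (hz : z.im ≠ 0) (t : ℝ) :
    ‖((t : ℂ) - z)⁻¹‖ ^ 2 = (z.im ^ 2)⁻¹ * (1 + ((t - z.re) / z.im) ^ 2)⁻¹ := by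
  rw [norm_inv, inv_pow, ← mul_inv, Complex.sq_norm, Complex.normSq_apply]
  congr 1
  simp only [sub_re, ofReal_re, sub_im, ofReal_im, zero_sub]
  field_simp
  ring

theorem integrable_norm_kernel_sq {z : ℂ} (hz : z.im ≠ 0) :
    Integrable fun t : ℝ => ‖((t : ℂ) - z)⁻¹‖ ^ 2 := by
  simp_rw [norm_kernel_sq hz]
  apply Integrable.const_mul
  exact (integrable_inv_one_add_sq.comp_div hz).comp_sub_right z.re

theorem integral_norm_kernel_sq {z : ℂ} (hz : z.im ≠ 0) :
    ∫ t : ℝ, ‖((t : ℂ) - z)⁻¹‖ ^ 2 = Real.pi / |z.im| := by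
  simp_rw [norm_kernel_sq hz]
  rw [integral_const_mul, integral_sub_right_eq_self (fun t => (1 + (t / z.im) ^ 2)⁻¹) z.re,
    Measure.integral_comp_div (fun t => (1 + t ^ 2)⁻¹) z.im, integral_univ_inv_one_add_sq,
    ← sq_abs z.im, smul_eq_mul]
  have := abs_pos.mpr hz
  field_simp

theorem memLp_kernel {z : ℂ} (hz : z.im ≠ 0) : MemLp (fun t : ℝ => ((t : ℂ) - z)⁻¹) 2 :=
  (memLp_two_iff_integrable_sq_norm (continuous_kernel hz).aestronglyMeasurable).mpr
    (integrable_norm_kernel_sq hz)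

theorem integrable_kernel_mul_kernel {p q : ℂ} (hp : p.im ≠ 0) (hq : q.im ≠ 0) :
    Integrable fun t : ℝ => ((t : ℂ) - p)⁻¹ * ((t : ℂ) - q)⁻¹ :=
  (memLp_kernel hp).integrable_mul (memLp_kernel hq)

theorem tendsto_log_sub_log_atTop (p q : ℂ) :
    Tendsto (fun t : ℝ => log ((t : ℂ) - p) - log ((t : ℂ) - q)) atTop (𝓝 0) := by
  have key : ∀ p : ℂ, Tendsto (fun t : ℝ => log ((t : ℂ) - p) - Real.log t) atTop (𝓝 0) := by
    intro p
    have h1 : Tendsto (fun t : ℝ => 1 - p * ((t⁻¹ : ℝ) : ℂ)) atTop (𝓝 1) := by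
      have : Tendsto (fun t : ℝ => ((t⁻¹ : ℝ) : ℂ)) atTop (𝓝 ((0 : ℝ) : ℂ)) :=
        (Complex.continuous_ofReal.tendsto 0).comp tendsto_inv_atTop_zero
      simpa using (this.const_mul p).const_sub 1
    have h2 : Tendsto (fun t : ℝ => log (1 - p * ((t⁻¹ : ℝ) : ℂ))) atTop (𝓝 0) := by
      have := ((continuousAt_clog (x := 1) (by simp)).tendsto).comp h1
      simpa [Function.comp_def] using this
    refine h2.congr' ?_
    have h3 := h1.eventually_ne one_ne_zero
    filter_upwards [eventually_gt_atTop 0, h3] with t ht h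
    have : (t : ℂ) - p = t * (1 - p * ((t⁻¹ : ℝ) : ℂ)) := by
      have : (t : ℂ) ≠ 0 := by exact_mod_cast ht.ne'
      push_cast
      field_simp
    rw [this, Complex.log_ofReal_mul ht h]
    ring
  simpa using (key p).sub (key q)

theorem tendsto_log_sub_log_atBot {p q : ℂ} (hp : 0 < p.im) (hq : q.im < 0) :
    Tendsto (fun t : ℝ => log ((t : ℂ) - p) - log ((t : ℂ) - q)) atBot
      (𝓝 (-(2 * Real.pi * I))) := by
  have h := ((tendsto_log_sub_log_atTop (-p) (-q)).comp tendsto_neg_atBot_atTop).sub_const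
    (2 * Real.pi * I)
  rw [zero_sub] at h
  refine h.congr fun t => ?_
  have e1 : (((-t : ℝ) : ℂ) - -p) = -((t : ℂ) - p) := by push_cast; ring
  have e2 : (((-t : ℝ) : ℂ) - -q) = -((t : ℂ) - q) := by push_cast; ring
  simp only [Function.comp]
  rw [e1, e2, Complex.log, Complex.log, Complex.log, Complex.log,
    Complex.arg_neg_eq_arg_add_pi_of_im_neg (x := (t : ℂ) - p) (by simpa using hp),
    Complex.arg_neg_eq_arg_sub_pi_of_im_pos (x := (t : ℂ) - q) (by simpa using hq), norm_neg,
    norm_neg]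
  push_cast
  ring

theorem integral_kernel_mul_kernel {p q : ℂ} (hp : 0 < p.im) (hq : q.im < 0) :
    ∫ t : ℝ, ((t : ℂ) - p)⁻¹ * ((t : ℂ) - q)⁻¹ = 2 * Real.pi * I / (p - q) := by
  have hpq : p - q ≠ 0 := by
    intro h
    have := congrArg Complex.im h
    simp at this
    linarith
  have hd : ∀ t : ℝ, HasDerivAt (fun t : ℝ => (log ((t : ℂ) - p) - log ((t : ℂ) - q)) / (p - q))
      (((t : ℂ) - p)⁻¹ * ((t : ℂ) - q)⁻¹) t := by
    intro t
    have h1 : HasDerivAt (fun t : ℝ => log ((t : ℂ) - p)) (((t : ℂ) - p)⁻¹) t := by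
      have := (((hasDerivAt_id t).ofReal_comp).sub_const p).clog_real
        (by rw [mem_slitPlane_iff]; right; simpa using hp.ne')
      simpa using this
    have h2 : HasDerivAt (fun t : ℝ => log ((t : ℂ) - q)) (((t : ℂ) - q)⁻¹) t := by
      have := (((hasDerivAt_id t).ofReal_comp).sub_const q).clog_real
        (by rw [mem_slitPlane_iff]; right; simpa using hq.ne)
      simpa using this
    have a1 := ofReal_sub_ne_zero hp.ne' t
    have a2 := ofReal_sub_ne_zero hq.ne t
    have e : ((t : ℂ) - p)⁻¹ * ((t : ℂ) - q)⁻¹ = (((t : ℂ) - p)⁻¹ - ((t : ℂ) - q)⁻¹) / (p - q) := by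
      field_simp
      ring
    rw [e]
    exact (h1.sub h2).div_const (p - q)
  rw [integral_of_hasDerivAt_of_tendsto hd (integrable_kernel_mul_kernel hp.ne' hq.ne)
    ((tendsto_log_sub_log_atBot hp hq).div_const _) ((tendsto_log_sub_log_atTop p q).div_const _)]
  field_simp
  ring

end CauchyTransform

end

noncomputable section

namespace CauchyTransform

open Complex
open scoped ComplexConjugate ENNReal

/-! ### The Cauchy transform of an integrable function -/

/-- The Cauchy transform `z ↦ ∫ a(s) / (s - z) ds`. -/
def cauchy (a : ℝ → ℂ) (z : ℂ) : ℂ := ∫ s : ℝ, a s * ((s : ℂ) - z)⁻¹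

theorem im_ofReal_add_mul_I (t κ : ℝ) : ((t : ℂ) + κ * I).im = κ := by simp

theorem cauchy_congr {a b : ℝ → ℂ} (h : a =ᵐ[volume] b) (z : ℂ) : cauchy a z = cauchy b z :=
  integral_congr_ae (by filter_upwards [h] with s hs; rw [hs])

theorem integrable_mul_kernel {a : ℝ → ℂ} (ha : Integrable a) {z : ℂ} (hz : z.im ≠ 0) :
    Integrable fun s : ℝ => a s * ((s : ℂ) - z)⁻¹ :=
  ha.mul_bdd (c := |z.im|⁻¹) (continuous_kernel hz).aestronglyMeasurable
    (Eventually.of_forall (norm_kernel_le hz))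

theorem integrable_mul_kernel_of_memLp {a : ℝ → ℂ} (ha : MemLp a 2) {z : ℂ} (hz : z.im ≠ 0) :
    Integrable fun s : ℝ => a s * ((s : ℂ) - z)⁻¹ :=
  ha.integrable_mul (memLp_kernel hz)

theorem conj_cauchy (a : ℝ → ℂ) (z : ℂ) :
    conj (cauchy a z) = cauchy (fun s => conj (a s)) (conj z) := by
  rw [cauchy, cauchy, ← integral_conj]
  simp

theorem norm_cauchy_le {a : ℝ → ℂ} (ha : Integrable a) {z : ℂ} (hz : z.im ≠ 0) :
    ‖cauchy a z‖ ≤ |z.im|⁻¹ * ∫ s, ‖a s‖ := by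
  rw [cauchy, ← integral_const_mul]
  apply norm_integral_le_of_norm_le (ha.norm.const_mul _)
  filter_upwards with s
  rw [norm_mul, mul_comm]
  gcongr
  exact norm_kernel_le hz s

theorem hasDerivAt_cauchy {a : ℝ → ℂ} (ha : Integrable a) {z : ℂ} {δ : ℝ} (hδ : 0 < δ)
    (h : ∀ s : ℝ, a s ≠ 0 → δ ≤ ‖(s : ℂ) - z‖) :
    HasDerivAt (cauchy a) (∫ s : ℝ, a s * (((s : ℂ) - z)⁻¹) ^ 2) z := by
  have hdist : ∀ s : ℝ, a s ≠ 0 → ∀ w ∈ Metric.ball z (δ / 2), δ / 2 ≤ ‖(s : ℂ) - w‖ := by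
    intro s hs w hw
    have h1 := h s hs
    have h2 : ‖w - z‖ < δ / 2 := by simpa [dist_eq_norm] using hw
    have h3 : ‖(s : ℂ) - z‖ ≤ ‖(s : ℂ) - w‖ + ‖w - z‖ := by
      simpa using norm_add_le ((s : ℂ) - w) (w - z)
    linarith
  have hmeas : ∀ w : ℂ, Measurable fun s : ℝ => ((s : ℂ) - w)⁻¹ := fun w => by fun_prop
  have hb : ∀ s : ℝ, ∀ w ∈ Metric.ball z (δ / 2),
      ‖a s * ((s : ℂ) - w)⁻¹‖ ≤ ‖a s‖ * (2 / δ) := by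
    intro s w hw
    by_cases hs : a s = 0
    · simp [hs]
    rw [norm_mul, norm_inv]
    gcongr
    rw [← inv_div]
    exact inv_anti₀ (by positivity) (hdist s hs w hw)
  have hb' : ∀ s : ℝ, ∀ w ∈ Metric.ball z (δ / 2),
      ‖a s * (((s : ℂ) - w)⁻¹) ^ 2‖ ≤ ‖a s‖ * (2 / δ) ^ 2 := by
    intro s w hw
    by_cases hs : a s = 0
    · simp [hs]
    rw [norm_mul, norm_pow, norm_inv]
    gcongr
    rw [← inv_div]
    exact inv_anti₀ (by positivity) (hdist s hs w hw)
  have hz : z ∈ Metric.ball z (δ / 2) := Metric.mem_ball_self (by positivity)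
  refine (hasDerivAt_integral_of_dominated_loc_of_deriv_le (μ := volume)
    (F := fun w s => a s * ((s : ℂ) - w)⁻¹)
    (F' := fun w s => a s * (((s : ℂ) - w)⁻¹) ^ 2)
    (bound := fun s => ‖a s‖ * (2 / δ) ^ 2) (s := Metric.ball z (δ / 2))
    (Metric.ball_mem_nhds _ (by positivity)) ?_ ?_ ?_ ?_ ?_ ?_).2
  · exact Eventually.of_forall fun w => ha.1.mul (hmeas w).aestronglyMeasurable
  · refine (ha.norm.mul_const (2 / δ)).mono' (ha.1.mul (hmeas z).aestronglyMeasurable) ?_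
    exact Eventually.of_forall fun s => hb s z hz
  · exact ha.1.mul ((hmeas z).pow_const 2).aestronglyMeasurable
  · exact Eventually.of_forall fun s w hw => hb' s w hw
  · exact ha.norm.mul_const _
  · refine Eventually.of_forall fun s w hw => ?_
    by_cases hs : a s = 0
    · simpa [hs] using hasDerivAt_const w (0 : ℂ)
    have hne : (s : ℂ) - w ≠ 0 := by
      have := hdist s hs w hw
      rw [← norm_pos_iff]
      linarith
    have := (((hasDerivAt_id w).const_sub (s : ℂ)).inv hne).const_mul (a s)
    refine this.congr_deriv ?_
    simp only [id]
    field_simp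

theorem differentiableAt_cauchy {a : ℝ → ℂ} (ha : Integrable a) {z : ℂ} (hz : z.im ≠ 0) :
    DifferentiableAt ℂ (cauchy a) z :=
  (hasDerivAt_cauchy ha (abs_pos.mpr hz) fun s _ => by
    simpa using Complex.abs_im_le_norm ((s : ℂ) - z)).differentiableAt

theorem continuous_cauchy_line {a : ℝ → ℂ} (ha : Integrable a) {κ : ℝ} (hκ : κ ≠ 0) :
    Continuous fun t : ℝ => cauchy a (t + κ * I) := by
  rw [continuous_iff_continuousAt]
  intro t
  exact ContinuousAt.comp (f := fun t : ℝ => (t : ℂ) + κ * I)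
    (differentiableAt_cauchy ha (by simpa using hκ)).continuousAt (by fun_prop)

/-! ### Square integrability along horizontal lines -/

theorem norm_kernel_swap (s t κ : ℝ) :
    ‖((s : ℂ) - (t + κ * I))⁻¹‖ = ‖((t : ℂ) - (s + (-κ : ℝ) * I))⁻¹‖ := by
  rw [norm_inv, norm_inv, ← norm_neg]
  congr 2
  push_cast
  ring

theorem lintegral_enorm_cauchy_sq_le {a : ℝ → ℂ} (ha : Integrable a) {κ : ℝ} (hκ : κ ≠ 0) :
    ∫⁻ t : ℝ, ‖cauchy a (t + κ * I)‖ₑ ^ 2 ≤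
      ENNReal.ofReal (Real.pi / |κ|) * (∫⁻ s, ‖a s‖ₑ) ^ 2 := by
  set ν : Measure ℝ := volume.withDensity fun s => ‖a s‖ₑ with hν
  have hνu : ν univ = ∫⁻ s, ‖a s‖ₑ := by simp [hν]
  have : IsFiniteMeasure ν := ⟨by rw [hνu]; exact ha.2⟩
  have hmeas : Measurable fun p : ℝ × ℝ => ‖((p.2 : ℂ) - (p.1 + κ * I))⁻¹‖ₑ := by fun_prop
  have h1 : ∀ t : ℝ, ‖cauchy a (t + κ * I)‖ₑ ≤ ∫⁻ s : ℝ, ‖((s : ℂ) - (t + κ * I))⁻¹‖ₑ ∂ν := by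
    intro t
    rw [hν, lintegral_withDensity_eq_lintegral_mul₀ ha.1.enorm
      (g := fun s : ℝ => ‖((s : ℂ) - (t + κ * I))⁻¹‖ₑ) (by fun_prop)]
    refine (enorm_integral_le_lintegral_enorm _).trans (le_of_eq ?_)
    simp [enorm_mul]
  have h2 : ∀ t : ℝ, (∫⁻ s : ℝ, ‖((s : ℂ) - (t + κ * I))⁻¹‖ₑ ∂ν) ^ 2 ≤
      ν univ * ∫⁻ s : ℝ, ‖((s : ℂ) - (t + κ * I))⁻¹‖ₑ ^ 2 ∂ν := by
    intro t
    have := ENNReal.lintegral_mul_le_Lp_mul_Lq ν Real.HolderConjugate.two_two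
      (f := fun _ => 1) (g := fun s : ℝ => ‖((s : ℂ) - (t + κ * I))⁻¹‖ₑ) aemeasurable_const
      (hmeas.comp (measurable_const.prodMk measurable_id)).aemeasurable
    simp only [Pi.mul_apply, one_mul, ENNReal.one_rpow, lintegral_const] at this
    calc _ ≤ _ := pow_le_pow_left' this 2
      _ = _ := by
        rw [mul_pow, ← ENNReal.rpow_natCast, ← ENNReal.rpow_natCast, ← ENNReal.rpow_mul,
          ← ENNReal.rpow_mul]
        norm_num
  have h3 : ∀ s : ℝ, ∫⁻ t : ℝ, ‖((s : ℂ) - (t + κ * I))⁻¹‖ₑ ^ 2 =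
      ENNReal.ofReal (Real.pi / |κ|) := by
    intro s
    have hz : ((s : ℂ) + (-κ : ℝ) * I).im ≠ 0 := by simpa using hκ
    have e := ofReal_integral_eq_lintegral_ofReal (integrable_norm_kernel_sq hz)
      (Eventually.of_forall fun t => by positivity)
    rw [integral_norm_kernel_sq hz, im_ofReal_add_mul_I, abs_neg] at e
    rw [e]
    refine lintegral_congr fun t => ?_
    rw [← norm_kernel_swap, ENNReal.ofReal_pow (norm_nonneg _), ofReal_norm]
  calc ∫⁻ t : ℝ, ‖cauchy a (t + κ * I)‖ₑ ^ 2
      ≤ ∫⁻ t : ℝ, ν univ * ∫⁻ s : ℝ, ‖((s : ℂ) - (t + κ * I))⁻¹‖ₑ ^ 2 ∂ν :=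
        lintegral_mono fun t => (pow_le_pow_left' (h1 t) 2).trans (h2 t)
    _ = ν univ * ∫⁻ t : ℝ, ∫⁻ s : ℝ, ‖((s : ℂ) - (t + κ * I))⁻¹‖ₑ ^ 2 ∂ν :=
        lintegral_const_mul' _ _ (measure_ne_top _ _)
    _ = ν univ * ∫⁻ s : ℝ, (∫⁻ t : ℝ, ‖((s : ℂ) - (t + κ * I))⁻¹‖ₑ ^ 2) ∂ν := by
        rw [lintegral_lintegral_swap]
        exact (hmeas.pow_const 2).aemeasurable
    _ = _ := by
        simp_rw [h3]
        rw [lintegral_const, hνu]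
        ring

theorem memLp_cauchy_line_of_integrable {a : ℝ → ℂ} (ha : Integrable a) {κ : ℝ} (hκ : κ ≠ 0) :
    MemLp (fun t : ℝ => cauchy a (t + κ * I)) 2 := by
  refine (memLp_two_iff_integrable_sq_norm
    (continuous_cauchy_line ha hκ).aestronglyMeasurable).mpr
    ⟨((continuous_cauchy_line ha hκ).norm.pow 2).aestronglyMeasurable, ?_⟩
  rw [hasFiniteIntegral_def]
  simp_rw [enorm_pow, enorm_norm]
  refine (lintegral_enorm_cauchy_sq_le ha hκ).trans_lt ?_
  exact ENNReal.mul_lt_top ENNReal.ofReal_lt_top (ENNReal.pow_lt_top ha.2)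

theorem integral_norm_cauchy_sq_le {a : ℝ → ℂ} (ha : Integrable a) {κ : ℝ} (hκ : κ ≠ 0) :
    ∫ t : ℝ, ‖cauchy a (t + κ * I)‖ ^ 2 ≤ Real.pi / |κ| * (∫ s, ‖a s‖) ^ 2 := by
  rw [integral_eq_lintegral_of_nonneg_ae (Eventually.of_forall fun t => by positivity)
    (by simpa using! ((continuous_cauchy_line ha hκ).norm.pow 2).aestronglyMeasurable),
    integral_norm_eq_lintegral_enorm ha.1]
  have h0 : ENNReal.ofReal (Real.pi / |κ|) * (∫⁻ s, ‖a s‖ₑ) ^ 2 ≠ ∞ :=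
    (ENNReal.mul_lt_top ENNReal.ofReal_lt_top (ENNReal.pow_lt_top ha.2)).ne
  have := ENNReal.toReal_mono h0 (lintegral_enorm_cauchy_sq_le ha hκ)
  rw [ENNReal.toReal_mul, ENNReal.toReal_pow, ENNReal.toReal_ofReal (by positivity)] at this
  refine le_trans (le_of_eq ?_) this
  congr 1
  refine lintegral_congr fun t => ?_
  rw [ENNReal.ofReal_pow (norm_nonneg _), ofReal_norm]

/-! ### The composition rule -/

theorem integrable_mul_prod_of_bound {a : ℝ → ℂ} (ha : Integrable a) {F : ℝ × ℝ → ℂ}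
    (hF : Continuous F) (hi : ∀ s, Integrable fun t => F (s, t)) {C : ℝ}
    (hC : ∀ s, ∫ t, ‖F (s, t)‖ ≤ C) :
    Integrable (fun p : ℝ × ℝ => a p.1 * F p) (volume.prod volume) := by
  have hm : AEStronglyMeasurable (fun p : ℝ × ℝ => a p.1 * F p) (volume.prod volume) :=
    (ha.1.comp_fst).mul hF.aestronglyMeasurable
  rw [integrable_prod_iff hm]
  refine ⟨Eventually.of_forall fun s => (hi s).const_mul (a s), ?_⟩
  refine (ha.norm.mul_const C).mono' hm.norm.integral_prod_right' ?_
  filter_upwards with s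
  simp_rw [norm_mul]
  rw [integral_const_mul, Real.norm_of_nonneg (by positivity)]
  gcongr
  exact hC s

theorem integral_norm_mul_le {f g : ℝ → ℂ} (hf : MemLp f 2) (hg : MemLp g 2) :
    ∫ t, ‖f t * g t‖ ≤ (∫ t, ‖f t‖ ^ 2) + ∫ t, ‖g t‖ ^ 2 := by
  have hf' := (memLp_two_iff_integrable_sq_norm hf.1).mp hf
  have hg' := (memLp_two_iff_integrable_sq_norm hg.1).mp hg
  rw [← integral_add hf' hg']
  refine integral_mono (hf.integrable_mul hg).norm (hf'.add hg') fun t => ?_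
  simp only [norm_mul]
  nlinarith [sq_nonneg (‖f t‖ - ‖g t‖), norm_nonneg (f t), norm_nonneg (g t)]

theorem integral_kernel_mul_kernel_of_sign {σ : ℝ} (hσ : σ = 1 ∨ σ = -1) {p q : ℂ}
    (hp : 0 < σ * p.im) (hq : σ * q.im < 0) :
    ∫ t : ℝ, ((t : ℂ) - p)⁻¹ * ((t : ℂ) - q)⁻¹ = 2 * Real.pi * I * σ / (p - q) := by
  rcases hσ with rfl | rfl
  · rw [integral_kernel_mul_kernel (by linarith) (by linarith)]
    simp
  · simp_rw [mul_comm (((_ : ℝ) : ℂ) - p)⁻¹]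
    rw [integral_kernel_mul_kernel (by linarith) (by linarith), ← neg_sub p q, div_neg]
    push_cast
    ring

theorem integral_cauchy_mul_kernel {σ : ℝ} (hσ : σ = 1 ∨ σ = -1) {b : ℝ → ℂ} (hb : Integrable b)
    {κ : ℝ} (hκ : 0 < σ * κ) {p : ℂ} (hp : 0 < σ * p.im) :
    ∫ t : ℝ, cauchy b (t + κ * I) * ((t : ℂ) - p)⁻¹ =
      2 * Real.pi * I * σ * cauchy b (p + κ * I) := by
  have hκ0 : κ ≠ 0 := by rintro rfl; simp at hκ
  have hp0 : p.im ≠ 0 := by intro h; simp [h] at hp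
  have hden : ∀ s t : ℝ, ((s : ℂ) - (t + κ * I))⁻¹ = -((t : ℂ) - (s + (-κ : ℝ) * I))⁻¹ := by
    intro s t
    rw [← inv_neg]
    congr 1
    push_cast
    ring
  have hint : Integrable (fun x : ℝ × ℝ => b x.1 *
      (((x.1 : ℂ) - (x.2 + κ * I))⁻¹ * ((x.2 : ℂ) - p)⁻¹)) (volume.prod volume) := by
    refine integrable_mul_prod_of_bound hb (F := fun x : ℝ × ℝ =>
      ((x.1 : ℂ) - (x.2 + κ * I))⁻¹ * ((x.2 : ℂ) - p)⁻¹) ?_ ?_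
      (C := Real.pi / |κ| + Real.pi / |p.im|) ?_
    · refine Continuous.mul (Continuous.inv₀ (by fun_prop) fun x => ?_)
        ((continuous_kernel hp0).comp continuous_snd)
      exact ofReal_sub_ne_zero (by simpa using hκ0) x.1
    · intro s
      simp_rw [hden, neg_mul]
      exact (integrable_kernel_mul_kernel (by simpa using hκ0) hp0).neg
    · intro s
      have hz : ((s : ℂ) + (-κ : ℝ) * I).im ≠ 0 := by simpa using hκ0
      simp_rw [hden, neg_mul, norm_neg]
      refine (integral_norm_mul_le (memLp_kernel hz) (memLp_kernel hp0)).trans ?_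
      rw [integral_norm_kernel_sq hz, integral_norm_kernel_sq hp0, im_ofReal_add_mul_I, abs_neg]
  calc ∫ t : ℝ, cauchy b (t + κ * I) * ((t : ℂ) - p)⁻¹
      = ∫ t : ℝ, ∫ s : ℝ, b s * (((s : ℂ) - (t + κ * I))⁻¹ * ((t : ℂ) - p)⁻¹) := by
        refine integral_congr_ae (Eventually.of_forall fun t => ?_)
        simp only [cauchy]
        rw [← integral_mul_const]
        simp_rw [mul_assoc]
    _ = ∫ s : ℝ, ∫ t : ℝ, b s * (((s : ℂ) - (t + κ * I))⁻¹ * ((t : ℂ) - p)⁻¹) :=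
        (integral_integral_swap (f := fun s t : ℝ =>
          b s * (((s : ℂ) - (t + κ * I))⁻¹ * ((t : ℂ) - p)⁻¹)) hint).symm
    _ = ∫ s : ℝ, 2 * Real.pi * I * σ * (b s * ((s : ℂ) - (p + κ * I))⁻¹) := by
        refine integral_congr_ae (Eventually.of_forall fun s => ?_)
        simp only
        rw [integral_const_mul]
        simp_rw [hden, neg_mul]
        rw [integral_neg]
        simp_rw [mul_comm _ (((_ : ℝ) : ℂ) - p)⁻¹]
        rw [integral_kernel_mul_kernel_of_sign hσ hp (by simp; linarith), ← neg_div_neg_eq,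
          div_eq_mul_inv]
        have : -(p - ((s : ℂ) + (-κ : ℝ) * I)) = (s : ℂ) - (p + κ * I) := by push_cast; ring
        rw [this]
        ring
    _ = _ := by rw [integral_const_mul, cauchy]

theorem integral_conj_cauchy_mul_cauchy {σ : ℝ} (hσ : σ = 1 ∨ σ = -1) {a b : ℝ → ℂ}
    (ha : Integrable a) (hb : Integrable b) {κ κ' : ℝ} (hκ : 0 < σ * κ) (hκ' : 0 < σ * κ') :
    ∫ t : ℝ, conj (cauchy a (t + κ * I)) * cauchy b (t + κ' * I) =
      -(2 * Real.pi * I * σ) * ∫ s : ℝ, conj (a s) * cauchy b (s + (κ + κ' : ℝ) * I) := by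
  have hκ0 : κ ≠ 0 := by rintro rfl; simp at hκ
  have hκ0' : κ' ≠ 0 := by rintro rfl; simp at hκ'
  have hden : ∀ s t : ℝ, ((s : ℂ) - conj ((t : ℂ) + κ * I))⁻¹ = -((t : ℂ) - (s + κ * I))⁻¹ := by
    intro s t
    rw [← inv_neg]
    congr 1
    simp
    ring
  have hca : Integrable fun s => conj (a s) := by
    simpa using (Complex.conjCLE.toContinuousLinearMap.integrable_comp ha)
  have hint : Integrable (fun x : ℝ × ℝ => conj (a x.1) *
      (cauchy b (x.2 + κ' * I) * ((x.2 : ℂ) - (x.1 + κ * I))⁻¹)) (volume.prod volume) := by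
    refine integrable_mul_prod_of_bound hca (F := fun x : ℝ × ℝ =>
      cauchy b (x.2 + κ' * I) * ((x.2 : ℂ) - (x.1 + κ * I))⁻¹) ?_ ?_
      (C := (∫ t : ℝ, ‖cauchy b (t + κ' * I)‖ ^ 2) + Real.pi / |κ|) ?_
    · refine Continuous.mul ((continuous_cauchy_line hb hκ0').comp continuous_snd)
        (Continuous.inv₀ (by fun_prop) fun x => ?_)
      exact ofReal_sub_ne_zero (by simpa using hκ0) x.2
    · intro s
      have hz : ((s : ℂ) + κ * I).im ≠ 0 := by simpa using hκ0
      have h1 := MemLp.integrable_mul (p := 2) (q := 2)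
        (memLp_cauchy_line_of_integrable hb hκ0') (memLp_kernel hz)
      exact h1
    · intro s
      have hz : ((s : ℂ) + κ * I).im ≠ 0 := by simpa using hκ0
      refine (integral_norm_mul_le (memLp_cauchy_line_of_integrable hb hκ0')
        (memLp_kernel hz)).trans ?_
      rw [integral_norm_kernel_sq hz, im_ofReal_add_mul_I]
  calc ∫ t : ℝ, conj (cauchy a (t + κ * I)) * cauchy b (t + κ' * I)
      = ∫ t : ℝ, -∫ s : ℝ, conj (a s) *
          (cauchy b (t + κ' * I) * ((t : ℂ) - (s + κ * I))⁻¹) := by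
        refine integral_congr_ae (Eventually.of_forall fun t => ?_)
        simp only
        rw [conj_cauchy, cauchy, ← integral_mul_const, ← integral_neg]
        simp_rw [hden]
        refine integral_congr_ae (Eventually.of_forall fun s => ?_)
        simp only
        ring
    _ = -∫ s : ℝ, ∫ t : ℝ, conj (a s) *
          (cauchy b (t + κ' * I) * ((t : ℂ) - (s + κ * I))⁻¹) := by
        rw [integral_neg]
        congr 1
        exact (integral_integral_swap (f := fun s t : ℝ => conj (a s) *
          (cauchy b (t + κ' * I) * ((t : ℂ) - (s + κ * I))⁻¹)) hint).symm
    _ = -∫ s : ℝ, (2 * Real.pi * I * σ) * (conj (a s) * cauchy b (s + (κ + κ' : ℝ) * I)) := by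
        congr 1
        refine integral_congr_ae (Eventually.of_forall fun s => ?_)
        simp only
        rw [integral_const_mul, integral_cauchy_mul_kernel hσ hb hκ' (by simpa using hκ)]
        have : (s : ℂ) + κ * I + κ' * I = s + (κ + κ' : ℝ) * I := by push_cast; ring
        rw [this]
        ring
    _ = _ := by rw [integral_const_mul, neg_mul]

/-- The transform on horizontal lines is skew-symmetric. -/
theorem integral_conj_mul_cauchy {a b : ℝ → ℂ} (ha : Integrable a) (hb : Integrable b) {κ : ℝ}
    (hκ : κ ≠ 0) :
    ∫ t : ℝ, conj (a t) * cauchy b (t + κ * I) = -∫ t : ℝ, conj (cauchy a (t + κ * I)) * b t := by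
  have hca : Integrable fun s => conj (a s) := by
    simpa using (Complex.conjCLE.toContinuousLinearMap.integrable_comp ha)
  have hint : Integrable (fun x : ℝ × ℝ => conj (a x.1) * b x.2 *
      ((x.2 : ℂ) - (x.1 + κ * I))⁻¹) (volume.prod volume) := by
    refine (hca.mul_prod hb).mul_bdd (c := |κ|⁻¹) ?_ (Eventually.of_forall fun x => ?_)
    · refine Continuous.aestronglyMeasurable (Continuous.inv₀ (by fun_prop) fun x => ?_)
      exact ofReal_sub_ne_zero (by simpa using hκ) x.2
    · simpa using norm_kernel_le (z := (x.1 : ℂ) + κ * I) (by simpa using hκ) x.2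
  calc ∫ t : ℝ, conj (a t) * cauchy b (t + κ * I)
      = ∫ t : ℝ, ∫ s : ℝ, conj (a t) * b s * ((s : ℂ) - (t + κ * I))⁻¹ := by
        refine integral_congr_ae (Eventually.of_forall fun t => ?_)
        simp only [cauchy]
        rw [← integral_const_mul]
        simp_rw [mul_assoc]
    _ = ∫ s : ℝ, ∫ t : ℝ, conj (a t) * b s * ((s : ℂ) - (t + κ * I))⁻¹ :=
        integral_integral_swap (f := fun t s : ℝ =>
          conj (a t) * b s * ((s : ℂ) - (t + κ * I))⁻¹) hint
    _ = _ := by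
        rw [← integral_neg]
        refine integral_congr_ae (Eventually.of_forall fun s => ?_)
        simp only
        rw [conj_cauchy, cauchy, ← integral_mul_const, ← integral_neg]
        refine integral_congr_ae (Eventually.of_forall fun t => ?_)
        simp only
        have : ((t : ℂ) - conj ((s : ℂ) + κ * I))⁻¹ = -((s : ℂ) - (t + κ * I))⁻¹ := by
          rw [← inv_neg]
          congr 1
          simp
          ring
        rw [this]
        ring

end CauchyTransform

end

noncomputable section

namespace CauchyTransform

open Complex
open scoped ComplexConjugate ENNReal

/-! ### The Cauchy transform as an operator on `L²(ℝ)` -/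

/-- The Hilbert space `L²(ℝ)`. -/
abbrev L2R : Type := Lp ℂ 2 (volume : Measure ℝ)

theorem inner_toLp {f g : ℝ → ℂ} (hf : MemLp f 2) (hg : MemLp g 2) :
    inner ℂ (hf.toLp f) (hg.toLp g) = ∫ t, conj (f t) * g t := by
  rw [L2.inner_def]
  refine integral_congr_ae ?_
  filter_upwards [hf.coeFn_toLp, hg.coeFn_toLp] with t h1 h2
  rw [h1, h2, RCLike.inner_apply, mul_comm]

theorem inner_eq_integral (f g : L2R) : inner ℂ f g = ∫ t, conj (f t) * g t := by
  rw [L2.inner_def]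
  refine integral_congr_ae (Eventually.of_forall fun t => ?_)
  simp only [RCLike.inner_apply, mul_comm]

theorem norm_toLp_sq {f : ℝ → ℂ} (hf : MemLp f 2) : ‖hf.toLp f‖ ^ 2 = ∫ t, ‖f t‖ ^ 2 := by
  have h := inner_toLp hf hf
  rw [inner_self_eq_norm_sq_to_K] at h
  simp_rw [Complex.conj_mul'] at h
  apply Complex.ofReal_injective
  push_cast
  rw [← integral_complex_ofReal]
  simpa using h

theorem exists_sign {κ : ℝ} (hκ : κ ≠ 0) : ∃ σ : ℝ, (σ = 1 ∨ σ = -1) ∧ 0 < σ * κ := by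
  rcases hκ.lt_or_gt with h | h
  · exact ⟨-1, Or.inr rfl, by linarith⟩
  · exact ⟨1, Or.inl rfl, by linarith⟩

theorem le_of_sq_le_mul_succ {f : ℕ → ℝ} {c M : ℝ} (hc : 0 ≤ c)
    (h : ∀ n, f n ^ 2 ≤ c * f (n + 1)) (hM : ∀ n, f n ≤ M) : f 0 ≤ c := by
  by_contra! hlt
  rcases hc.eq_or_lt with rfl | hc
  · have := h 0
    nlinarith
  set r := f 0 / c with hr
  have hr1 : 1 < r := by rwa [hr, one_lt_div hc]
  have key : ∀ n, c * r ^ (n + 1) ≤ f n := by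
    intro n
    induction n with
    | zero =>
      rw [hr, zero_add, pow_one, mul_div_cancel₀ _ hc.ne']
    | succ n ih =>
      have h1 : (c * r ^ (n + 1)) ^ 2 ≤ c * f (n + 1) :=
        (pow_le_pow_left₀ (by positivity) ih 2).trans (h n)
      have h2 : c * r ^ (n + 2) ≤ c * (r ^ (n + 1)) ^ 2 := by
        rw [← pow_mul]
        gcongr
        · exact hr1.le
        · omega
      nlinarith
  obtain ⟨n, hn⟩ := pow_unbounded_of_one_lt (M / c) hr1
  have h3 := (key n).trans (hM n)
  rw [div_lt_iff₀ hc] at hn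
  have : r ^ n ≤ r ^ (n + 1) := pow_le_pow_right₀ hr1.le (by omega)
  nlinarith

theorem norm_toLp_cauchy_le {a : ℝ → ℂ} (ha : Integrable a) (ha2 : MemLp a 2) {κ : ℝ}
    (hκ : κ ≠ 0) :
    ‖(memLp_cauchy_line_of_integrable ha hκ).toLp _‖ ≤ 2 * Real.pi * ‖ha2.toLp a‖ := by
  obtain ⟨σ, hσ, hσκ⟩ := exists_sign hκ
  have hn : ∀ n : ℕ, 2 ^ n * κ ≠ 0 := fun n => by positivity
  set f : ℕ → ℝ := fun n => ‖(memLp_cauchy_line_of_integrable ha (hn n)).toLp _‖ with hf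
  have h0 : f 0 = ‖(memLp_cauchy_line_of_integrable ha hκ).toLp _‖ := by
    simp only [hf]
    congr 2
    simp
  rw [← h0]
  apply le_of_sq_le_mul_succ (M := √(Real.pi / |κ| * (∫ s, ‖a s‖) ^ 2)) (by positivity)
  · intro n
    have h1 := inner_toLp (memLp_cauchy_line_of_integrable ha (hn n))
      (memLp_cauchy_line_of_integrable ha (hn n))
    have hpos : 0 < σ * (2 ^ n * κ) := by
      have : (0 : ℝ) < 2 ^ n := by positivity
      nlinarith
    rw [integral_conj_cauchy_mul_cauchy hσ ha ha hpos hpos] at h1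
    have e : 2 ^ n * κ + 2 ^ n * κ = 2 ^ (n + 1) * κ := by ring
    rw [e, ← inner_toLp ha2 (memLp_cauchy_line_of_integrable ha (hn (n + 1)))] at h1
    have h2 := congrArg norm h1
    rw [inner_self_eq_norm_sq_to_K, norm_mul] at h2
    have h3 : ‖-(2 * (Real.pi : ℂ) * I * σ)‖ = 2 * Real.pi := by
      have : |σ| = 1 := by rcases hσ with rfl | rfl <;> simp
      simp [this, abs_of_pos Real.pi_pos]
    have h4 : f n ^ 2 = 2 * Real.pi * ‖inner ℂ (ha2.toLp a)
        ((memLp_cauchy_line_of_integrable ha (hn (n + 1))).toLp _)‖ := by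
      rw [← h3, ← h2]
      simp [hf]
    have h5 := norm_inner_le_norm (𝕜 := ℂ) (ha2.toLp a)
      ((memLp_cauchy_line_of_integrable ha (hn (n + 1))).toLp _)
    rw [h4, mul_assoc _ ‖ha2.toLp a‖]
    exact mul_le_mul_of_nonneg_left h5 (by positivity)
  · intro n
    apply Real.le_sqrt_of_sq_le
    rw [hf, norm_toLp_sq]
    refine (integral_norm_cauchy_sq_le ha (hn n)).trans ?_
    have h1 : |κ| ≤ |2 ^ n * κ| := by
      rw [abs_mul, abs_of_pos (by positivity : (0 : ℝ) < 2 ^ n)]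
      exact le_mul_of_one_le_left (abs_nonneg _) (one_le_pow₀ (by norm_num))
    have h2 : 0 < |κ| := abs_pos.mpr hκ
    gcongr

theorem eLpNorm_cauchy_line_le_of_integrable {a : ℝ → ℂ} (ha : Integrable a) (ha2 : MemLp a 2)
    {κ : ℝ} (hκ : κ ≠ 0) :
    eLpNorm (fun t : ℝ => cauchy a (t + κ * I)) 2 volume ≤
      ENNReal.ofReal (2 * Real.pi) * eLpNorm a 2 volume := by
  have h := norm_toLp_cauchy_le ha ha2 hκ
  rw [Lp.norm_toLp, Lp.norm_toLp] at h
  rw [← ENNReal.ofReal_toReal (memLp_cauchy_line_of_integrable ha hκ).2.ne,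
    ← ENNReal.ofReal_toReal ha2.2.ne, ← ENNReal.ofReal_mul (by positivity)]
  exact ENNReal.ofReal_le_ofReal h

theorem tendsto_cauchy_indicator {a : ℝ → ℂ} (ha : MemLp a 2) {z : ℂ} (hz : z.im ≠ 0) :
    Tendsto (fun n : ℕ => cauchy ((Icc (-n : ℝ) n).indicator a) z) atTop (𝓝 (cauchy a z)) := by
  refine tendsto_integral_of_dominated_convergence (fun s => ‖a s * ((s : ℂ) - z)⁻¹‖)
    (fun n => ?_) (integrable_mul_kernel_of_memLp ha hz).norm (fun n => ?_) ?_
  · exact (ha.1.indicator measurableSet_Icc).mul (continuous_kernel hz).aestronglyMeasurable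
  · filter_upwards with s
    rw [norm_mul, norm_mul]
    gcongr
    exact norm_indicator_le_norm_self _ _
  · filter_upwards with s
    refine tendsto_const_nhds.congr' ?_
    obtain ⟨N, hN⟩ := exists_nat_ge |s|
    filter_upwards [eventually_ge_atTop N] with n hn
    have : |s| ≤ n := hN.trans (by exact_mod_cast hn)
    rw [indicator_of_mem (show s ∈ Icc (-n : ℝ) n from abs_le.mp this)]

theorem memLp_cauchy_line_and_le {a : ℝ → ℂ} (ha : MemLp a 2) {κ : ℝ} (hκ : κ ≠ 0) :
    MemLp (fun t : ℝ => cauchy a (t + κ * I)) 2 ∧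
      eLpNorm (fun t : ℝ => cauchy a (t + κ * I)) 2 volume ≤
        ENNReal.ofReal (2 * Real.pi) * eLpNorm a 2 volume := by
  have hi : ∀ n : ℕ, Integrable ((Icc (-n : ℝ) n).indicator a) := by
    intro n
    rw [integrable_indicator_iff measurableSet_Icc]
    have : MemLp a 2 (volume.restrict (Icc (-n : ℝ) n)) := ha.restrict _
    exact this.integrable (by norm_num)
  have hi2 : ∀ n : ℕ, MemLp ((Icc (-n : ℝ) n).indicator a) 2 := fun n =>
    ha.indicator measurableSet_Icc
  have hlim : ∀ t : ℝ, Tendsto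
      (fun n : ℕ => cauchy ((Icc (-n : ℝ) n).indicator a) (t + κ * I)) atTop
      (𝓝 (cauchy a (t + κ * I))) := fun t => tendsto_cauchy_indicator ha (by simpa using hκ)
  have hm : ∀ n : ℕ, AEStronglyMeasurable
      (fun t : ℝ => cauchy ((Icc (-n : ℝ) n).indicator a) (t + κ * I)) volume := fun n =>
    (continuous_cauchy_line (hi n) hκ).aestronglyMeasurable
  have hle : eLpNorm (fun t : ℝ => cauchy a (t + κ * I)) 2 volume ≤
      ENNReal.ofReal (2 * Real.pi) * eLpNorm a 2 volume := by
    refine (Lp.eLpNorm_lim_le_liminf_eLpNorm hm _ (Eventually.of_forall hlim)).trans ?_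
    refine (liminf_le_liminf (v := fun _ => ENNReal.ofReal (2 * Real.pi) * eLpNorm a 2 volume)
      (Eventually.of_forall fun n => ?_)).trans (by simp)
    refine (eLpNorm_cauchy_line_le_of_integrable (hi n) (hi2 n) hκ).trans ?_
    gcongr
    exact eLpNorm_indicator_le _
  refine ⟨⟨aestronglyMeasurable_of_tendsto_ae _ hm (Eventually.of_forall hlim),
    hle.trans_lt ?_⟩, hle⟩
  exact ENNReal.mul_lt_top ENNReal.ofReal_lt_top ha.2

theorem memLp_cauchy_line {a : ℝ → ℂ} (ha : MemLp a 2) {κ : ℝ} (hκ : κ ≠ 0) :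
    MemLp (fun t : ℝ => cauchy a (t + κ * I)) 2 := (memLp_cauchy_line_and_le ha hκ).1

theorem cauchy_add {a b : ℝ → ℂ} (ha : MemLp a 2) (hb : MemLp b 2) {z : ℂ} (hz : z.im ≠ 0) :
    cauchy (fun s => a s + b s) z = cauchy a z + cauchy b z := by
  rw [cauchy, cauchy, cauchy, ← integral_add (integrable_mul_kernel_of_memLp ha hz)
    (integrable_mul_kernel_of_memLp hb hz)]
  simp_rw [add_mul]

theorem cauchy_const_mul (c : ℂ) (a : ℝ → ℂ) (z : ℂ) :
    cauchy (fun s => c * a s) z = c * cauchy a z := by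
  rw [cauchy, cauchy, ← integral_const_mul]
  simp_rw [mul_assoc]

/-- The operator `a ↦ cauchy a (· + iκ)` on `L²(ℝ)` for `κ ≠ 0`. -/
def lineOp {κ : ℝ} (hκ : κ ≠ 0) : L2R →L[ℂ] L2R :=
  LinearMap.mkContinuous
    { toFun := fun a => (memLp_cauchy_line (Lp.memLp a) hκ).toLp _
      map_add' := by
        intro a b
        rw [← MemLp.toLp_add]
        refine MemLp.toLp_congr _ _ (Eventually.of_forall fun t => ?_)
        simp only [Pi.add_apply]
        rw [← cauchy_add (Lp.memLp a) (Lp.memLp b) (by simpa using hκ)]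
        exact cauchy_congr (Lp.coeFn_add a b) _
      map_smul' := by
        intro c a
        rw [RingHom.id_apply, ← MemLp.toLp_const_smul]
        refine MemLp.toLp_congr _ _ (Eventually.of_forall fun t => ?_)
        simp only [Pi.smul_apply, smul_eq_mul]
        rw [← cauchy_const_mul]
        exact cauchy_congr (Lp.coeFn_smul c a) _ }
    (2 * Real.pi) (by
      intro a
      simp only [LinearMap.coe_mk, AddHom.coe_mk]
      rw [Lp.norm_toLp, Lp.norm_def]
      have h := (memLp_cauchy_line_and_le (Lp.memLp a) hκ).2
      have h' := ENNReal.toReal_mono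
        (ENNReal.mul_lt_top ENNReal.ofReal_lt_top (Lp.memLp a).2).ne h
      rwa [ENNReal.toReal_mul, ENNReal.toReal_ofReal (by positivity)] at h')

theorem coeFn_lineOp {κ : ℝ} (hκ : κ ≠ 0) (a : L2R) :
    lineOp hκ a =ᵐ[volume] fun t : ℝ => cauchy a (t + κ * I) :=
  MemLp.coeFn_toLp (memLp_cauchy_line (Lp.memLp a) hκ)

theorem lineOp_toLp {κ : ℝ} (hκ : κ ≠ 0) {a : ℝ → ℂ} (ha : MemLp a 2) :
    lineOp hκ (ha.toLp a) = (memLp_cauchy_line ha hκ).toLp _ :=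
  MemLp.toLp_congr (memLp_cauchy_line (Lp.memLp (ha.toLp a)) hκ) _
    (Eventually.of_forall fun _ => cauchy_congr ha.coeFn_toLp _)

theorem norm_lineOp_le {κ : ℝ} (hκ : κ ≠ 0) (a : L2R) : ‖lineOp hκ a‖ ≤ 2 * Real.pi * ‖a‖ :=
  (ContinuousLinearMap.le_opNorm _ _).trans (by
    gcongr
    exact LinearMap.mkContinuous_norm_le _ (by positivity) _)

theorem dense_continuous_compact : Dense {a : L2R | ∃ (g : ℝ → ℂ) (hg : MemLp g 2),
    Continuous g ∧ HasCompactSupport g ∧ a = hg.toLp g} := by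
  rw [Metric.dense_iff]
  intro a r hr
  obtain ⟨g, hg1, hg2, hg3, hg4⟩ := (Lp.memLp a).exists_hasCompactSupport_eLpNorm_sub_le
    (by norm_num) (ε := ENNReal.ofReal (r / 2)) (by positivity)
  refine ⟨hg4.toLp g, ?_, g, hg4, hg3, hg1, rfl⟩
  rw [Metric.mem_ball, dist_comm]
  have : dist a (hg4.toLp g) = (eLpNorm (⇑a - g) 2 volume).toReal := by
    rw [Lp.dist_def]
    congr 1
    exact eLpNorm_congr_ae (EventuallyEq.rfl.sub hg4.coeFn_toLp)
  rw [this]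
  have h := ENNReal.toReal_mono ENNReal.ofReal_ne_top hg2
  rw [ENNReal.toReal_ofReal (by positivity)] at h
  linarith

theorem dense_integrable : Dense {a : L2R | ∃ (g : ℝ → ℂ) (hg : MemLp g 2),
    Integrable g ∧ a = hg.toLp g} := by
  refine dense_continuous_compact.mono ?_
  rintro a ⟨g, hg, hg1, hg2, rfl⟩
  exact ⟨g, hg, hg1.integrable_of_hasCompactSupport hg2, rfl⟩

theorem inner_lineOp_lineOp {σ : ℝ} (hσ : σ = 1 ∨ σ = -1) {κ κ' : ℝ} (hκ : κ ≠ 0) (hκ' : κ' ≠ 0)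
    (hs : κ + κ' ≠ 0) (h : 0 < σ * κ) (h' : 0 < σ * κ') (a b : L2R) :
    inner ℂ (lineOp hκ a) (lineOp hκ' b) =
      -(2 * Real.pi * I * σ) * inner ℂ a (lineOp hs b) := by
  refine dense_integrable.induction (P := fun a => ∀ b, inner ℂ (lineOp hκ a) (lineOp hκ' b) =
      -(2 * Real.pi * I * σ) * inner ℂ a (lineOp hs b)) ?_ ?_ a b
  · rintro _ ⟨f, hf, hfi, rfl⟩ b
    refine dense_integrable.induction (P := fun b => inner ℂ (lineOp hκ (hf.toLp f)) (lineOp hκ' b) =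
      -(2 * Real.pi * I * σ) * inner ℂ (hf.toLp f) (lineOp hs b)) ?_ ?_ b
    · rintro _ ⟨g, hg, hgi, rfl⟩
      rw [lineOp_toLp, lineOp_toLp, lineOp_toLp, inner_toLp, inner_toLp,
        integral_conj_cauchy_mul_cauchy hσ hfi hgi h h']
    · exact isClosed_eq (by fun_prop) (by fun_prop)
  · rw [ofPred_forall]
    exact isClosed_iInter fun b => isClosed_eq (by fun_prop) (by fun_prop)

theorem inner_lineOp_left {κ : ℝ} (hκ : κ ≠ 0) (a b : L2R) :
    inner ℂ (lineOp hκ a) b = -inner ℂ a (lineOp hκ b) := by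
  refine dense_integrable.induction (P := fun a => ∀ b, inner ℂ (lineOp hκ a) b =
      -inner ℂ a (lineOp hκ b)) ?_ ?_ a b
  · rintro _ ⟨f, hf, hfi, rfl⟩ b
    refine dense_integrable.induction (P := fun b => inner ℂ (lineOp hκ (hf.toLp f)) b =
      -inner ℂ (hf.toLp f) (lineOp hκ b)) ?_ ?_ b
    · rintro _ ⟨g, hg, hgi, rfl⟩
      rw [lineOp_toLp, lineOp_toLp, inner_toLp, inner_toLp,
        integral_conj_mul_cauchy hfi hgi hκ, neg_neg]
    · exact isClosed_eq (by fun_prop) (by fun_prop)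
  · rw [ofPred_forall]
    exact isClosed_iInter fun b => isClosed_eq (by fun_prop) (by fun_prop)

theorem lineOp_lineOp {σ : ℝ} (hσ : σ = 1 ∨ σ = -1) {κ κ' : ℝ} (hκ : κ ≠ 0) (hκ' : κ' ≠ 0)
    (hs : κ + κ' ≠ 0) (h : 0 < σ * κ) (h' : 0 < σ * κ') (b : L2R) :
    lineOp hκ (lineOp hκ' b) = (2 * Real.pi * I * σ) • lineOp hs b := by
  refine ext_inner_left ℂ fun a => ?_
  rw [inner_smul_right, ← neg_inj, ← inner_lineOp_left, inner_lineOp_lineOp hσ hκ hκ' hs h h',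
    neg_mul]

/-! ### Boundary values in `L²(ℝ)` -/

open Classical in
/-- `lineOp` at `σ ε`, extended by `0` to `ε = 0`. -/
def lineOp' (κ : ℝ) : L2R →L[ℂ] L2R := if h : κ ≠ 0 then lineOp h else 0

theorem lineOp'_eq {κ : ℝ} (h : κ ≠ 0) : lineOp' κ = lineOp h := by rw [lineOp', dif_pos h]

theorem sign_mul_ne_zero {σ : ℝ} (hσ : σ = 1 ∨ σ = -1) {ε : ℝ} (hε : 0 < ε) : σ * ε ≠ 0 := by
  rcases hσ with rfl | rfl <;> simpa using hε.ne'

theorem sign_mul_mul_pos {σ : ℝ} (hσ : σ = 1 ∨ σ = -1) {ε : ℝ} (hε : 0 < ε) :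
    0 < σ * (σ * ε) := by
  rcases hσ with rfl | rfl <;> simpa using hε

theorem norm_two_pi_I_sign {σ : ℝ} (hσ : σ = 1 ∨ σ = -1) :
    ‖2 * (Real.pi : ℂ) * I * σ‖ = 2 * Real.pi := by
  have : |σ| = 1 := by rcases hσ with rfl | rfl <;> simp
  simp [this, abs_of_pos Real.pi_pos]

theorem inner_lineOp'_lineOp' {σ : ℝ} (hσ : σ = 1 ∨ σ = -1) {ε ε' : ℝ} (hε : 0 < ε)
    (hε' : 0 < ε') (a b : L2R) :
    inner ℂ (lineOp' (σ * ε) a) (lineOp' (σ * ε') b) =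
      -(2 * Real.pi * I * σ) * inner ℂ a (lineOp' (σ * (ε + ε')) b) := by
  rw [lineOp'_eq (sign_mul_ne_zero hσ hε), lineOp'_eq (sign_mul_ne_zero hσ hε'),
    lineOp'_eq (sign_mul_ne_zero hσ (add_pos hε hε')),
    inner_lineOp_lineOp hσ _ _ (by rw [← mul_add]; exact sign_mul_ne_zero hσ (add_pos hε hε'))
      (sign_mul_mul_pos hσ hε) (sign_mul_mul_pos hσ hε')]
  congr 3
  simp only [mul_add]

theorem norm_lineOp'_add_le {σ : ℝ} (hσ : σ = 1 ∨ σ = -1) {ε ε' : ℝ} (hε : 0 < ε)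
    (hε' : 0 < ε') (a : L2R) : ‖lineOp' (σ * (ε + ε')) a‖ ≤ ‖lineOp' (σ * ε) a‖ := by
  have hs : σ * ε' + σ * ε ≠ 0 := by
    rw [← mul_add]; exact sign_mul_ne_zero hσ (add_pos hε' hε)
  have h := lineOp_lineOp hσ (sign_mul_ne_zero hσ hε') (sign_mul_ne_zero hσ hε) hs
      (sign_mul_mul_pos hσ hε') (sign_mul_mul_pos hσ hε) a
  have h1 := norm_lineOp_le (sign_mul_ne_zero hσ hε') (lineOp (sign_mul_ne_zero hσ hε) a)
  rw [h, norm_smul, norm_two_pi_I_sign hσ] at h1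
  have h2 := le_of_mul_le_mul_left h1 (by positivity)
  have e : σ * (ε + ε') = σ * ε' + σ * ε := by ring
  rw [e, lineOp'_eq hs, lineOp'_eq (sign_mul_ne_zero hσ hε)]
  exact h2

theorem exists_tendsto_norm_lineOp' {σ : ℝ} (hσ : σ = 1 ∨ σ = -1) (a : L2R) :
    ∃ l : ℝ, Tendsto (fun ε => ‖lineOp' (σ * ε) a‖) (𝓝[>] 0) (𝓝 l) := by
  refine ⟨_, AntitoneOn.tendsto_nhdsGT (α := ℝ) (f := fun ε => ‖lineOp' (σ * ε) a‖) (x := 0)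
    ?_ ?_⟩
  · intro x hx y hy hxy
    rcases hxy.eq_or_lt with rfl | hxy
    · rfl
    have := norm_lineOp'_add_le hσ hx (sub_pos.mpr hxy) a
    simpa using this
  · refine ⟨2 * Real.pi * ‖a‖, ?_⟩
    rintro _ ⟨ε, hε, rfl⟩
    simp only
    rw [lineOp'_eq (sign_mul_ne_zero hσ hε)]
    exact norm_lineOp_le _ a

theorem norm_lineOp'_sub_sq {σ : ℝ} (hσ : σ = 1 ∨ σ = -1) {ε ε' : ℝ} (hε : 0 < ε)
    (hε' : 0 < ε') (a : L2R) :
    ‖lineOp' (σ * ε) a - lineOp' (σ * ε') a‖ ^ 2 = ‖lineOp' (σ * ε) a‖ ^ 2 +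
      ‖lineOp' (σ * ε') a‖ ^ 2 - 2 * ‖lineOp' (σ * ((ε + ε') / 2)) a‖ ^ 2 := by
  have h1 : inner ℂ (lineOp' (σ * ε) a) (lineOp' (σ * ε') a) =
      ((‖lineOp' (σ * ((ε + ε') / 2)) a‖ ^ 2 : ℝ) : ℂ) := by
    rw [inner_lineOp'_lineOp' hσ hε hε']
    have h2 : 0 < (ε + ε') / 2 := by linarith
    have := inner_lineOp'_lineOp' hσ h2 h2 a a
    rw [add_halves, inner_self_eq_norm_sq_to_K] at this
    rw [← this]
    simp
  rw [@norm_sub_sq ℂ, h1]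
  simp only [RCLike.re_to_complex, ofReal_re]
  ring

theorem exists_tendsto_lineOp' {σ : ℝ} (hσ : σ = 1 ∨ σ = -1) (a : L2R) :
    ∃ b : L2R, Tendsto (fun ε => lineOp' (σ * ε) a) (𝓝[>] 0) (𝓝 b) := by
  obtain ⟨l, hl⟩ := exists_tendsto_norm_lineOp' hσ a
  apply cauchy_map_iff_exists_tendsto.mp
  rw [cauchy_map_iff]
  refine ⟨inferInstance, ?_⟩
  rw [tendsto_uniformity_iff_dist_tendsto_zero]
  have hmid : Tendsto (fun p : ℝ × ℝ => (p.1 + p.2) / 2) (𝓝[>] 0 ×ˢ 𝓝[>] 0) (𝓝[>] 0) := by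
    rw [tendsto_nhdsWithin_iff]
    constructor
    · have h1 : Tendsto (fun p : ℝ × ℝ => (p.1 + p.2) / 2) (𝓝 0 ×ˢ 𝓝 0) (𝓝 ((0 + 0) / 2)) :=
        (tendsto_fst.add tendsto_snd).div_const 2
      simp only [add_zero, zero_div] at h1
      exact h1.mono_left (Filter.prod_mono nhdsWithin_le_nhds nhdsWithin_le_nhds)
    · filter_upwards [prod_mem_prod self_mem_nhdsWithin self_mem_nhdsWithin] with p hp
      have h1 : 0 < p.1 := hp.1
      have h2 : 0 < p.2 := hp.2
      simp only [mem_Ioi]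
      linarith
  have hsq : Tendsto (fun p : ℝ × ℝ => ‖lineOp' (σ * p.1) a - lineOp' (σ * p.2) a‖ ^ 2)
      (𝓝[>] 0 ×ˢ 𝓝[>] 0) (𝓝 0) := by
    have h := (((hl.comp tendsto_fst).pow 2).add ((hl.comp tendsto_snd).pow 2)).sub
      (((hl.comp hmid).pow 2).const_mul 2)
    have e : l ^ 2 + l ^ 2 - 2 * l ^ 2 = 0 := by ring
    rw [e] at h
    refine h.congr' ?_
    filter_upwards [prod_mem_prod self_mem_nhdsWithin self_mem_nhdsWithin] with p hp
    exact (norm_lineOp'_sub_sq hσ hp.1 hp.2 a).symm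
  have := hsq.sqrt
  simpa [dist_eq_norm] using this

/-- The boundary operator `lim_{ε ↓ 0} lineOp (σ ε)`. -/
def bdryOp (σ : ℝ) (hσ : σ = 1 ∨ σ = -1) : L2R →L[ℂ] L2R :=
  continuousLinearMapOfTendsto (l := 𝓝[>] (0 : ℝ)) (fun ε => lineOp' (σ * ε))
    (f := fun a => (exists_tendsto_lineOp' hσ a).choose)
    (tendsto_pi_nhds.mpr fun a => (exists_tendsto_lineOp' hσ a).choose_spec)

theorem tendsto_lineOp' {σ : ℝ} (hσ : σ = 1 ∨ σ = -1) (a : L2R) :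
    Tendsto (fun ε => lineOp' (σ * ε) a) (𝓝[>] 0) (𝓝 (bdryOp σ hσ a)) :=
  (exists_tendsto_lineOp' hσ a).choose_spec

theorem inner_bdryOp_left {σ : ℝ} (hσ : σ = 1 ∨ σ = -1) (a b : L2R) :
    inner ℂ (bdryOp σ hσ a) b = -inner ℂ a (bdryOp σ hσ b) := by
  refine tendsto_nhds_unique ((tendsto_lineOp' hσ a).inner (𝕜 := ℂ) tendsto_const_nhds)
    (((tendsto_const_nhds.inner (𝕜 := ℂ) (tendsto_lineOp' hσ b)).neg).congr' ?_)
  filter_upwards [self_mem_nhdsWithin] with ε hε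
  rw [lineOp'_eq (sign_mul_ne_zero hσ hε), inner_lineOp_left]

end CauchyTransform

end

noncomputable section

namespace CauchyTransform

open Complex
open scoped ComplexConjugate ENNReal NNReal

/-! ### Pointwise boundary values -/

/-- Lipschitz integrable functions vanishing at infinity. -/
structure Nice (ρ : ℝ → ℂ) : Prop where
  lip : ∃ K, LipschitzWith K ρ
  int : Integrable ρ
  zero : Tendsto ρ (cocompact ℝ) (𝓝 0)

/-- The integrand of the Cauchy transform at `s + iσε`, regularised at `s`. -/
def regIntegrand (ρ : ℝ → ℂ) (σ s ε t : ℝ) : ℂ :=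
  (ρ t - (Icc (s - 1) (s + 1)).indicator (fun _ => ρ s) t) *
    ((t : ℂ) - (s + (σ * ε : ℝ) * I))⁻¹

/-- The integral over `[-1, 1]` of `r ↦ (r - iσε)⁻¹`. -/
def singularPart (σ ε : ℝ) : ℂ :=
  σ * Real.pi * I + (log (1 - (σ * ε : ℝ) * I) - log (1 + (σ * ε : ℝ) * I))

/-- The continuous extension of the Cauchy transform to a closed half-plane. -/
def cauchyExt (ρ : ℝ → ℂ) (σ s ε : ℝ) : ℂ :=
  (∫ t, regIntegrand ρ σ s ε t) + ρ s * singularPart σ ε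

/-- The boundary values of the Cauchy transform from the half-plane `σ Im z > 0`. -/
def cauchyBdry (ρ : ℝ → ℂ) (σ s : ℝ) : ℂ := cauchyExt ρ σ s 0

theorem integral_kernel_Icc {σ : ℝ} (hσ : σ = 1 ∨ σ = -1) {ε : ℝ} (hε : 0 < ε) (s : ℝ) :
    ∫ t in Icc (s - 1) (s + 1), ((t : ℂ) - (s + (σ * ε : ℝ) * I))⁻¹ = singularPart σ ε := by
  rw [integral_Icc_eq_integral_Ioc, ← intervalIntegral.integral_of_le (by linarith)]
  have hne := sign_mul_ne_zero hσ hε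
  have hd : ∀ t ∈ uIcc (s - 1) (s + 1), HasDerivAt
      (fun t : ℝ => log ((t : ℂ) - (s + (σ * ε : ℝ) * I)))
      (((t : ℂ) - (s + (σ * ε : ℝ) * I))⁻¹) t := by
    intro t _
    have := (((hasDerivAt_id t).ofReal_comp).sub_const ((s : ℂ) + (σ * ε : ℝ) * I)).clog_real
      (by rw [mem_slitPlane_iff]; right; simpa using hne)
    simpa using this
  rw [intervalIntegral.integral_eq_sub_of_hasDerivAt hd
    ((continuous_kernel (by simpa using hne)).intervalIntegrable _ _)]
  have e1 : (((s + 1 : ℝ) : ℂ) - (s + (σ * ε : ℝ) * I)) = 1 - (σ * ε : ℝ) * I := by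
    push_cast; ring
  have e2 : (((s - 1 : ℝ) : ℂ) - (s + (σ * ε : ℝ) * I)) = -(1 + (σ * ε : ℝ) * I) := by
    push_cast; ring
  have e3 : log (-(1 + (σ * ε : ℝ) * I)) = log (1 + (σ * ε : ℝ) * I) - σ * Real.pi * I := by
    rcases hσ with rfl | rfl
    · rw [Complex.log, Complex.log, Complex.arg_neg_eq_arg_sub_pi_of_im_pos (by simpa using hε),
        norm_neg]
      push_cast
      ring
    · rw [Complex.log, Complex.log, Complex.arg_neg_eq_arg_add_pi_of_im_neg (by simpa using hε),
        norm_neg]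
      push_cast
      ring
  rw [e1, e2, e3, singularPart]
  ring

theorem cauchy_eq_cauchyExt {ρ : ℝ → ℂ} (hρ : Integrable ρ) {σ : ℝ} (hσ : σ = 1 ∨ σ = -1) {ε : ℝ}
    (hε : 0 < ε) (s : ℝ) : cauchy ρ (s + (σ * ε : ℝ) * I) = cauchyExt ρ σ s ε := by
  have hz : ((s : ℂ) + (σ * ε : ℝ) * I).im ≠ 0 := by
    rw [im_ofReal_add_mul_I]; exact sign_mul_ne_zero hσ hε
  have hi1 := integrable_mul_kernel hρ hz
  have hi2 : Integrable ((Icc (s - 1) (s + 1)).indicator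
      fun t : ℝ => ρ s * ((t : ℂ) - (s + (σ * ε : ℝ) * I))⁻¹) := by
    rw [integrable_indicator_iff measurableSet_Icc]
    exact ((continuous_kernel hz).const_mul _).integrableOn_Icc
  have e : ∀ t, regIntegrand ρ σ s ε t = ρ t * ((t : ℂ) - (s + (σ * ε : ℝ) * I))⁻¹ -
      (Icc (s - 1) (s + 1)).indicator
        (fun t : ℝ => ρ s * ((t : ℂ) - (s + (σ * ε : ℝ) * I))⁻¹) t := by
    intro t
    rw [regIntegrand, sub_mul]
    congr 1
    by_cases ht : t ∈ Icc (s - 1) (s + 1) <;> simp [ht]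
  rw [cauchyExt]
  simp_rw [e]
  rw [integral_sub hi1 hi2, integral_indicator measurableSet_Icc, integral_const_mul,
    integral_kernel_Icc hσ hε, cauchy]
  ring

theorem norm_regIntegrand_le {ρ : ℝ → ℂ} {K : ℝ≥0} (hK : LipschitzWith K ρ) (σ s ε t : ℝ) :
    ‖regIntegrand ρ σ s ε t‖ ≤ (Icc (s - 1) (s + 1)).indicator (fun _ => (K : ℝ)) t + ‖ρ t‖ := by
  rw [regIntegrand, norm_mul, norm_inv]
  have h1 : |t - s| ≤ ‖(t : ℂ) - (s + (σ * ε : ℝ) * I)‖ := by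
    simpa using Complex.abs_re_le_norm ((t : ℂ) - (s + (σ * ε : ℝ) * I))
  by_cases ht : t ∈ Icc (s - 1) (s + 1)
  · rw [indicator_of_mem ht, indicator_of_mem ht]
    have h2 : ‖ρ t - ρ s‖ ≤ K * |t - s| := by
      simpa [dist_eq_norm, Real.dist_eq] using hK.dist_le_mul t s
    rcases eq_or_ne t s with rfl | hts
    · simp only [sub_self, norm_zero, zero_mul]
      positivity
    have h3 : 0 < |t - s| := abs_pos.mpr (sub_ne_zero.mpr hts)
    have h4 : 0 < ‖(t : ℂ) - (s + (σ * ε : ℝ) * I)‖ := h3.trans_le h1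
    have : ‖ρ t - ρ s‖ * ‖(t : ℂ) - (s + (σ * ε : ℝ) * I)‖⁻¹ ≤ K := by
      rw [← div_eq_mul_inv, div_le_iff₀ h4]
      exact h2.trans (by gcongr)
    linarith [norm_nonneg (ρ t)]
  · rw [indicator_of_notMem ht, indicator_of_notMem ht, sub_zero, zero_add]
    have h2 : 1 ≤ |t - s| := by
      by_contra! h
      rw [abs_lt] at h
      exact ht ⟨by linarith, by linarith⟩
    exact mul_le_of_le_one_right (norm_nonneg _) (inv_le_one_of_one_le₀ (h2.trans h1))

theorem measurable_regIntegrand {ρ : ℝ → ℂ} (hρ : Continuous ρ) (σ s ε : ℝ) :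
    Measurable (regIntegrand ρ σ s ε) := by
  unfold regIntegrand
  have := hρ.measurable
  exact (this.sub (measurable_const.indicator measurableSet_Icc)).mul (by fun_prop)

theorem continuous_singularPart (σ : ℝ) : Continuous (singularPart σ) := by
  unfold singularPart
  refine continuous_const.add (Continuous.sub ?_ ?_)
  · exact Continuous.clog (by fun_prop) fun ε => by rw [mem_slitPlane_iff]; left; simp
  · exact Continuous.clog (by fun_prop) fun ε => by rw [mem_slitPlane_iff]; left; simp

theorem singularPart_zero (σ : ℝ) : singularPart σ 0 = σ * Real.pi * I := by
  simp [singularPart]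

theorem continuous_cauchyExt {ρ : ℝ → ℂ} (hρ : Nice ρ) {σ : ℝ} :
    Continuous fun p : ℝ × ℝ => cauchyExt ρ σ p.1 p.2 := by
  obtain ⟨K, hK⟩ := hρ.lip
  have hc := hK.continuous
  unfold cauchyExt
  refine Continuous.add ?_ ((hc.comp continuous_fst).mul
    ((continuous_singularPart σ).comp continuous_snd))
  rw [continuous_iff_continuousAt]
  rintro ⟨s₀, ε₀⟩
  refine tendsto_integral_filter_of_dominated_convergence
    (fun t => (Icc (s₀ - 2) (s₀ + 2)).indicator (fun _ => (K : ℝ)) t + ‖ρ t‖) ?_ ?_ ?_ ?_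
  · exact Eventually.of_forall fun p => (measurable_regIntegrand hc σ p.1 p.2).aestronglyMeasurable
  · have : ∀ᶠ p : ℝ × ℝ in 𝓝 (s₀, ε₀), p.1 ∈ Ioo (s₀ - 1) (s₀ + 1) :=
      continuous_fst.continuousAt.eventually_mem (Ioo_mem_nhds (by simp) (by simp))
    filter_upwards [this] with p hp
    refine Eventually.of_forall fun t => (norm_regIntegrand_le hK σ p.1 p.2 t).trans ?_
    refine add_le_add ?_ le_rfl
    refine indicator_le_indicator_of_subset ?_ (fun _ => K.coe_nonneg) t
    exact Icc_subset_Icc (by linarith [hp.1]) (by linarith [hp.2])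
  · refine Integrable.add ?_ hρ.int.norm
    rw [integrable_indicator_iff measurableSet_Icc]
    simp [integrableOn_const_iff]
  · have h0 : ∀ᵐ t : ℝ, t ≠ s₀ ∧ t ≠ s₀ - 1 ∧ t ≠ s₀ + 1 := by
      have : ∀ x : ℝ, ∀ᵐ t : ℝ, t ≠ x := fun x => by
        simp [ae_iff, measure_singleton]
      filter_upwards [this s₀, this (s₀ - 1), this (s₀ + 1)] with t h1 h2 h3
      exact ⟨h1, h2, h3⟩
    filter_upwards [h0] with t ⟨h1, h2, h3⟩
    unfold regIntegrand
    refine Tendsto.mul ?_ ?_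
    · refine Tendsto.sub tendsto_const_nhds ?_
      have hfst : Tendsto (fun p : ℝ × ℝ => p.1) (𝓝 (s₀, ε₀)) (𝓝 s₀) :=
        continuous_fst.continuousAt
      by_cases ht : t ∈ Icc (s₀ - 1) (s₀ + 1)
      · have ht' : s₀ - 1 < t ∧ t < s₀ + 1 :=
          ⟨lt_of_le_of_ne ht.1 (Ne.symm h2), lt_of_le_of_ne ht.2 h3⟩
        have hev : ∀ᶠ p : ℝ × ℝ in 𝓝 (s₀, ε₀), p.1 ∈ Ioo (t - 1) (t + 1) :=
          hfst.eventually_mem (Ioo_mem_nhds (by linarith) (by linarith))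
        rw [indicator_of_mem ht]
        refine ((hc.tendsto s₀).comp hfst).congr' ?_
        filter_upwards [hev] with p hp
        have : t ∈ Icc (p.1 - 1) (p.1 + 1) := ⟨by linarith [hp.2], by linarith [hp.1]⟩
        rw [indicator_of_mem this]
        rfl
      · rw [indicator_of_notMem ht]
        refine tendsto_const_nhds.congr' ?_
        have : t < s₀ - 1 ∨ s₀ + 1 < t := by
          by_contra! h
          exact ht h
        rcases this with h | h
        · have hev : ∀ᶠ p : ℝ × ℝ in 𝓝 (s₀, ε₀), p.1 ∈ Ioi (t + 1) :=
            hfst.eventually_mem (Ioi_mem_nhds (by linarith))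
          filter_upwards [hev] with p hp
          rw [indicator_of_notMem]
          rintro ⟨h4, h5⟩
          rw [mem_Ioi] at hp
          linarith
        · have hev : ∀ᶠ p : ℝ × ℝ in 𝓝 (s₀, ε₀), p.1 ∈ Iio (t - 1) :=
            hfst.eventually_mem (Iio_mem_nhds (by linarith))
          filter_upwards [hev] with p hp
          rw [indicator_of_notMem]
          rintro ⟨h4, h5⟩
          rw [mem_Iio] at hp
          linarith
    · have hne : (t : ℂ) - (s₀ + (σ * ε₀ : ℝ) * I) ≠ 0 := by
        intro h
        have := congrArg Complex.re h
        simp only [sub_re, ofReal_re, add_re, mul_re, I_re, mul_zero, ofReal_im, I_im, mul_one,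
          sub_self, add_zero, zero_re] at this
        exact h1 (by linarith)
      have : ContinuousAt (fun p : ℝ × ℝ => ((t : ℂ) - (p.1 + (σ * p.2 : ℝ) * I))⁻¹) (s₀, ε₀) :=
        ContinuousAt.inv₀ (by fun_prop) hne
      exact this

/-- Convergence at infinity, uniformly on closed horizontal strips. -/
theorem tendsto_cauchyExt_zero {ρ : ℝ → ℂ} (hρ : Nice ρ) (σ M : ℝ) :
    Tendsto (fun p : ℝ × ℝ => cauchyExt ρ σ p.1 p.2)
      (comap (fun p : ℝ × ℝ => |p.1|) atTop ⊓ 𝓟 {p | p.2 ∈ Icc (0 : ℝ) M}) (𝓝 0) := by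
  obtain ⟨K, hK⟩ := hρ.lip
  have hc := hK.continuous
  set l := comap (fun p : ℝ × ℝ => |p.1|) atTop ⊓ 𝓟 {p | p.2 ∈ Icc (0 : ℝ) M} with hl
  have habs : Tendsto (fun p : ℝ × ℝ => |p.1|) l atTop := tendsto_comap.mono_left inf_le_left
  have hfst : Tendsto (fun p : ℝ × ℝ => p.1) l (cocompact ℝ) := by
    rw [cocompact_eq_atBot_atTop, ← comap_abs_atTop, tendsto_comap_iff]
    exact habs
  have hfst' : ∀ r : ℝ, Tendsto (fun p : ℝ × ℝ => p.1 + r) l (cocompact ℝ) := fun r =>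
    ((Homeomorph.addRight r).isClosedEmbedding.tendsto_cocompact).comp hfst
  have hmem : ∀ᶠ p in l, p.2 ∈ Icc (0 : ℝ) M := by
    filter_upwards [mem_inf_of_right (mem_principal_self _)] with p hp using hp
  have hsing : Tendsto (fun p : ℝ × ℝ => ρ p.1 * singularPart σ p.2) l (𝓝 0) := by
    obtain ⟨C, hC⟩ := isCompact_Icc.exists_bound_of_continuousOn (s := Icc (0 : ℝ) M)
      (continuous_singularPart σ).continuousOn
    have h1 : Tendsto (fun p : ℝ × ℝ => ‖ρ p.1‖ * C) l (𝓝 0) := by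
      simpa using ((hρ.zero.comp hfst).norm).mul_const C
    refine squeeze_zero_norm' ?_ h1
    filter_upwards [hmem] with p hp
    rw [norm_mul]
    gcongr
    exact hC _ hp
  have hinner : Tendsto (fun p : ℝ × ℝ => ∫ r in Icc (-1 : ℝ) 1, regIntegrand ρ σ p.1 p.2 (p.1 + r))
      l (𝓝 0) := by
    have : Tendsto (fun p : ℝ × ℝ => ∫ r in Icc (-1 : ℝ) 1, regIntegrand ρ σ p.1 p.2 (p.1 + r))
      l (𝓝 (∫ r in Icc (-1 : ℝ) 1, 0)) := by
      refine tendsto_integral_filter_of_dominated_convergence (fun r => (K : ℝ)) ?_ ?_ ?_ ?_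
      · exact Eventually.of_forall fun p => ((measurable_regIntegrand hc σ p.1 p.2).comp
          (measurable_const_add p.1)).aestronglyMeasurable
      · refine Eventually.of_forall fun p => ?_
        filter_upwards [ae_restrict_mem measurableSet_Icc] with r hr
        have h1 : |r| ≤ ‖((p.1 + r : ℝ) : ℂ) - (p.1 + (σ * p.2 : ℝ) * I)‖ := by
          simpa using Complex.abs_re_le_norm (((p.1 + r : ℝ) : ℂ) - (p.1 + (σ * p.2 : ℝ) * I))
        have hr' : p.1 + r ∈ Icc (p.1 - 1) (p.1 + 1) := ⟨by linarith [hr.1], by linarith [hr.2]⟩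
        rw [regIntegrand, indicator_of_mem hr', norm_mul, norm_inv]
        have h2 : ‖ρ (p.1 + r) - ρ p.1‖ ≤ K * |r| := by
          simpa [dist_eq_norm, Real.dist_eq] using hK.dist_le_mul (p.1 + r) p.1
        rcases eq_or_ne r 0 with rfl | hr0
        · simp
        have h3 : 0 < |r| := abs_pos.mpr hr0
        rw [← div_eq_mul_inv, div_le_iff₀ (h3.trans_le h1)]
        exact h2.trans (by gcongr)
      · simp
      · have h0 : ∀ᵐ r : ℝ, r ≠ 0 := by simp [ae_iff, measure_singleton]
        filter_upwards [ae_restrict_of_ae h0, ae_restrict_mem measurableSet_Icc] with r hr0 hr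
        have h1 : Tendsto (fun p : ℝ × ℝ => ‖ρ (p.1 + r) - ρ p.1‖ * |r|⁻¹) l (𝓝 0) := by
          simpa using (((hρ.zero.comp (hfst' r)).sub (hρ.zero.comp hfst)).norm).mul_const |r|⁻¹
        refine squeeze_zero_norm (fun p => ?_) h1
        have hr' : p.1 + r ∈ Icc (p.1 - 1) (p.1 + 1) := ⟨by linarith [hr.1], by linarith [hr.2]⟩
        rw [regIntegrand, indicator_of_mem hr', norm_mul, norm_inv]
        have h3 : 0 < |r| := abs_pos.mpr hr0
        have h2 : |r| ≤ ‖((p.1 + r : ℝ) : ℂ) - (p.1 + (σ * p.2 : ℝ) * I)‖ := by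
          simpa using Complex.abs_re_le_norm (((p.1 + r : ℝ) : ℂ) - (p.1 + (σ * p.2 : ℝ) * I))
        gcongr
    simpa using this
  have houter : Tendsto (fun p : ℝ × ℝ => ∫ t, (Icc (p.1 - 1) (p.1 + 1))ᶜ.indicator
      (regIntegrand ρ σ p.1 p.2) t) l (𝓝 0) := by
    have : Tendsto (fun p : ℝ × ℝ => ∫ t, (Icc (p.1 - 1) (p.1 + 1))ᶜ.indicator
      (regIntegrand ρ σ p.1 p.2) t) l (𝓝 (∫ t : ℝ, (0 : ℂ))) := by
      have hbd : ∀ (p : ℝ × ℝ) (t : ℝ), ‖(Icc (p.1 - 1) (p.1 + 1))ᶜ.indicator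
          (regIntegrand ρ σ p.1 p.2) t‖ ≤ ‖ρ t‖ := by
        intro p t
        by_cases ht : t ∈ Icc (p.1 - 1) (p.1 + 1)
        · rw [indicator_of_notMem (by simpa using ht)]
          simp
        · rw [indicator_of_mem (by simpa using ht)]
          simpa [indicator_of_notMem ht] using norm_regIntegrand_le hK σ p.1 p.2 t
      refine tendsto_integral_filter_of_dominated_convergence (fun t => ‖ρ t‖) ?_ ?_ hρ.int.norm ?_
      · exact Eventually.of_forall fun p => ((measurable_regIntegrand hc σ p.1 p.2).indicator
          measurableSet_Icc.compl).aestronglyMeasurable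
      · exact Eventually.of_forall fun p => Eventually.of_forall fun t => hbd p t
      · refine Eventually.of_forall fun t => ?_
        have h1 : Tendsto (fun p : ℝ × ℝ => ‖ρ t‖ * (|p.1| - |t|)⁻¹) l (𝓝 0) := by
          have h2 : Tendsto (fun p : ℝ × ℝ => |p.1| - |t|) l atTop :=
            tendsto_atTop_add_const_right _ _ habs
          simpa using (tendsto_inv_atTop_zero.comp h2).const_mul ‖ρ t‖
        refine squeeze_zero_norm' ?_ h1
        filter_upwards [habs.eventually_gt_atTop |t|] with p hp
        by_cases ht : t ∈ Icc (p.1 - 1) (p.1 + 1)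
        · rw [indicator_of_notMem (by simpa using ht), norm_zero]
          have : 0 < |p.1| - |t| := by linarith
          positivity
        · rw [indicator_of_mem (by simpa using ht), regIntegrand, indicator_of_notMem ht, sub_zero,
            norm_mul, norm_inv]
          have h2 : |t - p.1| ≤ ‖(t : ℂ) - (p.1 + (σ * p.2 : ℝ) * I)‖ := by
            simpa using Complex.abs_re_le_norm ((t : ℂ) - (p.1 + (σ * p.2 : ℝ) * I))
          have h3 : |p.1| - |t| ≤ |t - p.1| := by
            rw [abs_sub_comm]; exact abs_sub_abs_le_abs_sub _ _
          have h4 : 0 < |p.1| - |t| := by linarith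
          gcongr
          linarith
    simpa using this
  have hsum := (hinner.add houter).add hsing
  simp only [add_zero] at hsum
  refine hsum.congr fun p => ?_
  rw [cauchyExt]
  congr 1
  have hint : Integrable (regIntegrand ρ σ p.1 p.2) := by
    refine Integrable.mono' (Integrable.add ?_ hρ.int.norm)
      (measurable_regIntegrand hc σ p.1 p.2).aestronglyMeasurable
      (Eventually.of_forall (norm_regIntegrand_le hK σ p.1 p.2))
    rw [integrable_indicator_iff measurableSet_Icc]
    simp [integrableOn_const_iff]
  rw [integral_indicator measurableSet_Icc.compl, ← integral_add_compl measurableSet_Icc hint]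
  congr 1
  have e : Icc (-1 : ℝ) 1 = (fun r => p.1 + r) ⁻¹' Icc (p.1 - 1) (p.1 + 1) := by
    rw [preimage_const_add_Icc]
    congr 1 <;> ring
  rw [e]
  exact (measurePreserving_add_left volume p.1).setIntegral_preimage_emb
    (measurableEmbedding_addLeft p.1) _ _

end CauchyTransform

end

noncomputable section

namespace CauchyTransform

open Complex
open scoped ComplexConjugate ENNReal NNReal

theorem Nice.continuous {ρ : ℝ → ℂ} (hρ : Nice ρ) : Continuous ρ := hρ.lip.choose_spec.continuous

theorem Nice.bounded {ρ : ℝ → ℂ} (hρ : Nice ρ) : ∃ M, ∀ t, ‖ρ t‖ ≤ M := by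
  have h := hρ.zero.norm.eventually_lt_const (u := 1) (by simp)
  obtain ⟨C, hC, hC'⟩ := mem_cocompact.mp h
  obtain ⟨M, hM⟩ := hC.exists_bound_of_continuousOn hρ.continuous.continuousOn
  refine ⟨max M 1, fun t => ?_⟩
  by_cases ht : t ∈ C
  · exact (hM t ht).trans (le_max_left _ _)
  · exact (le_of_lt (hC' ht)).trans (le_max_right _ _)

theorem Nice.memLp {ρ : ℝ → ℂ} (hρ : Nice ρ) : MemLp ρ 2 := by
  obtain ⟨M, hM⟩ := hρ.bounded
  rw [memLp_two_iff_integrable_sq_norm hρ.int.1]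
  refine (hρ.int.norm.const_mul M).mono' (hρ.int.1.norm.pow 2) (Eventually.of_forall fun t => ?_)
  rw [Real.norm_of_nonneg (by positivity), sq]
  exact mul_le_mul_of_nonneg_right (hM t) (norm_nonneg _)

/-- Outside a compact subset of the closed half-plane the Cauchy transform is small. -/
theorem exists_compact_norm_cauchyExt_le {ρ : ℝ → ℂ} (hρ : Nice ρ) {σ : ℝ}
    (hσ : σ = 1 ∨ σ = -1) :
    ∃ C : Set (ℝ × ℝ), IsCompact C ∧ (∀ p ∈ C, 0 ≤ p.2) ∧
      ∀ s ε, 0 ≤ ε → (s, ε) ∉ C → ‖cauchyExt ρ σ s ε‖ ≤ 1 / 2 := by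
  set B := ∫ t, ‖ρ t‖ with hB
  have hB0 : 0 ≤ B := integral_nonneg fun t => norm_nonneg _
  set M := 2 * B + 1 with hM
  have h := (tendsto_cauchyExt_zero hρ σ M).norm.eventually_le_const (u := 1 / 2) (by simp)
  rw [eventually_inf_principal, eventually_comap] at h
  obtain ⟨N, hN⟩ := eventually_atTop.mp h
  refine ⟨Icc (-N) N ×ˢ Icc 0 M, isCompact_Icc.prod isCompact_Icc, fun p hp => hp.2.1, ?_⟩
  intro s ε hε hs
  by_cases hεM : ε ≤ M
  · have : N ≤ |s| := by
      by_contra! hlt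
      exact hs ⟨abs_le.mp hlt.le, hε, hεM⟩
    exact hN |s| this (s, ε) rfl ⟨hε, hεM⟩
  · push Not at hεM
    have hε' : 0 < ε := by linarith
    rw [← cauchy_eq_cauchyExt hρ.int hσ hε']
    have hz : ((s : ℂ) + (σ * ε : ℝ) * I).im ≠ 0 := by
      rw [im_ofReal_add_mul_I]; exact sign_mul_ne_zero hσ hε'
    refine (norm_cauchy_le hρ.int hz).trans ?_
    have : |σ| = 1 := by rcases hσ with rfl | rfl <;> simp
    rw [im_ofReal_add_mul_I, abs_mul, this, one_mul, abs_of_pos hε', ← hB, inv_mul_le_iff₀ hε']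
    linarith

theorem exists_norm_cauchyExt_le {ρ : ℝ → ℂ} (hρ : Nice ρ) {σ : ℝ} (hσ : σ = 1 ∨ σ = -1) :
    ∃ M, ∀ s ε, 0 ≤ ε → ‖cauchyExt ρ σ s ε‖ ≤ M := by
  obtain ⟨C, hC, -, hC2⟩ := exists_compact_norm_cauchyExt_le hρ hσ
  obtain ⟨M, hM⟩ := hC.exists_bound_of_continuousOn (continuous_cauchyExt hρ (σ := σ)).continuousOn
  refine ⟨max M (1 / 2), fun s ε hε => ?_⟩
  by_cases h : (s, ε) ∈ C
  · exact (hM (s, ε) h).trans (le_max_left _ _)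
  · exact (hC2 s ε hε h).trans (le_max_right _ _)

theorem exists_le_norm_one_add_cauchyExt_of_isClosed {ρ : ℝ → ℂ} (hρ : Nice ρ) {σ : ℝ}
    (hσ : σ = 1 ∨ σ = -1) {Z : Set (ℝ × ℝ)} (hZ : IsClosed Z) (hZ0 : ∀ p ∈ Z, 0 ≤ p.2)
    (hne : ∀ p ∈ Z, 1 + cauchyExt ρ σ p.1 p.2 ≠ 0) :
    ∃ c, 0 < c ∧ ∀ s ε, (s, ε) ∈ Z → c ≤ ‖1 + cauchyExt ρ σ s ε‖ := by
  obtain ⟨C, hC, -, hC2⟩ := exists_compact_norm_cauchyExt_le hρ hσ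
  have hout : ∀ s ε, (s, ε) ∈ Z → (s, ε) ∉ C → 1 / 2 ≤ ‖1 + cauchyExt ρ σ s ε‖ := by
    intro s ε hε h
    have h1 := hC2 s ε (hZ0 _ hε) h
    have h2 : ‖(1 : ℂ)‖ ≤ ‖1 + cauchyExt ρ σ s ε‖ + ‖cauchyExt ρ σ s ε‖ := by
      simpa using norm_sub_le (1 + cauchyExt ρ σ s ε) (cauchyExt ρ σ s ε)
    rw [norm_one] at h2
    linarith
  rcases (C ∩ Z).eq_empty_or_nonempty with he | hne'
  · exact ⟨1 / 2, by norm_num, fun s ε hε => hout s ε hε fun h => by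
      have : (s, ε) ∈ C ∩ Z := ⟨h, hε⟩
      simp [he] at this⟩
  obtain ⟨p, hp, hmin⟩ := (hC.inter_right hZ).exists_isMinOn hne'
    (f := fun p : ℝ × ℝ => ‖1 + cauchyExt ρ σ p.1 p.2‖)
    (continuous_const.add (continuous_cauchyExt hρ (σ := σ))).norm.continuousOn
  have hpos : 0 < ‖1 + cauchyExt ρ σ p.1 p.2‖ := norm_pos_iff.mpr (hne _ hp.2)
  refine ⟨min ‖1 + cauchyExt ρ σ p.1 p.2‖ (1 / 2), by positivity, fun s ε hε => ?_⟩
  by_cases h : (s, ε) ∈ C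
  · exact (min_le_left _ _).trans (isMinOn_iff.mp hmin (s, ε) ⟨h, hε⟩)
  · exact (min_le_right _ _).trans (hout s ε hε h)

theorem exists_le_norm_one_add_cauchyExt {ρ : ℝ → ℂ} (hρ : Nice ρ) {σ : ℝ} (hσ : σ = 1 ∨ σ = -1)
    (hne : ∀ s ε, 0 ≤ ε → 1 + cauchyExt ρ σ s ε ≠ 0) :
    ∃ c, 0 < c ∧ ∀ s ε, 0 ≤ ε → c ≤ ‖1 + cauchyExt ρ σ s ε‖ :=
  exists_le_norm_one_add_cauchyExt_of_isClosed hρ hσ (Z := {p | 0 ≤ p.2})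
    (isClosed_le continuous_const continuous_snd) (fun _ h => h) fun p hp => hne p.1 p.2 hp

theorem continuous_cauchyBdry {ρ : ℝ → ℂ} (hρ : Nice ρ) (σ : ℝ) : Continuous (cauchyBdry ρ σ) := by
  have h := Continuous.comp (f := fun s : ℝ => (s, (0 : ℝ)))
    (continuous_cauchyExt hρ (σ := σ)) (by fun_prop)
  exact h

theorem tendsto_cauchy_bdry {ρ : ℝ → ℂ} (hρ : Nice ρ) {σ : ℝ} (hσ : σ = 1 ∨ σ = -1) (s : ℝ) :
    Tendsto (fun ε : ℝ => cauchy ρ (s + (σ * ε : ℝ) * I)) (𝓝[>] 0) (𝓝 (cauchyBdry ρ σ s)) := by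
  have h : Tendsto (fun ε : ℝ => cauchyExt ρ σ s ε) (𝓝 0) (𝓝 (cauchyBdry ρ σ s)) :=
    (Continuous.comp (f := fun ε : ℝ => (s, ε))
      (continuous_cauchyExt hρ (σ := σ)) (by fun_prop)).tendsto 0
  refine (h.mono_left nhdsWithin_le_nhds).congr' ?_
  filter_upwards [self_mem_nhdsWithin] with ε hε
  exact (cauchy_eq_cauchyExt hρ.int hσ hε s).symm

theorem cauchyBdry_sub_cauchyBdry (ρ : ℝ → ℂ) (s : ℝ) :
    cauchyBdry ρ 1 s - cauchyBdry ρ (-1) s = 2 * Real.pi * I * ρ s := by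
  simp only [cauchyBdry, cauchyExt, singularPart_zero]
  have : ∀ t, regIntegrand ρ 1 s 0 t = regIntegrand ρ (-1) s 0 t := by
    intro t
    simp [regIntegrand]
  simp_rw [this]
  push_cast
  ring

theorem conj_cauchyBdry {ρ : ℝ → ℂ} (hρ : Nice ρ) (hr : ∀ t, conj (ρ t) = ρ t) {σ : ℝ}
    (hσ : σ = 1 ∨ σ = -1) (s : ℝ) : conj (cauchyBdry ρ σ s) = cauchyBdry ρ (-σ) s := by
  have hσ' : -σ = 1 ∨ -σ = -1 := by rcases hσ with rfl | rfl <;> simp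
  refine tendsto_nhds_unique ((Complex.continuous_conj.tendsto _).comp (tendsto_cauchy_bdry hρ hσ s))
    ((tendsto_cauchy_bdry hρ hσ' s).congr fun ε => ?_)
  simp only [Function.comp]
  rw [conj_cauchy]
  simp_rw [hr]
  congr 1
  simp

theorem exists_seq_tendsto_ae {f : ℕ → L2R} {b : L2R} (hb : Tendsto f atTop (𝓝 b)) :
    ∃ ns : ℕ → ℕ, StrictMono ns ∧ ∀ᵐ t, Tendsto (fun n => f (ns n) t) atTop (𝓝 (b t)) :=
  (tendstoInMeasure_of_tendsto_Lp hb).exists_seq_tendsto_ae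

/-- Linear relations with pointwise convergent coefficients pass to limits in `L²`. -/
theorem ae_eq_of_tendsto_of_tendsto {m m' : ℝ → ℝ → ℂ} {m₀ m₀' : ℝ → ℂ} {f f' : ℝ → L2R}
    {b b' : L2R} (h : ∀ ε, 0 < ε → ∀ᵐ t, m ε t * f ε t = m' ε t * f' ε t)
    (hb : Tendsto f (𝓝[>] 0) (𝓝 b)) (hb' : Tendsto f' (𝓝[>] 0) (𝓝 b'))
    (hm : ∀ t, Tendsto (fun ε => m ε t) (𝓝[>] 0) (𝓝 (m₀ t)))
    (hm' : ∀ t, Tendsto (fun ε => m' ε t) (𝓝[>] 0) (𝓝 (m₀' t))) :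
    ∀ᵐ t, m₀ t * b t = m₀' t * b' t := by
  set u : ℕ → ℝ := fun n => 1 / ((n : ℝ) + 1) with hu
  have hupos : ∀ n, 0 < u n := fun n => by positivity
  have hu0 : Tendsto u atTop (𝓝[>] 0) := tendsto_nhdsWithin_iff.mpr
    ⟨tendsto_one_div_add_atTop_nhds_zero_nat, Eventually.of_forall hupos⟩
  obtain ⟨n₁, hn₁, h₁⟩ := exists_seq_tendsto_ae (hb.comp hu0)
  obtain ⟨n₂, hn₂, h₂⟩ := exists_seq_tendsto_ae (hb'.comp (hu0.comp hn₁.tendsto_atTop))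
  have h₃ : ∀ᵐ t, ∀ n, m (u n) t * f (u n) t = m' (u n) t * f' (u n) t :=
    ae_all_iff.mpr fun n => h _ (hupos n)
  have hlim : Tendsto (fun n => u (n₁ (n₂ n))) atTop (𝓝[>] 0) :=
    hu0.comp (hn₁.tendsto_atTop.comp hn₂.tendsto_atTop)
  filter_upwards [h₁, h₂, h₃] with t h₁ h₂ h₃
  refine tendsto_nhds_unique (((hm t).comp hlim).mul (h₁.comp hn₂.tendsto_atTop))
    ((((hm' t).comp hlim).mul h₂).congr fun n => (h₃ _).symm)

/-- A limit in `L²` and a pointwise limit agree almost everywhere. -/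
theorem ae_eq_of_tendsto_toLp {F : ℝ → ℝ → ℂ} {G : ℝ → ℂ} {f : ℝ → L2R} {b : L2R}
    (hf : ∀ ε, 0 < ε → f ε =ᵐ[volume] F ε) (hb : Tendsto f (𝓝[>] 0) (𝓝 b))
    (hG : ∀ t, Tendsto (fun ε => F ε t) (𝓝[>] 0) (𝓝 (G t))) : b =ᵐ[volume] G := by
  set u : ℕ → ℝ := fun n => 1 / ((n : ℝ) + 1) with hu
  have hupos : ∀ n, 0 < u n := fun n => by positivity
  have hu0 : Tendsto u atTop (𝓝[>] 0) := tendsto_nhdsWithin_iff.mpr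
    ⟨tendsto_one_div_add_atTop_nhds_zero_nat, Eventually.of_forall hupos⟩
  obtain ⟨ns, hns, h2⟩ := exists_seq_tendsto_ae (hb.comp hu0)
  have h3 : ∀ᵐ t, ∀ n, f (u n) t = F (u n) t := ae_all_iff.mpr fun n => hf _ (hupos n)
  filter_upwards [h2, h3] with t h2 h3
  simp only [Function.comp, h3] at h2
  exact tendsto_nhds_unique h2 ((hG t).comp (hu0.comp hns.tendsto_atTop))

theorem Nice.const_mul {ρ : ℝ → ℂ} (hρ : Nice ρ) (c : ℂ) : Nice fun t => c * ρ t := by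
  obtain ⟨K, hK⟩ := hρ.lip
  refine ⟨⟨‖c‖₊ * K, LipschitzWith.of_dist_le_mul fun s t => ?_⟩, hρ.int.const_mul c, ?_⟩
  · rw [dist_eq_norm, ← mul_sub, norm_mul, ← dist_eq_norm, NNReal.coe_mul, coe_nnnorm, mul_assoc]
    exact mul_le_mul_of_nonneg_left (hK.dist_le_mul s t) (norm_nonneg c)
  · simpa using hρ.zero.const_mul c

theorem cauchyBdry_const_mul {ρ : ℝ → ℂ} (hρ : Nice ρ) (c : ℂ) {σ : ℝ} (hσ : σ = 1 ∨ σ = -1)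
    (s : ℝ) : cauchyBdry (fun t => c * ρ t) σ s = c * cauchyBdry ρ σ s :=
  tendsto_nhds_unique (tendsto_cauchy_bdry (hρ.const_mul c) hσ s)
    (((tendsto_cauchy_bdry hρ hσ s).const_mul c).congr fun _ => (cauchy_const_mul _ _ _).symm)

theorem Nice.mul {ρ h : ℝ → ℂ} (hρ : Nice ρ) {K : ℝ≥0} (hK : LipschitzWith K h) {C : ℝ}
    (hC : ∀ t, ‖h t‖ ≤ C) : Nice fun t => ρ t * h t := by
  obtain ⟨L, hL⟩ := hρ.lip
  obtain ⟨M, hM⟩ := hρ.bounded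
  have hM0 : 0 ≤ M := (norm_nonneg _).trans (hM 0)
  have hC0 : 0 ≤ C := (norm_nonneg _).trans (hC 0)
  refine ⟨⟨Real.toNNReal (M * K + C * L), LipschitzWith.of_dist_le_mul fun s t => ?_⟩,
    hρ.int.mul_bdd hK.continuous.aestronglyMeasurable (Eventually.of_forall hC), ?_⟩
  · rw [dist_eq_norm]
    have e : ρ s * h s - ρ t * h t = ρ s * (h s - h t) + (ρ s - ρ t) * h t := by ring
    have h1 := hK.dist_le_mul s t
    have h2 := hL.dist_le_mul s t
    rw [dist_eq_norm] at h1 h2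
    calc ‖ρ s * h s - ρ t * h t‖ ≤ ‖ρ s‖ * ‖h s - h t‖ + ‖ρ s - ρ t‖ * ‖h t‖ := by
          rw [e, ← norm_mul, ← norm_mul]; exact norm_add_le _ _
      _ ≤ M * (K * dist s t) + L * dist s t * C := by
          gcongr
          · exact hM s
          · exact hC t
      _ = _ := by
          rw [Real.coe_toNNReal _ (by positivity)]
          ring
  · have : Tendsto (fun t => ‖ρ t‖ * C) (cocompact ℝ) (𝓝 0) := by
      simpa using hρ.zero.norm.mul_const C
    refine squeeze_zero_norm (fun t => ?_) this
    rw [norm_mul]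
    gcongr
    exact hC t

theorem coeFn_bdryOp_of_nice {ρ : ℝ → ℂ} (hρ : Nice ρ) {σ : ℝ} (hσ : σ = 1 ∨ σ = -1) :
    bdryOp σ hσ (hρ.memLp.toLp ρ) =ᵐ[volume] cauchyBdry ρ σ := by
  refine ae_eq_of_tendsto_toLp (F := fun ε t => cauchy ρ (t + (σ * ε : ℝ) * I)) (fun ε hε => ?_)
    (tendsto_lineOp' hσ _) fun t => tendsto_cauchy_bdry hρ hσ t
  rw [lineOp'_eq (sign_mul_ne_zero hσ hε)]
  filter_upwards [coeFn_lineOp (sign_mul_ne_zero hσ hε) (hρ.memLp.toLp ρ)] with t ht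
  rw [ht]
  exact cauchy_congr hρ.memLp.coeFn_toLp _

theorem dense_nice : Dense {a : L2R | ∃ (g : ℝ → ℂ) (hg : Nice g), a = hg.memLp.toLp g} := by
  rw [Metric.dense_iff]
  intro a r hr
  obtain ⟨g, hg1, hg2, hg3⟩ := (Lp.memLp a).exist_eLpNorm_sub_le
    (by norm_num) (by norm_num) (ε := r / 2) (by positivity)
  have hgn : Nice g := by
    refine ⟨?_, hg2.continuous.integrable_of_hasCompactSupport hg1, hg1.is_zero_at_infty⟩
    obtain ⟨K, hK⟩ := ContDiff.lipschitzWith_of_hasCompactSupport hg1 hg2 (by simp)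
    exact ⟨K, hK⟩
  refine ⟨hgn.memLp.toLp g, ?_, g, hgn, rfl⟩
  rw [Metric.mem_ball, dist_comm]
  have : dist a (hgn.memLp.toLp g) = (eLpNorm (⇑a - g) 2 volume).toReal := by
    rw [Lp.dist_def]
    congr 1
    exact eLpNorm_congr_ae (EventuallyEq.rfl.sub hgn.memLp.coeFn_toLp)
  rw [this]
  have h := ENNReal.toReal_mono ENNReal.ofReal_ne_top hg3
  rw [ENNReal.toReal_ofReal (by positivity)] at h
  linarith

/-- The jump of the Cauchy transform across the real line. -/
theorem bdryOp_sub_bdryOp (a : L2R) :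
    bdryOp 1 (Or.inl rfl) a - bdryOp (-1) (Or.inr rfl) a = (2 * Real.pi * I) • a := by
  refine dense_nice.induction (P := fun a => bdryOp 1 (Or.inl rfl) a - bdryOp (-1) (Or.inr rfl) a =
    (2 * Real.pi * I) • a) ?_ (isClosed_eq (by fun_prop) (by fun_prop)) a
  rintro _ ⟨g, hg, rfl⟩
  refine Lp.ext ?_
  filter_upwards [Lp.coeFn_sub (bdryOp 1 (Or.inl rfl) (hg.memLp.toLp g))
    (bdryOp (-1) (Or.inr rfl) (hg.memLp.toLp g)), coeFn_bdryOp_of_nice hg (σ := 1) (Or.inl rfl),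
    coeFn_bdryOp_of_nice hg (σ := -1) (Or.inr rfl),
    Lp.coeFn_smul (2 * Real.pi * I) (hg.memLp.toLp g), hg.memLp.coeFn_toLp] with t h1 h2 h3 h4 h5
  rw [h1, h4, Pi.sub_apply, Pi.smul_apply, h2, h3, h5, cauchyBdry_sub_cauchyBdry, smul_eq_mul]

end CauchyTransform

end

noncomputable section

namespace CauchyTransform

open Complex
open scoped ComplexConjugate ENNReal NNReal

/-! ### Shifting horizontal contours -/

theorem integral_horizontal_eq_zero {q : ℂ → ℂ} (hq : DifferentiableOn ℂ q {z | 0 < z.im}) {C : ℝ}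
    (hC : ∀ z : ℂ, 0 < z.im → ‖q z‖ ≤ C / (z.im * (1 + z.re ^ 2))) {y : ℝ} (hy : 0 < y) :
    ∫ x : ℝ, q (x + y * I) = 0 := by
  have hcont : ∀ {y : ℝ}, 0 < y → Continuous fun x : ℝ => q (x + y * I) := by
    intro y hy
    refine ContinuousOn.comp_continuous (s := {z | 0 < z.im}) hq.continuousOn (by fun_prop) ?_
    intro x
    simpa using hy
  have hbd : ∀ {y : ℝ}, 0 < y → ∀ x : ℝ, ‖q (x + y * I)‖ ≤ C / y * (1 + x ^ 2)⁻¹ := by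
    intro y hy x
    refine (hC _ (by simpa using hy)).trans (le_of_eq ?_)
    simp
    field_simp
  have hint : ∀ {y : ℝ}, 0 < y → Integrable fun x : ℝ => q (x + y * I) := fun hy =>
    (integrable_inv_one_add_sq.const_mul _).mono' (hcont hy).aestronglyMeasurable
      (Eventually.of_forall (hbd hy))
  have hC0 : 0 ≤ C := by
    have := (norm_nonneg _).trans (hC I (by simp))
    simpa using this
  have heq : ∀ Y, y ≤ Y → ∫ x : ℝ, q (x + y * I) = ∫ x : ℝ, q (x + Y * I) := by
    intro Y hyY
    have hY : 0 < Y := hy.trans_le hyY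
    have hrect : ∀ X : ℝ, (∫ x : ℝ in -X..X, q (x + y * I)) - (∫ x : ℝ in -X..X, q (x + Y * I)) =
        I • (∫ t : ℝ in y..Y, q (((-X : ℝ) : ℂ) + t * I)) -
          I • ∫ t : ℝ in y..Y, q ((X : ℂ) + t * I) := by
      intro X
      have h := integral_boundary_rect_eq_zero_of_differentiableOn q (((-X : ℝ) : ℂ) + y * I)
        ((X : ℂ) + Y * I) (hq.mono ?_)
      · simp only [add_re, ofReal_re, mul_re, I_re, mul_zero, ofReal_im, I_im, mul_one, sub_self,
          add_zero, add_im, mul_im, zero_add] at h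
        linear_combination h
      · intro z hz
        have := hz.2
        simp only [mem_preimage, add_im, ofReal_im, mul_im, ofReal_re, I_im, mul_one, I_re,
          mul_zero, add_zero, zero_add] at this
        rw [uIcc_of_le hyY] at this
        exact hy.trans_le this.1
    have hvert : ∀ ς : ℝ, |ς| = 1 → Tendsto
        (fun X : ℝ => ∫ t : ℝ in y..Y, q (((ς * X : ℝ) : ℂ) + t * I)) atTop (𝓝 0) := by
      intro ς hς
      have hlim : Tendsto (fun X : ℝ => C / y * (1 + X ^ 2)⁻¹ * |Y - y|) atTop (𝓝 0) := by
        have h1 : Tendsto (fun X : ℝ => 1 + X ^ 2) atTop atTop :=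
          tendsto_atTop_add_const_left _ _ (tendsto_pow_atTop (by norm_num))
        simpa using ((tendsto_inv_atTop_zero.comp h1).const_mul (C / y)).mul_const |Y - y|
      refine squeeze_zero_norm (fun X => ?_) hlim
      refine intervalIntegral.norm_integral_le_of_norm_le_const fun t ht => ?_
      rw [uIoc_of_le hyY] at ht
      have ht0 : 0 < t := hy.trans ht.1
      refine (hbd ht0 _).trans ?_
      have : (ς * X) ^ 2 = X ^ 2 := by rw [mul_pow, ← sq_abs ς, hς]; simp
      rw [this]
      gcongr
      exact ht.1.le
    have h1 := (intervalIntegral_tendsto_integral (hint hy) tendsto_neg_atTop_atBot tendsto_id).sub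
      (intervalIntegral_tendsto_integral (hint hY) tendsto_neg_atTop_atBot tendsto_id)
    have h2 := ((hvert (-1) (by simp)).const_smul I).sub ((hvert 1 (by simp)).const_smul I)
    simp only [neg_mul, one_mul, smul_zero, sub_zero] at h2
    have h3 := tendsto_nhds_unique (h1.congr fun X => hrect X) h2
    exact sub_eq_zero.mp h3
  have hlim : Tendsto (fun Y : ℝ => C / Y * Real.pi) atTop (𝓝 0) := by
    simpa using (tendsto_const_nhds.div_atTop tendsto_id).mul_const Real.pi
  refine norm_le_zero_iff.mp (ge_of_tendsto hlim ?_)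
  filter_upwards [eventually_ge_atTop y] with Y hY
  rw [heq Y hY, ← integral_univ_inv_one_add_sq, ← integral_const_mul]
  exact norm_integral_le_of_norm_le (integrable_inv_one_add_sq.const_mul _)
    (Eventually.of_forall (hbd (hy.trans_le hY)))

theorem integral_horizontal_eq_zero_of_sign {σ : ℝ} (hσ : σ = 1 ∨ σ = -1) {q : ℂ → ℂ}
    (hq : DifferentiableOn ℂ q {z | 0 < σ * z.im}) {C : ℝ}
    (hC : ∀ z : ℂ, 0 < σ * z.im → ‖q z‖ ≤ C / (|z.im| * (1 + z.re ^ 2))) {ε : ℝ} (hε : 0 < ε) :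
    ∫ x : ℝ, q (x + (σ * ε : ℝ) * I) = 0 := by
  rcases hσ with rfl | rfl
  · simp only [one_mul] at *
    exact integral_horizontal_eq_zero hq (fun z hz => by simpa [abs_of_pos hz] using hC z hz) hε
  · have h1 : DifferentiableOn ℂ (fun z => q (-z)) {z | 0 < z.im} := by
      refine hq.comp (by fun_prop) fun z hz => ?_
      simpa using hz
    have h2 := integral_horizontal_eq_zero h1 (C := C) (fun z hz => by
      simpa [abs_of_pos hz] using hC (-z) (by simpa using hz)) hε
    rw [← integral_neg_eq_self, ← h2]
    congr 1
    ext x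
    congr 1
    push_cast
    ring

/-! ### Dominated convergence in `L²` -/

theorem tendsto_of_dominated {F : ℝ → ℝ → ℂ} {G : ℝ → ℂ} {f : ℝ → L2R} {g : L2R} {B : ℝ → ℝ}
    (hf : ∀ ε, 0 < ε → f ε =ᵐ[volume] F ε) (hg : g =ᵐ[volume] G)
    (hB : Integrable fun t => B t ^ 2) (hFB : ∀ ε, 0 < ε → ∀ᵐ t, ‖F ε t‖ ≤ B t)
    (hlim : ∀ᵐ t, Tendsto (fun ε => F ε t) (𝓝[>] 0) (𝓝 (G t))) :
    Tendsto f (𝓝[>] 0) (𝓝 g) := by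
  have hnorm : ∀ a b : L2R, ‖a - b‖ ^ 2 = ∫ t, ‖a t - b t‖ ^ 2 := by
    intro a b
    have h := norm_toLp_sq (Lp.memLp (a - b))
    rw [Lp.toLp_coeFn] at h
    rw [h]
    refine integral_congr_ae ?_
    filter_upwards [Lp.coeFn_sub a b] with t ht
    rw [ht, Pi.sub_apply]
  have hev : ∀ᶠ ε : ℝ in 𝓝[>] 0, 0 < ε := self_mem_nhdsWithin
  have hGB : ∀ᵐ t, ‖G t‖ ≤ B t := by
    have h1 : ∀ᵐ t, ∀ n : ℕ, ‖F (1 / ((n : ℝ) + 1)) t‖ ≤ B t :=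
      ae_all_iff.mpr fun n => hFB _ (by positivity)
    have hu0 : Tendsto (fun n : ℕ => 1 / ((n : ℝ) + 1)) atTop (𝓝[>] 0) :=
      tendsto_nhdsWithin_iff.mpr ⟨tendsto_one_div_add_atTop_nhds_zero_nat,
        Eventually.of_forall fun n => by simp only [mem_Ioi]; positivity⟩
    filter_upwards [h1, hlim] with t h1 h2
    exact le_of_tendsto (h2.comp hu0).norm (Eventually.of_forall h1)
  have h0 : Tendsto (fun ε => ∫ t, ‖F ε t - G t‖ ^ 2) (𝓝[>] 0) (𝓝 (∫ _ : ℝ, (0 : ℝ))) := by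
    refine tendsto_integral_filter_of_dominated_convergence (fun t => 4 * B t ^ 2) ?_ ?_
      (hB.const_mul 4) ?_
    · filter_upwards [hev] with ε hε
      have h1 : AEStronglyMeasurable (F ε) volume :=
        (Lp.aestronglyMeasurable (f ε)).congr (hf ε hε)
      have h2 : AEStronglyMeasurable G volume := (Lp.aestronglyMeasurable g).congr hg
      exact (h1.sub h2).norm.pow 2
    · filter_upwards [hev] with ε hε
      filter_upwards [hFB ε hε, hGB] with t h1 h2
      rw [Real.norm_of_nonneg (by positivity)]
      have h3 := norm_sub_le (F ε t) (G t)
      have h4 : ‖F ε t - G t‖ ≤ 2 * B t := by linarith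
      calc ‖F ε t - G t‖ ^ 2 ≤ (2 * B t) ^ 2 := pow_le_pow_left₀ (norm_nonneg _) h4 2
        _ = 4 * B t ^ 2 := by ring
    · filter_upwards [hlim] with t ht
      simpa using ((ht.sub_const (G t)).norm).pow 2
  rw [integral_zero] at h0
  rw [tendsto_iff_norm_sub_tendsto_zero]
  have h1 : Tendsto (fun ε => ‖f ε - g‖ ^ 2) (𝓝[>] 0) (𝓝 0) := by
    refine h0.congr' ?_
    filter_upwards [hev] with ε hε
    rw [hnorm]
    refine integral_congr_ae ?_
    filter_upwards [hf ε hε, hg] with t h1 h2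
    rw [h1, h2]
  simpa using h1.sqrt

/-! ### Functions with boundary values in a Hardy space -/

theorem norm_cauchy_le_of_memLp {a : ℝ → ℂ} (ha : MemLp a 2) {z : ℂ} (hz : z.im ≠ 0) :
    ‖cauchy a z‖ ≤ ‖ha.toLp a‖ * √(Real.pi / |z.im|) := by
  have hz' : (conj z).im ≠ 0 := by simpa using hz
  have h := inner_toLp (memLp_kernel hz') ha
  have e : ∫ t : ℝ, conj (((t : ℂ) - conj z)⁻¹) * a t = cauchy a z := by
    refine integral_congr_ae (Eventually.of_forall fun t => ?_)
    simp [mul_comm]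
  rw [e] at h
  rw [← h]
  refine (norm_inner_le_norm _ _).trans ?_
  rw [mul_comm]
  gcongr
  apply Real.le_sqrt_of_sq_le
  rw [norm_toLp_sq, integral_norm_kernel_sq hz']
  simp

theorem exists_one_add_sq_le {σ : ℝ} (hσ : σ = 1 ∨ σ = -1) {w : ℂ} (hw : σ * w.im < 0) :
    ∃ C, 0 < C ∧ ∀ z : ℂ, 0 ≤ σ * z.im → 1 + z.re ^ 2 ≤ C * ‖z - w‖ ^ 2 := by
  have hw0 : 0 < w.im ^ 2 := by
    have : w.im ≠ 0 := by rintro h; simp [h] at hw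
    positivity
  refine ⟨2 + (1 + 2 * w.re ^ 2) / w.im ^ 2, by positivity, fun z hz => ?_⟩
  rw [Complex.sq_norm, Complex.normSq_apply, sub_re, sub_im]
  have h1 : w.im ^ 2 ≤ (z.im - w.im) * (z.im - w.im) := by
    rcases hσ with rfl | rfl <;> nlinarith
  have h2 : 1 + 2 * w.re ^ 2 ≤ (1 + 2 * w.re ^ 2) / w.im ^ 2 * ((z.im - w.im) * (z.im - w.im)) := by
    rw [div_mul_eq_mul_div, le_div_iff₀ hw0]
    gcongr
  have h3 : 0 ≤ (1 + 2 * w.re ^ 2) / w.im ^ 2 * ((z.re - w.re) * (z.re - w.re)) :=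
    mul_nonneg (by positivity) (mul_self_nonneg _)
  nlinarith [sq_nonneg (z.re - 2 * w.re), mul_self_nonneg (z.im - w.im)]

theorem exists_norm_two_kernels_le {σ : ℝ} (hσ : σ = 1 ∨ σ = -1) {w w' : ℂ} (hw : σ * w.im < 0)
    (hw' : σ * w'.im < 0) : ∃ C, 0 < C ∧ ∀ z : ℂ, 0 ≤ σ * z.im →
      ‖(z - w)⁻¹ * (z - w')⁻¹‖ ≤ C * (1 + z.re ^ 2)⁻¹ := by
  obtain ⟨A, hA, h⟩ := exists_one_add_sq_le hσ hw
  obtain ⟨A', hA', h'⟩ := exists_one_add_sq_le hσ hw'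
  refine ⟨A + A', by positivity, fun z hz => ?_⟩
  have h1 := h z hz
  have h2 := h' z hz
  have hx : 0 < 1 + z.re ^ 2 := by positivity
  have hn : 0 < ‖z - w‖ := by
    by_contra! h0
    have : ‖z - w‖ = 0 := le_antisymm h0 (norm_nonneg _)
    rw [this] at h1
    nlinarith
  have hn' : 0 < ‖z - w'‖ := by
    by_contra! h0
    have : ‖z - w'‖ = 0 := le_antisymm h0 (norm_nonneg _)
    rw [this] at h2
    nlinarith
  rw [norm_mul, norm_inv, norm_inv, ← mul_inv, ← div_eq_mul_inv, le_div_iff₀ hx, mul_comm,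
    ← div_eq_mul_inv, div_le_iff₀ (by positivity)]
  have h3 : (1 + z.re ^ 2) ^ 2 ≤ ((A + A') * (‖z - w‖ * ‖z - w'‖)) ^ 2 := by
    calc (1 + z.re ^ 2) ^ 2 ≤ (A * ‖z - w‖ ^ 2) * (A' * ‖z - w'‖ ^ 2) := by
          rw [sq]; gcongr
      _ = (A * A') * (‖z - w‖ * ‖z - w'‖) ^ 2 := by ring
      _ ≤ (A + A') ^ 2 * (‖z - w‖ * ‖z - w'‖) ^ 2 := by
          gcongr
          nlinarith
      _ = _ := by ring
  exact (abs_le_of_sq_le_sq' h3 (by positivity)).2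

/-- If `Ψ (1 + F) = Φ` on the boundary, where `1 + F` and `Φ` are boundary values of analytic
functions and `1 + F` has no zeros, then `Ψ` is the boundary value of an analytic function. -/
theorem cauchy_eq_zero_of_mul_eq_bdryOp {σ : ℝ} (hσ : σ = 1 ∨ σ = -1) {ρ φ : ℝ → ℂ} (hρ : Nice ρ)
    (hne : ∀ s ε, 0 ≤ ε → 1 + cauchyExt ρ σ s ε ≠ 0) (hφ : Integrable φ) (hφ2 : MemLp φ 2)
    {Ψ : L2R} (hΨ : ∀ᵐ t, Ψ t * (1 + cauchyBdry ρ σ t) = bdryOp σ hσ (hφ2.toLp φ) t)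
    {w : ℂ} (hw : σ * w.im < 0) : cauchy Ψ w = 0 := by
  obtain ⟨c, hc, hcle⟩ := exists_le_norm_one_add_cauchyExt hρ hσ hne
  have key : ∀ w w' : ℂ, σ * w.im < 0 → σ * w'.im < 0 →
      ∫ t : ℝ, Ψ t * (((t : ℂ) - w)⁻¹ * ((t : ℂ) - w')⁻¹) = 0 := by
    intro w w' hw hw'
    obtain ⟨A, hA, hAle⟩ := exists_norm_two_kernels_le hσ hw hw'
    have him : ∀ t ε : ℝ, 0 ≤ ε → 0 ≤ σ * ((t : ℂ) + (σ * ε : ℝ) * I).im := by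
      intro t ε hε
      rw [im_ofReal_add_mul_I]
      rcases hσ with rfl | rfl <;> linarith
    have hsub : ∀ z w : ℂ, 0 ≤ σ * z.im → σ * w.im < 0 → z - w ≠ 0 := by
      intro z w hz hw h
      rw [sub_eq_zero] at h
      rw [h] at hz
      linarith
    set m : ℝ → ℝ → ℂ := fun ε t => conj ((1 + cauchyExt ρ σ t ε)⁻¹ *
      ((((t : ℂ) + (σ * ε : ℝ) * I) - w)⁻¹ * (((t : ℂ) + (σ * ε : ℝ) * I) - w')⁻¹)) with hm
    have hmB : ∀ ε, 0 ≤ ε → ∀ t, ‖m ε t‖ ≤ c⁻¹ * A * (1 + t ^ 2)⁻¹ := by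
      intro ε hε t
      simp only [hm]
      rw [RCLike.norm_conj, norm_mul, norm_inv, mul_assoc]
      have h1 := hAle _ (him t ε hε)
      have h2 : ((t : ℂ) + (σ * ε : ℝ) * I).re = t := by simp
      rw [h2] at h1
      gcongr
      exact hcle t ε hε
    have hmc : ∀ ε, 0 ≤ ε → Continuous (m ε) := by
      intro ε hε
      have h1 : Continuous fun t : ℝ => cauchyExt ρ σ t ε :=
        Continuous.comp (f := fun t : ℝ => (t, ε)) (continuous_cauchyExt hρ (σ := σ)) (by fun_prop)
      refine Complex.continuous_conj.comp (Continuous.mul ?_ (Continuous.mul ?_ ?_))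
      · exact (continuous_const.add h1).inv₀ fun t => hne t ε hε
      · exact Continuous.inv₀ (by fun_prop) fun t => hsub _ _ (him t ε hε) hw
      · exact Continuous.inv₀ (by fun_prop) fun t => hsub _ _ (him t ε hε) hw'
    have hB : Integrable fun t : ℝ => (c⁻¹ * A * (1 + t ^ 2)⁻¹) ^ 2 := by
      simp_rw [mul_pow]
      refine Integrable.const_mul (integrable_inv_one_add_sq.mono' ?_ ?_) _
      · exact (by fun_prop : Measurable fun t : ℝ => ((1 + t ^ 2)⁻¹) ^ 2).aestronglyMeasurable
      · filter_upwards with t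
        have h1 : (1 + t ^ 2)⁻¹ ≤ 1 := inv_le_one_of_one_le₀ (by nlinarith [sq_nonneg t])
        rw [Real.norm_of_nonneg (by positivity), sq]
        exact mul_le_of_le_one_left (by positivity) h1
    have hml : ∀ ε : ℝ, MemLp (m |ε|) 2 := by
      intro ε
      rw [memLp_two_iff_integrable_sq_norm (hmc _ (abs_nonneg ε)).aestronglyMeasurable]
      refine hB.mono' ((hmc _ (abs_nonneg ε)).norm.pow 2).aestronglyMeasurable
        (Eventually.of_forall fun t => ?_)
      rw [Real.norm_of_nonneg (by positivity)]
      exact pow_le_pow_left₀ (norm_nonneg _) (hmB _ (abs_nonneg ε) t) 2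
    have hmt : Tendsto (fun ε => (hml ε).toLp (m |ε|)) (𝓝[>] 0) (𝓝 ((hml 0).toLp (m |0|))) := by
      refine tendsto_of_dominated (F := m) (G := m |0|) (B := fun t => c⁻¹ * A * (1 + t ^ 2)⁻¹)
        (fun ε hε => ?_) (hml 0).coeFn_toLp hB
        (fun ε hε => Eventually.of_forall fun t => hmB ε hε.le t)
        (Eventually.of_forall fun t => ?_)
      · filter_upwards [(hml ε).coeFn_toLp] with t ht
        rw [ht, abs_of_pos hε]
      · rw [abs_zero]
        have h1 : Continuous fun ε : ℝ => cauchyExt ρ σ t ε :=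
          Continuous.comp (f := fun ε : ℝ => (t, ε)) (continuous_cauchyExt hρ (σ := σ))
            (by fun_prop)
        have h2 : ContinuousAt (fun ε : ℝ => m ε t) 0 := by
          refine ContinuousAt.comp (g := conj) Complex.continuous_conj.continuousAt
            (ContinuousAt.mul ?_ (ContinuousAt.mul ?_ ?_))
          · exact ContinuousAt.inv₀ (by fun_prop) (hne t 0 le_rfl)
          · exact ContinuousAt.inv₀ (by fun_prop) (hsub _ _ (him t 0 le_rfl) hw)
          · exact ContinuousAt.inv₀ (by fun_prop) (hsub _ _ (him t 0 le_rfl) hw')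
        exact h2.tendsto.mono_left nhdsWithin_le_nhds
    have hzero : ∀ ε, 0 < ε → inner ℂ ((hml ε).toLp (m |ε|)) (lineOp' (σ * ε) (hφ2.toLp φ)) = 0 := by
      intro ε hε
      rw [lineOp'_eq (sign_mul_ne_zero hσ hε), lineOp_toLp, inner_toLp, abs_of_pos hε]
      have hpos : ∀ z : ℂ, 0 < σ * z.im → z = (z.re : ℂ) + (σ * (σ * z.im) : ℝ) * I := by
        intro z hz
        have : σ * (σ * z.im) = z.im := by rcases hσ with rfl | rfl <;> ring
        rw [this, Complex.re_add_im]
      rw [← integral_horizontal_eq_zero_of_sign hσ (q := fun z => (1 + cauchy ρ z)⁻¹ *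
        ((z - w)⁻¹ * (z - w')⁻¹) * cauchy φ z) (C := c⁻¹ * A * ∫ t, ‖φ t‖) ?_ ?_ hε]
      · congr 1
        ext t
        simp only [hm]
        rw [RingHomCompTriple.comp_apply, RingHom.id_apply, cauchy_eq_cauchyExt hρ.int hσ hε]
      · intro z hz
        have hz0 : z.im ≠ 0 := by intro h; simp [h] at hz
        have hne1 : 1 + cauchy ρ z ≠ 0 := by
          rw [hpos z hz, cauchy_eq_cauchyExt hρ.int hσ hz]
          exact hne _ _ (le_of_lt hz)
        have h1 := differentiableAt_cauchy hρ.int hz0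
        have h2 := differentiableAt_cauchy hφ hz0
        refine DifferentiableAt.differentiableWithinAt ?_
        refine DifferentiableAt.mul (DifferentiableAt.mul ?_ (DifferentiableAt.mul ?_ ?_)) h2
        · exact (h1.const_add 1).inv hne1
        · exact DifferentiableAt.inv (by fun_prop) (hsub _ _ (le_of_lt hz) hw)
        · exact DifferentiableAt.inv (by fun_prop) (hsub _ _ (le_of_lt hz) hw')
      · intro z hz
        have hz0 : z.im ≠ 0 := by intro h; simp [h] at hz
        have h1 : ‖(1 + cauchy ρ z)⁻¹‖ ≤ c⁻¹ := by
          rw [norm_inv, hpos z hz, cauchy_eq_cauchyExt hρ.int hσ hz]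
          exact inv_anti₀ hc (hcle _ _ (le_of_lt hz))
        have h2 := hAle z (le_of_lt hz)
        have h3 := norm_cauchy_le hφ hz0
        rw [norm_mul, norm_mul]
        calc _ ≤ c⁻¹ * (A * (1 + z.re ^ 2)⁻¹) * (|z.im|⁻¹ * ∫ s, ‖φ s‖) := by gcongr
          _ = _ := by
            have := abs_pos.mpr hz0
            field_simp
    have hin : inner ℂ ((hml 0).toLp (m |0|)) (bdryOp σ hσ (hφ2.toLp φ)) = 0 := by
      refine tendsto_nhds_unique (hmt.inner (𝕜 := ℂ) (tendsto_lineOp' hσ (hφ2.toLp φ)))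
        (tendsto_const_nhds.congr' ?_)
      filter_upwards [self_mem_nhdsWithin] with ε hε
      exact (hzero ε hε).symm
    rw [inner_eq_integral] at hin
    rw [← hin]
    refine integral_congr_ae ?_
    filter_upwards [hΨ, (hml 0).coeFn_toLp] with t h1 h2
    rw [h2, ← h1]
    have h3 : 1 + cauchyBdry ρ σ t ≠ 0 := hne t 0 le_rfl
    simp only [hm, abs_zero, mul_zero, ofReal_zero, zero_mul, add_zero]
    rw [RingHomCompTriple.comp_apply, RingHom.id_apply]
    change _ = (1 + cauchyBdry ρ σ t)⁻¹ * _ * _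
    field_simp
  have hconst : ∀ w' : ℂ, σ * w'.im < 0 → cauchy Ψ w = cauchy Ψ w' := by
    intro w' hw'
    have h0 : w.im ≠ 0 := by intro h; simp [h] at hw
    have h0' : w'.im ≠ 0 := by intro h; simp [h] at hw'
    rw [← sub_eq_zero, cauchy, cauchy,
      ← integral_sub (integrable_mul_kernel_of_memLp (Lp.memLp Ψ) h0)
      (integrable_mul_kernel_of_memLp (Lp.memLp Ψ) h0')]
    rw [← mul_zero (w - w'), ← key w w' hw hw', ← integral_const_mul]
    refine integral_congr_ae (Eventually.of_forall fun t => ?_)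
    have h1 := ofReal_sub_ne_zero h0 t
    have h2 := ofReal_sub_ne_zero h0' t
    simp only
    field_simp
    ring
  have hlim : Tendsto (fun Y : ℝ => ‖Ψ‖ * √(Real.pi / Y)) atTop (𝓝 0) := by
    have h1 : Tendsto (fun Y : ℝ => Real.pi / Y) atTop (𝓝 0) :=
      tendsto_const_nhds.div_atTop tendsto_id
    simpa using h1.sqrt.const_mul ‖Ψ‖
  refine norm_le_zero_iff.mp (ge_of_tendsto hlim ?_)
  filter_upwards [eventually_gt_atTop 0] with Y hY
  have h1 : σ * (((-(σ * Y) : ℝ) : ℂ) * I).im < 0 := by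
    have : (((-(σ * Y) : ℝ) : ℂ) * I).im = -(σ * Y) := by simp
    rw [this]
    rcases hσ with rfl | rfl <;> linarith
  rw [hconst _ h1]
  have h2 : (((-(σ * Y) : ℝ) : ℂ) * I).im ≠ 0 := by intro h; rw [h] at h1; simp at h1
  refine (norm_cauchy_le_of_memLp (Lp.memLp Ψ) h2).trans (le_of_eq ?_)
  rw [Lp.toLp_coeFn]
  have h3 : |(((-(σ * Y) : ℝ) : ℂ) * I).im| = Y := by
    have : (((-(σ * Y) : ℝ) : ℂ) * I).im = -(σ * Y) := by simp
    rw [this]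
    rcases hσ with rfl | rfl <;> simp [abs_of_pos hY]
  rw [h3]

theorem eq_zero_of_cauchy_eq_zero {Ψ : L2R} (h : ∀ w : ℂ, w.im ≠ 0 → cauchy Ψ w = 0) : Ψ = 0 := by
  have h1 : ∀ {σ : ℝ} (hσ : σ = 1 ∨ σ = -1), bdryOp σ hσ Ψ = 0 := by
    intro σ hσ
    refine tendsto_nhds_unique (tendsto_lineOp' hσ Ψ) (tendsto_const_nhds.congr' ?_)
    filter_upwards [self_mem_nhdsWithin] with ε hε
    have hne := sign_mul_ne_zero hσ hε
    rw [lineOp'_eq hne]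
    refine Lp.ext ?_
    filter_upwards [Lp.coeFn_zero ℂ 2 volume, coeFn_lineOp hne Ψ] with t h1 h2
    rw [h1, h2, h _ (by simpa using hne), Pi.zero_apply]
  have h2 := bdryOp_sub_bdryOp Ψ
  rw [h1, h1, sub_zero, eq_comm, smul_eq_zero] at h2
  exact h2.resolve_left (by simp [Real.pi_ne_zero])

end CauchyTransform

end

noncomputable section

namespace CauchyTransform
open Complex
open scoped ComplexConjugate ENNReal NNReal

open Classical in
/-- Multiplication by a bounded function on `L²(ℝ)`. -/
def mulOp (m : ℝ → ℂ) : L2R →L[ℂ] L2R :=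
  if h : MemLp m ∞ volume then
    (ContinuousLinearMap.mul ℂ ℂ).holderL volume ∞ 2 2 (h.toLp m) else 0

theorem coeFn_mulOp {m : ℝ → ℂ} (h : MemLp m ∞ volume) (a : L2R) :
    mulOp m a =ᵐ[volume] fun t => m t * a t := by
  rw [mulOp, dif_pos h]
  filter_upwards [ContinuousLinearMap.coeFn_holder (r := 2) (ContinuousLinearMap.mul ℂ ℂ)
    (h.toLp m) a, h.coeFn_toLp] with t h1 h2
  rw [ContinuousLinearMap.holderL_apply_apply, h1, h2, ContinuousLinearMap.mul_apply']

theorem mulOp_congr {m : ℝ → ℂ} (h : MemLp m ∞ volume) {a b : L2R}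
    (hab : ∀ᵐ t, m t * a t = b t) : mulOp m a = b := by
  refine Lp.ext ?_
  filter_upwards [coeFn_mulOp h a, hab] with t h1 h2
  rw [h1, h2]

theorem memLp_top_conj {m : ℝ → ℂ} (h : MemLp m ∞ volume) :
    MemLp (fun t => conj (m t)) ∞ volume := h.star

theorem inner_mulOp_left {m : ℝ → ℂ} (h : MemLp m ∞ volume) (a b : L2R) :
    inner ℂ (mulOp m a) b = inner ℂ a (mulOp (fun t => conj (m t)) b) := by
  rw [inner_eq_integral, inner_eq_integral]
  refine integral_congr_ae ?_
  filter_upwards [coeFn_mulOp h a, coeFn_mulOp (memLp_top_conj h) b] with t h1 h2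
  rw [h1, h2, map_mul]
  ring

theorem mulOp_mulOp {m n : ℝ → ℂ} (hm : MemLp m ∞ volume) (hn : MemLp n ∞ volume)
    (hmn : MemLp (fun t => m t * n t) ∞ volume) (a : L2R) :
    mulOp m (mulOp n a) = mulOp (fun t => m t * n t) a := by
  refine mulOp_congr hm ?_
  filter_upwards [coeFn_mulOp hn a, coeFn_mulOp hmn a] with t h1 h2
  rw [h1, h2, mul_assoc]

theorem memLp_top_of_continuous {m : ℝ → ℂ} (hm : Continuous m) {C : ℝ} (hC : ∀ t, ‖m t‖ ≤ C) :
    MemLp m ∞ volume :=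
  memLp_top_of_bound hm.aestronglyMeasurable C (Eventually.of_forall hC)

theorem Nice.memLp_top {ρ : ℝ → ℂ} (hρ : Nice ρ) : MemLp ρ ∞ volume := by
  obtain ⟨M, hM⟩ := hρ.bounded
  exact memLp_top_of_continuous hρ.continuous hM

theorem memLp_top_cauchyBdry {ρ : ℝ → ℂ} (hρ : Nice ρ) {σ : ℝ} (hσ : σ = 1 ∨ σ = -1) :
    MemLp (cauchyBdry ρ σ) ∞ volume := by
  obtain ⟨M, hM⟩ := exists_norm_cauchyExt_le hρ hσ
  exact memLp_top_of_continuous (continuous_cauchyBdry hρ σ) fun t => hM t 0 le_rfl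

theorem memLp_top_cauchy_line {ρ : ℝ → ℂ} (hρ : Integrable ρ) {κ : ℝ} (hκ : κ ≠ 0) :
    MemLp (fun t : ℝ => cauchy ρ (t + κ * I)) ∞ volume :=
  memLp_top_of_continuous (continuous_cauchy_line hρ hκ) (C := |κ|⁻¹ * ∫ s, ‖ρ s‖) fun t => by
    simpa using norm_cauchy_le hρ (z := (t : ℂ) + κ * I) (by simpa using hκ)

theorem integral_mul_cauchy {f b : ℝ → ℂ} (hf : Integrable f) (hb : Integrable b) {κ : ℝ}
    (hκ : κ ≠ 0) :
    ∫ t : ℝ, f t * cauchy b (t + κ * I) = -∫ t : ℝ, cauchy f (t - κ * I) * b t := by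
  have hcf : Integrable fun s => conj (f s) := by
    simpa using (Complex.conjCLE.toContinuousLinearMap.integrable_comp hf)
  have h := integral_conj_mul_cauchy hcf hb hκ
  simp_rw [conj_cauchy, Complex.conj_conj] at h
  rw [h]
  congr 2
  funext t
  congr 2
  simp [sub_eq_add_neg]

theorem cauchy_mul_kernel {ρ : ℝ → ℂ} {z y : ℂ} (hz : Integrable fun t => ρ t * ((t : ℂ) - z)⁻¹)
    (hy : Integrable fun t => ρ t * ((t : ℂ) - y)⁻¹) (hne : ∀ t : ℝ, ρ t ≠ 0 → (t : ℂ) - z ≠ 0)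
    (hne' : ∀ t : ℝ, ρ t ≠ 0 → (t : ℂ) - y ≠ 0) (hzy : z ≠ y) :
    cauchy (fun t => ρ t * ((t : ℂ) - z)⁻¹) y = (cauchy ρ z - cauchy ρ y) * (z - y)⁻¹ := by
  rw [cauchy, cauchy, cauchy, ← integral_sub hz hy, ← integral_mul_const]
  refine integral_congr_ae (Eventually.of_forall fun t => ?_)
  simp only
  by_cases h0 : ρ t = 0
  · simp [h0]
  have h1 := hne t h0
  have h2 := hne' t h0
  have h3 : z - y ≠ 0 := sub_ne_zero.mpr hzy
  field_simp
  ring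

theorem cauchy_mul_cauchy_line {ρ w : ℝ → ℂ} (hρ : Integrable ρ) (hw : Integrable w) {κ : ℝ}
    (hκ : κ ≠ 0) (s : ℝ) :
    cauchy (fun t => ρ t * cauchy w (t + κ * I)) (s + κ * I) =
      cauchy ρ (s + κ * I) * cauchy w (s + (2 * κ : ℝ) * I) -
        cauchy (fun t => cauchy ρ (t - κ * I) * w t) (s + (2 * κ : ℝ) * I) := by
  set z : ℂ := s + κ * I with hz
  have hzi : z.im ≠ 0 := by simpa [hz] using hκ
  have hzi2 : ((s : ℂ) + (2 * κ : ℝ) * I).im ≠ 0 := by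
    rw [im_ofReal_add_mul_I]; simpa using hκ
  have h1 := integral_mul_cauchy (integrable_mul_kernel hρ hzi) hw hκ
  have hb : Integrable fun t : ℝ => cauchy ρ (t - κ * I) * w t := by
    have h := continuous_cauchy_line hρ (neg_ne_zero.mpr hκ)
    simp only [ofReal_neg, neg_mul, ← sub_eq_add_neg] at h
    refine hw.bdd_mul (c := |κ|⁻¹ * ∫ s, ‖ρ s‖) h.aestronglyMeasurable
      (Eventually.of_forall fun t => ?_)
    simpa using norm_cauchy_le hρ (z := (t : ℂ) - κ * I) (by simpa using hκ)
  have h2 : cauchy (fun t => ρ t * cauchy w (t + κ * I)) z =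
      ∫ t, ρ t * ((t : ℂ) - z)⁻¹ * cauchy w (t + κ * I) := by
    rw [cauchy]
    refine integral_congr_ae (Eventually.of_forall fun t => ?_)
    simp only
    ring
  rw [h2, h1, cauchy.eq_def w, cauchy.eq_def (fun t : ℝ => cauchy ρ (t - κ * I) * w t), ← integral_neg, ← integral_const_mul,
    ← integral_sub ((integrable_mul_kernel hw hzi2).const_mul _) (integrable_mul_kernel hb hzi2)]
  refine integral_congr_ae (Eventually.of_forall fun r => ?_)
  simp only
  have hyi : ((r : ℂ) - κ * I).im ≠ 0 := by simpa using hκ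
  have hzy : z ≠ r - κ * I := by
    intro h
    have := congrArg Complex.im h
    simp [hz] at this
    exact hκ (by linarith)
  rw [cauchy_mul_kernel (integrable_mul_kernel hρ hzi) (integrable_mul_kernel hρ hyi)
    (fun t _ => ofReal_sub_ne_zero hzi t) (fun t _ => ofReal_sub_ne_zero hyi t) hzy]
  have : (z - (r - κ * I))⁻¹ = -((r : ℂ) - (s + (2 * κ : ℝ) * I))⁻¹ := by
    rw [← inv_neg]
    congr 1
    simp [hz]
    ring
  rw [this]
  ring

theorem inner_mulOp_lineOp {ρ : ℝ → ℂ} (hρ : Nice ρ) {κ : ℝ} (hκ : κ ≠ 0) (a w : L2R) :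
    -inner ℂ (lineOp hκ a) (mulOp ρ (lineOp hκ w)) =
      inner ℂ (mulOp (fun t : ℝ => conj (cauchy ρ (t + κ * I))) a)
        (lineOp (mul_ne_zero two_ne_zero hκ) w) +
      inner ℂ (lineOp (mul_ne_zero two_ne_zero hκ) a)
        (mulOp (fun t : ℝ => cauchy ρ (t + (-κ : ℝ) * I)) w) := by
  have hm := memLp_top_cauchy_line hρ.int hκ
  have hm' := memLp_top_cauchy_line hρ.int (neg_ne_zero.mpr hκ)
  refine dense_integrable.induction (P := fun w => -inner ℂ (lineOp hκ a) (mulOp ρ (lineOp hκ w)) =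
      inner ℂ (mulOp (fun t : ℝ => conj (cauchy ρ (t + κ * I))) a)
        (lineOp (mul_ne_zero two_ne_zero hκ) w) +
      inner ℂ (lineOp (mul_ne_zero two_ne_zero hκ) a)
        (mulOp (fun t : ℝ => cauchy ρ (t + (-κ : ℝ) * I)) w)) ?_
    (isClosed_eq (by fun_prop) (by fun_prop)) w
  rintro _ ⟨g, hg, hgi, rfl⟩
  rw [inner_lineOp_left, neg_neg, inner_lineOp_left, inner_mulOp_left (memLp_top_conj hm),
    ← sub_eq_add_neg, ← inner_sub_right]
  congr 1
  refine Lp.ext ?_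
  filter_upwards [coeFn_lineOp hκ (mulOp ρ (lineOp hκ (hg.toLp g))),
    Lp.coeFn_sub (mulOp (fun t : ℝ => conj (conj (cauchy ρ (t + κ * I))))
      (lineOp (mul_ne_zero two_ne_zero hκ) (hg.toLp g))) (lineOp (mul_ne_zero two_ne_zero hκ)
        (mulOp (fun t : ℝ => cauchy ρ (t + (-κ : ℝ) * I)) (hg.toLp g))),
    coeFn_mulOp (memLp_top_conj (memLp_top_conj hm))
      (lineOp (mul_ne_zero two_ne_zero hκ) (hg.toLp g)),
    coeFn_lineOp (mul_ne_zero two_ne_zero hκ) (hg.toLp g),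
    coeFn_lineOp (mul_ne_zero two_ne_zero hκ)
      (mulOp (fun t : ℝ => cauchy ρ (t + (-κ : ℝ) * I)) (hg.toLp g))] with t h1 h2 h3 h4 h5
  rw [h1, h2, Pi.sub_apply, h3, h4, h5, Complex.conj_conj, cauchy_congr hg.coeFn_toLp]
  have e1 : (mulOp ρ (lineOp hκ (hg.toLp g))) =ᵐ[volume] fun t => ρ t * cauchy g (t + κ * I) := by
    filter_upwards [coeFn_mulOp hρ.memLp_top (lineOp hκ (hg.toLp g)),
      coeFn_lineOp hκ (hg.toLp g)] with t h1 h2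
    rw [h1, h2, cauchy_congr hg.coeFn_toLp]
  have e2 : mulOp (fun t : ℝ => cauchy ρ (t + (-κ : ℝ) * I)) (hg.toLp g) =ᵐ[volume]
      fun t => cauchy ρ (t - κ * I) * g t := by
    filter_upwards [coeFn_mulOp hm' (hg.toLp g), hg.coeFn_toLp] with t h1 h2
    rw [h1, h2]
    congr 2
    push_cast
    ring
  rw [cauchy_congr e1, cauchy_congr e2]
  exact cauchy_mul_cauchy_line hρ.int hgi hκ t

theorem norm_cauchy_line_le {ρ : ℝ → ℂ} (hρ : Nice ρ) {σ : ℝ} (hσ : σ = 1 ∨ σ = -1) :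
    ∃ M, ∀ t ε : ℝ, 0 < ε → ‖cauchy ρ (t + (σ * ε : ℝ) * I)‖ ≤ M := by
  obtain ⟨M, hM⟩ := exists_norm_cauchyExt_le hρ hσ
  refine ⟨M, fun t ε hε => ?_⟩
  rw [cauchy_eq_cauchyExt hρ.int hσ hε]
  exact hM t ε hε.le

theorem tendsto_mulOp_cauchy_line {ρ : ℝ → ℂ} (hρ : Nice ρ) {σ : ℝ} (hσ : σ = 1 ∨ σ = -1)
    (a : L2R) :
    Tendsto (fun ε => mulOp (fun t : ℝ => cauchy ρ (t + (σ * ε : ℝ) * I)) a) (𝓝[>] 0)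
      (𝓝 (mulOp (cauchyBdry ρ σ) a)) := by
  obtain ⟨M, hM⟩ := norm_cauchy_line_le hρ hσ
  refine tendsto_of_dominated (B := fun t => M * ‖a t‖)
    (fun ε hε => coeFn_mulOp (memLp_top_cauchy_line hρ.int (sign_mul_ne_zero hσ hε)) a)
    (coeFn_mulOp (memLp_top_cauchyBdry hρ hσ) a) ?_ ?_ ?_
  · simp_rw [mul_pow]
    exact (Lp.memLp a).integrable_norm_pow (by norm_num) |>.const_mul _
  · intro ε hε
    filter_upwards with t
    rw [norm_mul]
    gcongr
    exact hM t ε hε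
  · filter_upwards with t
    exact (tendsto_cauchy_bdry hρ hσ t).mul_const _

theorem tendsto_mulOp_conj_cauchy_line {ρ : ℝ → ℂ} (hρ : Nice ρ) {σ : ℝ} (hσ : σ = 1 ∨ σ = -1)
    (a : L2R) :
    Tendsto (fun ε => mulOp (fun t : ℝ => conj (cauchy ρ (t + (σ * ε : ℝ) * I))) a) (𝓝[>] 0)
      (𝓝 (mulOp (fun t => conj (cauchyBdry ρ σ t)) a)) := by
  obtain ⟨M, hM⟩ := norm_cauchy_line_le hρ hσ
  refine tendsto_of_dominated (B := fun t => M * ‖a t‖)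
    (fun ε hε => coeFn_mulOp
      (memLp_top_conj (memLp_top_cauchy_line hρ.int (sign_mul_ne_zero hσ hε))) a)
    (coeFn_mulOp (memLp_top_conj (memLp_top_cauchyBdry hρ hσ)) a) ?_ ?_ ?_
  · simp_rw [mul_pow]
    exact (Lp.memLp a).integrable_norm_pow (by norm_num) |>.const_mul _
  · intro ε hε
    filter_upwards with t
    rw [norm_mul, Complex.norm_conj]
    gcongr
    exact hM t ε hε
  · filter_upwards with t
    exact ((Complex.continuous_conj.tendsto _).comp (tendsto_cauchy_bdry hρ hσ t)).mul_const _

theorem neg_sign {σ : ℝ} (hσ : σ = 1 ∨ σ = -1) : -σ = 1 ∨ -σ = -1 := by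
  rcases hσ with rfl | rfl <;> simp

/-- The operator identity `B ρ B = F B - B F'` for the boundary values `F`, `F'` of the Cauchy
transform of `ρ`, in weak form. -/
theorem inner_mulOp_bdryOp {ρ : ℝ → ℂ} (hρ : Nice ρ) {σ : ℝ} (hσ : σ = 1 ∨ σ = -1) (a w : L2R) :
    -inner ℂ (bdryOp σ hσ a) (mulOp ρ (bdryOp σ hσ w)) =
      inner ℂ (mulOp (fun t => conj (cauchyBdry ρ σ t)) a) (bdryOp σ hσ w) +
      inner ℂ (bdryOp σ hσ a) (mulOp (cauchyBdry ρ (-σ)) w) := by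
  have h2 : Tendsto (fun ε : ℝ => 2 * ε) (𝓝[>] 0) (𝓝[>] 0) := by
    refine tendsto_nhdsWithin_iff.mpr ⟨?_, ?_⟩
    · have : Tendsto (fun ε : ℝ => 2 * ε) (𝓝 0) (𝓝 (2 * 0)) := tendsto_id.const_mul 2
      rw [mul_zero] at this
      exact this.mono_left nhdsWithin_le_nhds
    · filter_upwards [self_mem_nhdsWithin] with ε hε
      simpa using hε
  have l1 := (tendsto_lineOp' hσ a).inner (𝕜 := ℂ)
    (((mulOp ρ).continuous.tendsto _).comp (tendsto_lineOp' hσ w))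
  have l2 := (tendsto_mulOp_conj_cauchy_line hρ hσ a).inner (𝕜 := ℂ)
    ((tendsto_lineOp' hσ w).comp h2)
  have l3 := ((tendsto_lineOp' hσ a).comp h2).inner (𝕜 := ℂ)
    (tendsto_mulOp_cauchy_line hρ (neg_sign hσ) w)
  refine tendsto_nhds_unique l1.neg ((l2.add l3).congr' ?_)
  filter_upwards [self_mem_nhdsWithin] with ε hε
  have hne := sign_mul_ne_zero hσ hε
  have hne2 : σ * (2 * ε) ≠ 0 := by simpa [mul_left_comm] using hne
  have h := inner_mulOp_lineOp hρ hne a w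
  have e : lineOp (mul_ne_zero two_ne_zero hne) = lineOp' (σ * (2 * ε)) := by
    rw [lineOp'_eq hne2]
    congr 1
    ring
  rw [e, ← lineOp'_eq hne] at h
  simp only [Function.comp_apply]
  rw [h]
  simp only [neg_mul]

end CauchyTransform

end

noncomputable section

namespace CauchyTransform
open Complex
open scoped ComplexConjugate ENNReal NNReal

/-- The densities to which the scattering theory applies: Lipschitz, integrable, vanishing at
infinity, positive exactly on `(0, ∞)`, and with `ρ(t) / t` integrable. -/
structure Weight (ρ : ℝ → ℝ) : Prop where
  nice : Nice fun t => (ρ t : ℂ)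
  eq_zero : ∀ t ≤ 0, ρ t = 0
  pos : ∀ t, 0 < t → 0 < ρ t
  inv : Integrable fun t => ρ t / t

namespace Weight

variable {ρ : ℝ → ℝ}

theorem nonneg (hρ : Weight ρ) (t : ℝ) : 0 ≤ ρ t := by
  rcases le_or_gt t 0 with h | h
  · exact (hρ.eq_zero t h).ge
  · exact (hρ.pos t h).le

theorem pos_of_ne (hρ : Weight ρ) {t : ℝ} (h : ρ t ≠ 0) : 0 < t := by
  by_contra! h'
  exact h (hρ.eq_zero t h')

theorem continuous (hρ : Weight ρ) : Continuous ρ := by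
  have := Complex.continuous_re.comp hρ.nice.continuous
  simpa [Function.comp_def] using this

theorem integrable (hρ : Weight ρ) : Integrable ρ := by
  simpa using hρ.nice.int.re

/-- The real Cauchy integral, for `s ≤ 0`. -/
def stieltjes (ρ : ℝ → ℝ) (s : ℝ) : ℝ := ∫ t, ρ t / (t - s)

theorem integrable_div (hρ : Weight ρ) {s : ℝ} (hs : s ≤ 0) : Integrable fun t => ρ t / (t - s) := by
  refine hρ.inv.mono
    (Measurable.aestronglyMeasurable (by have := hρ.continuous.measurable; fun_prop)) (Eventually.of_forall fun t => ?_)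
  by_cases h : ρ t = 0
  · simp [h]
  have ht := hρ.pos_of_ne h
  have := hρ.nonneg t
  rw [Real.norm_of_nonneg (by apply div_nonneg <;> linarith),
    Real.norm_of_nonneg (by positivity)]
  gcongr
  linarith

theorem integrable_div_mul (hρ : Weight ρ) {s r : ℝ} (hs : s ≤ 0) (hr : r < 0) :
    Integrable fun t => ρ t / ((t - s) * (t - r)) := by
  refine ((hρ.integrable_div hs).const_mul (-r)⁻¹).mono
    (Measurable.aestronglyMeasurable (by have := hρ.continuous.measurable; fun_prop)) (Eventually.of_forall fun t => ?_)
  by_cases h : ρ t = 0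
  · simp [h]
  have ht := hρ.pos_of_ne h
  have h0 := hρ.nonneg t
  have h1 : 0 < t - s := by linarith
  have h2 : 0 < t - r := by linarith
  have h3 : 0 < -r := by linarith
  rw [Real.norm_of_nonneg (by positivity), Real.norm_of_nonneg (by positivity), ← div_div,
    div_eq_inv_mul _ (t - r)]
  gcongr
  linarith

theorem integral_pos_of_pos {f : ℝ → ℝ} (hf : Integrable f)
    (h0 : ∀ t, 0 ≤ f t) (h : ∀ t, 0 < t → 0 < f t) : 0 < ∫ t, f t := by
  rw [integral_pos_iff_support_of_nonneg h0 hf]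
  refine lt_of_lt_of_le ?_ (measure_mono (fun t (ht : t ∈ Ioi (0:ℝ)) => (h t ht).ne'))
  simp

theorem stieltjes_sub (hρ : Weight ρ) {s r : ℝ} (hs : s ≤ 0) (hr : r < 0) :
    stieltjes ρ s - stieltjes ρ r = (s - r) * ∫ t, ρ t / ((t - s) * (t - r)) := by
  rw [stieltjes, stieltjes, ← integral_sub (hρ.integrable_div hs) (hρ.integrable_div hr.le),
    ← integral_const_mul]
  refine integral_congr_ae (Eventually.of_forall fun t => ?_)
  simp only
  by_cases h : ρ t = 0
  · simp [h]
  have ht := hρ.pos_of_ne h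
  have h1 : t - s ≠ 0 := by linarith
  have h2 : t - r ≠ 0 := by linarith
  field_simp
  ring

theorem integral_div_mul_pos (hρ : Weight ρ) {s r : ℝ} (hs : s ≤ 0) (hr : r < 0) :
    0 < ∫ t, ρ t / ((t - s) * (t - r)) := by
  refine integral_pos_of_pos (hρ.integrable_div_mul hs hr) (fun t => ?_) fun t ht => ?_
  · by_cases h : ρ t = 0
    · simp [h]
    have ht := hρ.pos_of_ne h
    have h0 := hρ.nonneg t
    have h1 : 0 < t - s := by linarith
    have h2 : 0 < t - r := by linarith
    positivity
  · have h0 := hρ.pos t ht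
    have h1 : 0 < t - s := by linarith
    have h2 : 0 < t - r := by linarith
    positivity

theorem stieltjes_lt (hρ : Weight ρ) {s r : ℝ} (hs : s ≤ 0) (hr : r < s) :
    stieltjes ρ r < stieltjes ρ s := by
  have h := hρ.stieltjes_sub hs (hr.trans_le hs)
  have h2 := mul_pos (sub_pos.mpr hr) (hρ.integral_div_mul_pos hs (hr.trans_le hs))
  linarith

theorem stieltjes_pos (hρ : Weight ρ) {s : ℝ} (hs : s ≤ 0) : 0 < stieltjes ρ s := by
  refine integral_pos_of_pos (hρ.integrable_div hs) (fun t => ?_) fun t ht => ?_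
  · by_cases h : ρ t = 0
    · simp [h]
    have ht := hρ.pos_of_ne h
    have h0 := hρ.nonneg t
    have h1 : 0 < t - s := by linarith
    positivity
  · have h0 := hρ.pos t ht
    have h1 : 0 < t - s := by linarith
    positivity

theorem cauchy_ofReal (ρ : ℝ → ℝ) (s : ℝ) :
    cauchy (fun t => (ρ t : ℂ)) s = stieltjes ρ s := by
  rw [cauchy, stieltjes, ← integral_complex_ofReal]
  congr 1
  funext t
  push_cast
  rw [div_eq_mul_inv]

theorem cauchyBdry_of_nonpos (hρ : Weight ρ) (σ : ℝ) {s : ℝ} (hs : s ≤ 0) :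
    cauchyBdry (fun t => (ρ t : ℂ)) σ s = stieltjes ρ s := by
  rw [← cauchy_ofReal, cauchyBdry, cauchyExt, cauchy]
  simp [regIntegrand, hρ.eq_zero s hs]

/-- The perturbation determinant. -/
def det (ρ : ℝ → ℝ) (lam : ℝ) (z : ℂ) : ℂ := 1 + lam * cauchy (fun t => (ρ t : ℂ)) z

/-- The boundary values of the perturbation determinant. -/
def detBdry (ρ : ℝ → ℝ) (lam σ s : ℝ) : ℂ := 1 + lam * cauchyBdry (fun t => (ρ t : ℂ)) σ s

/-- The coupling at which the determinant vanishes at `0`. -/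
def critical (ρ : ℝ → ℝ) : ℝ := -(∫ t, ρ t / t)⁻¹

theorem critical_eq (ρ : ℝ → ℝ) : critical ρ = -(stieltjes ρ 0)⁻¹ := by
  simp [critical, stieltjes]

theorem tendsto_det (hρ : Weight ρ) (lam : ℝ) {σ : ℝ} (hσ : σ = 1 ∨ σ = -1) (s : ℝ) :
    Tendsto (fun ε : ℝ => det ρ lam (s + (σ * ε : ℝ) * I)) (𝓝[>] 0) (𝓝 (detBdry ρ lam σ s)) :=
  ((tendsto_cauchy_bdry hρ.nice hσ s).const_mul _).const_add _

theorem continuous_detBdry (hρ : Weight ρ) (lam σ : ℝ) : Continuous (detBdry ρ lam σ) :=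
  continuous_const.add (continuous_const.mul (continuous_cauchyBdry hρ.nice σ))

theorem conj_detBdry (hρ : Weight ρ) (lam : ℝ) {σ : ℝ} (hσ : σ = 1 ∨ σ = -1) (s : ℝ) :
    conj (detBdry ρ lam σ s) = detBdry ρ lam (-σ) s := by
  simp [detBdry, conj_cauchyBdry hρ.nice (fun t => conj_ofReal _) hσ]

theorem detBdry_sub_detBdry (ρ : ℝ → ℝ) (lam s : ℝ) :
    detBdry ρ lam 1 s - detBdry ρ lam (-1) s = 2 * Real.pi * I * (lam * ρ s) := by
  have := cauchyBdry_sub_cauchyBdry (fun t => (ρ t : ℂ)) s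
  rw [detBdry, detBdry]
  linear_combination (lam : ℂ) * this

theorem det_ofReal (ρ : ℝ → ℝ) (lam s : ℝ) : det ρ lam s = (1 + lam * stieltjes ρ s : ℝ) := by
  rw [det, cauchy_ofReal]
  push_cast
  ring

theorem detBdry_of_nonpos (hρ : Weight ρ) (lam σ : ℝ) {s : ℝ} (hs : s ≤ 0) :
    detBdry ρ lam σ s = (1 + lam * stieltjes ρ s : ℝ) := by
  rw [detBdry, hρ.cauchyBdry_of_nonpos σ hs]
  push_cast
  ring

theorem im_cauchy (hρ : Weight ρ) {z : ℂ} (hz : z.im ≠ 0) :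
    (cauchy (fun t => (ρ t : ℂ)) z).im = z.im * ∫ t, ρ t / ‖(t : ℂ) - z‖ ^ 2 := by
  have h := (Complex.imCLM.integral_comp_comm (integrable_mul_kernel hρ.nice.int hz)).symm
  simp only [imCLM_apply] at h
  rw [cauchy, h, ← integral_const_mul]
  refine integral_congr_ae (Eventually.of_forall fun t => ?_)
  simp only [Complex.im_ofReal_mul, Complex.inv_im, Complex.sub_im, Complex.ofReal_im,
    Complex.normSq_eq_norm_sq]
  ring

theorem integral_div_norm_pos (hρ : Weight ρ) {z : ℂ} (hz : z.im ≠ 0) :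
    0 < ∫ t, ρ t / ‖(t : ℂ) - z‖ ^ 2 := by
  refine integral_pos_of_pos ?_ (fun t => ?_) fun t ht => ?_
  · refine (hρ.integrable.mul_bdd (c := (|z.im|⁻¹) ^ 2) (f := ρ)
      (g := fun t : ℝ => ‖((t : ℂ) - z)⁻¹‖ ^ 2) ?_ ?_).congr ?_
    · have := continuous_kernel hz
      exact (this.norm.pow 2).aestronglyMeasurable
    · filter_upwards with t
      rw [norm_pow, norm_norm]
      gcongr
      exact norm_kernel_le hz t
    · filter_upwards with t
      rw [norm_inv, inv_pow, div_eq_mul_inv]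
  · have := hρ.nonneg t
    positivity
  · have := hρ.pos t ht
    have := norm_pos_iff.mpr (ofReal_sub_ne_zero hz t)
    positivity

theorem det_ne_zero_of_im (hρ : Weight ρ) (lam : ℝ) {z : ℂ} (hz : z.im ≠ 0) : det ρ lam z ≠ 0 := by
  intro h
  have h1 := congrArg Complex.im h
  rw [det, Complex.add_im, Complex.im_ofReal_mul, hρ.im_cauchy hz] at h1
  simp only [one_im, zero_add, zero_im, mul_eq_zero, hz, (hρ.integral_div_norm_pos hz).ne',
    or_false] at h1
  subst h1
  simp [det] at h

theorem detBdry_ne_zero_of_pos (hρ : Weight ρ) (lam : ℝ) {σ : ℝ} (hσ : σ = 1 ∨ σ = -1) {s : ℝ}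
    (hs : 0 < s) : detBdry ρ lam σ s ≠ 0 := by
  intro h
  have h2 : detBdry ρ lam (-σ) s = 0 := by rw [← hρ.conj_detBdry lam hσ, h, map_zero]
  have h3 := detBdry_sub_detBdry ρ lam s
  have h4 : lam = 0 := by
    have : (0:ℂ) = 2 * Real.pi * I * (lam * ρ s) := by
      rcases hσ with rfl | rfl
      · rw [← h3, h, h2, sub_zero]
      · rw [neg_neg] at h2
        rw [← h3, h, h2, sub_zero]
    have h5 := hρ.pos s hs
    simpa [Real.pi_ne_zero, h5.ne'] using this
  subst h4
  simp [detBdry] at h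

theorem one_add_mul_stieltjes_pos (hρ : Weight ρ) {lam : ℝ} (h : critical ρ < lam) {s : ℝ}
    (hs : s ≤ 0) : 0 < 1 + lam * stieltjes ρ s := by
  have h0 := hρ.stieltjes_pos hs
  rcases le_or_gt 0 lam with hl | hl
  · positivity
  have h1 := hρ.stieltjes_pos (le_refl 0)
  have h2 : stieltjes ρ s ≤ stieltjes ρ 0 := by
    rcases hs.eq_or_lt with rfl | hs
    · rfl
    · exact (hρ.stieltjes_lt le_rfl hs).le
  rw [critical_eq] at h
  have h3 : -1 < lam * stieltjes ρ 0 := by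
    have := mul_lt_mul_of_pos_right h h1
    rwa [neg_mul, inv_mul_cancel₀ h1.ne'] at this
  nlinarith

theorem one_add_mul_stieltjes_zero_neg (hρ : Weight ρ) {lam : ℝ} (h : lam < critical ρ) :
    1 + lam * stieltjes ρ 0 < 0 := by
  have h1 := hρ.stieltjes_pos (le_refl 0)
  rw [critical_eq] at h
  have := mul_lt_mul_of_pos_right h h1
  rw [neg_mul, inv_mul_cancel₀ h1.ne'] at this
  linarith

theorem critical_neg (hρ : Weight ρ) : critical ρ < 0 := by
  rw [critical_eq]
  have h1 := hρ.stieltjes_pos (le_refl 0)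
  simpa using h1

theorem exists_zero (hρ : Weight ρ) {lam : ℝ} (h : lam < critical ρ) :
    ∃ x < 0, 1 + lam * stieltjes ρ x = 0 := by
  have hlam := h.trans hρ.critical_neg
  have hc : ContinuousOn (fun s => 1 + lam * stieltjes ρ s) (Iic 0) := by
    have := (Complex.continuous_re.comp (hρ.continuous_detBdry lam 1)).continuousOn (s := Iic 0)
    refine this.congr fun s hs => ?_
    simp only [Function.comp_apply]
    rw [hρ.detBdry_of_nonpos lam 1 hs, Complex.ofReal_re]
  have hI : Integrable ρ := hρ.integrable
  have h0 := hρ.one_add_mul_stieltjes_zero_neg h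
  set A := ∫ t, ρ t with hA
  have hA0 : 0 ≤ A := integral_nonneg hρ.nonneg
  set y := lam * A - 1 with hy
  have hy0 : y < 0 := by nlinarith
  have hyle : stieltjes ρ y ≤ A * (-y)⁻¹ := by
    rw [stieltjes, hA, ← integral_mul_const]
    refine integral_mono (hρ.integrable_div hy0.le) (hI.mul_const _) fun t => ?_
    simp only
    by_cases h : ρ t = 0
    · simp [h]
    have ht := hρ.pos_of_ne h
    have := hρ.nonneg t
    have hy1 : 0 < -y := by linarith
    rw [div_eq_mul_inv]
    gcongr
    linarith
  have hy2 : 0 ≤ 1 + lam * stieltjes ρ y := by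
    have h1 : lam * (A * (-y)⁻¹) ≤ lam * stieltjes ρ y := mul_le_mul_of_nonpos_left hyle hlam.le
    have h2 : -1 ≤ lam * (A * (-y)⁻¹) := by
      have hy1 : 0 < -y := by linarith
      rw [← mul_assoc, ← div_eq_mul_inv, le_div_iff₀ hy1]
      linarith
    linarith
  obtain ⟨x, hx, hx0⟩ := intermediate_value_Icc' hy0.le (hc.mono Icc_subset_Iic_self)
    (show (0:ℝ) ∈ Icc _ _ from ⟨h0.le, hy2⟩)
  refine ⟨x, lt_of_le_of_ne hx.2 ?_, hx0⟩
  rintro rfl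
  exact h0.ne hx0

theorem zero_unique (hρ : Weight ρ) {lam x y : ℝ} (hx : x ≤ 0) (hy : y ≤ 0)
    (hx0 : 1 + lam * stieltjes ρ x = 0) (hy0 : 1 + lam * stieltjes ρ y = 0) : x = y := by
  have hl : lam ≠ 0 := by rintro rfl; simp at hx0
  have h : stieltjes ρ x = stieltjes ρ y := mul_left_cancel₀ hl (by linarith)
  by_contra hne
  rcases lt_or_gt_of_ne hne with h' | h'
  · exact (hρ.stieltjes_lt hy h').ne h
  · exact (hρ.stieltjes_lt hx h').ne' h

theorem detBdry_ne_zero_of_nonneg (hρ : Weight ρ) {lam : ℝ} (hl : lam ≠ critical ρ) {σ : ℝ}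
    (hσ : σ = 1 ∨ σ = -1) {s : ℝ} (hs : 0 ≤ s) : detBdry ρ lam σ s ≠ 0 := by
  rcases hs.eq_or_lt with rfl | hs
  · rw [hρ.detBdry_of_nonpos lam σ le_rfl, Complex.ofReal_ne_zero]
    rcases hl.lt_or_gt with h | h
    · exact (hρ.one_add_mul_stieltjes_zero_neg h).ne
    · exact (hρ.one_add_mul_stieltjes_pos h le_rfl).ne'
  · exact hρ.detBdry_ne_zero_of_pos lam hσ hs

theorem exists_le_norm_detBdry (hρ : Weight ρ) {lam : ℝ} (hl : lam ≠ critical ρ) {σ : ℝ}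
    (hσ : σ = 1 ∨ σ = -1) : ∃ c, 0 < c ∧ ∀ s, 0 ≤ s → c ≤ ‖detBdry ρ lam σ s‖ := by
  have e : ∀ s, 1 + cauchyExt (fun t => (lam : ℂ) * ρ t) σ s 0 = detBdry ρ lam σ s := by
    intro s
    rw [detBdry, ← cauchyBdry_const_mul hρ.nice _ hσ, cauchyBdry]
  obtain ⟨c, hc, h⟩ := exists_le_norm_one_add_cauchyExt_of_isClosed (hρ.nice.const_mul lam) hσ
    (Z := {p : ℝ × ℝ | 0 ≤ p.1 ∧ p.2 = 0})
    ((isClosed_le continuous_const continuous_fst).inter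
      (isClosed_eq continuous_snd continuous_const))
    (fun p hp => hp.2.ge) (by
      rintro ⟨s, ε⟩ ⟨hs, rfl⟩
      simp only
      rw [e]
      exact hρ.detBdry_ne_zero_of_nonneg hl hσ hs)
  exact ⟨c, hc, fun s hs => by simpa [e] using h s 0 ⟨hs, rfl⟩⟩

end Weight
end CauchyTransform

end

noncomputable section

namespace CauchyTransform
open Complex
open scoped ComplexConjugate ENNReal NNReal

theorem bdryOp_congr {σ σ' : ℝ} (h : σ = σ') (hσ : σ = 1 ∨ σ = -1) (hσ' : σ' = 1 ∨ σ' = -1) :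
    bdryOp σ hσ = bdryOp σ' hσ' := by
  subst h
  rfl

/-- Two families of boundary values related by a quotient of determinants without zeros, one from
each half-plane, vanish. -/
theorem bdryOp_eq_zero_of_cross {ρp ρm φp φm : ℝ → ℂ} (hρp : Nice ρp) (hρm : Nice ρm)
    (hp : ∀ s ε, 0 ≤ ε → 1 + cauchyExt ρp 1 s ε ≠ 0)
    (hm : ∀ s ε, 0 ≤ ε → 1 + cauchyExt ρm (-1) s ε ≠ 0)
    (hφp : Integrable φp) (hφp2 : MemLp φp 2) (hφm : Integrable φm) (hφm2 : MemLp φm 2)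
    (h : ∀ᵐ t, (1 + cauchyBdry ρm (-1) t) * bdryOp 1 (Or.inl rfl) (hφp2.toLp φp) t =
      (1 + cauchyBdry ρp 1 t) * bdryOp (-1) (Or.inr rfl) (hφm2.toLp φm) t) :
    bdryOp 1 (Or.inl rfl) (hφp2.toLp φp) = 0 ∧ bdryOp (-1) (Or.inr rfl) (hφm2.toLp φm) = 0 := by
  obtain ⟨c, hc, hcle⟩ := exists_le_norm_one_add_cauchyExt hρp (Or.inl rfl) hp
  have hpne : ∀ t, 1 + cauchyBdry ρp 1 t ≠ 0 := fun t => hp t 0 le_rfl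
  have hinv : MemLp (fun t => (1 + cauchyBdry ρp 1 t)⁻¹) ∞ volume := by
    refine memLp_top_of_continuous (C := c⁻¹)
      ((continuous_const.add (continuous_cauchyBdry hρp 1)).inv₀ hpne) fun t => ?_
    rw [norm_inv]
    exact inv_anti₀ hc (hcle t 0 le_rfl)
  set Ψ := mulOp (fun t => (1 + cauchyBdry ρp 1 t)⁻¹) (bdryOp 1 (Or.inl rfl) (hφp2.toLp φp))
  have h1 : ∀ᵐ t, Ψ t * (1 + cauchyBdry ρp 1 t) = bdryOp 1 (Or.inl rfl) (hφp2.toLp φp) t := by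
    filter_upwards [coeFn_mulOp hinv (bdryOp 1 (Or.inl rfl) (hφp2.toLp φp))] with t ht
    rw [ht]
    have := hpne t
    field_simp
  have h2 : ∀ᵐ t, Ψ t * (1 + cauchyBdry ρm (-1) t) =
      bdryOp (-1) (Or.inr rfl) (hφm2.toLp φm) t := by
    filter_upwards [h1, h] with t h1 h2
    have := hpne t
    rw [← h1] at h2
    refine mul_left_cancel₀ this ?_
    rw [← h2]
    ring
  have h0 : Ψ = 0 := by
    refine eq_zero_of_cauchy_eq_zero fun w hw => ?_
    rcases hw.lt_or_gt with hw | hw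
    · exact cauchy_eq_zero_of_mul_eq_bdryOp (Or.inl rfl) hρp hp hφp hφp2 h1 (by simpa using hw)
    · exact cauchy_eq_zero_of_mul_eq_bdryOp (Or.inr rfl) hρm hm hφm hφm2 h2 (by simpa using hw)
  have h3 : ∀ᵐ t, Ψ t = 0 := by
    rw [h0]
    filter_upwards [Lp.coeFn_zero ℂ 2 volume] with t ht
    exact ht
  constructor
  · refine Lp.ext ?_
    filter_upwards [h1, h3, Lp.coeFn_zero ℂ 2 volume] with t h1 h3 h4
    rw [← h1, h3, h4]
    simp
  · refine Lp.ext ?_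
    filter_upwards [h2, h3, Lp.coeFn_zero ℂ 2 volume] with t h1 h3 h4
    rw [← h1, h3, h4]
    simp

namespace Weight

variable {ρ : ℝ → ℝ}

/-- The square root of the density. -/
def root (ρ : ℝ → ℝ) (t : ℝ) : ℂ := (√(ρ t) : ℝ)

/-- The square root of the density over the boundary values of the determinant. -/
def quot (ρ : ℝ → ℝ) (lam σ t : ℝ) : ℂ := root ρ t * (detBdry ρ lam σ t)⁻¹

theorem root_mul_root (hρ : Weight ρ) (t : ℝ) : root ρ t * root ρ t = ρ t := by
  rw [root, ← Complex.ofReal_mul, Real.mul_self_sqrt (hρ.nonneg t)]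

theorem root_of_nonpos (hρ : Weight ρ) {t : ℝ} (ht : t ≤ 0) : root ρ t = 0 := by
  simp [root, hρ.eq_zero t ht]

theorem conj_root (ρ : ℝ → ℝ) (t : ℝ) : conj (root ρ t) = root ρ t := conj_ofReal _

theorem continuous_root (hρ : Weight ρ) : Continuous (root ρ) :=
  Complex.continuous_ofReal.comp (Real.continuous_sqrt.comp hρ.continuous)

theorem exists_norm_root_le (hρ : Weight ρ) : ∃ M, ∀ t, ‖root ρ t‖ ≤ M := by
  obtain ⟨M, hM⟩ := hρ.nice.bounded
  refine ⟨√M, fun t => ?_⟩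
  rw [root, Complex.norm_real, Real.norm_of_nonneg (Real.sqrt_nonneg _)]
  refine Real.sqrt_le_sqrt ?_
  simpa [abs_of_nonneg (hρ.nonneg t)] using hM t

theorem memLp_top_root (hρ : Weight ρ) : MemLp (root ρ) ∞ volume := by
  obtain ⟨M, hM⟩ := hρ.exists_norm_root_le
  exact memLp_top_of_continuous hρ.continuous_root hM

theorem norm_root_sq (hρ : Weight ρ) (t : ℝ) : ‖root ρ t‖ ^ 2 = ρ t := by
  rw [root, Complex.norm_real, Real.norm_of_nonneg (Real.sqrt_nonneg _), Real.sq_sqrt (hρ.nonneg t)]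

theorem memLp_root (hρ : Weight ρ) : MemLp (root ρ) 2 := by
  rw [memLp_two_iff_integrable_sq_norm hρ.continuous_root.aestronglyMeasurable]
  simp_rw [hρ.norm_root_sq]
  exact hρ.integrable

theorem exists_norm_quot_le (hρ : Weight ρ) {lam : ℝ} (hl : lam ≠ critical ρ) {σ : ℝ}
    (hσ : σ = 1 ∨ σ = -1) : ∃ C, ∀ t, ‖quot ρ lam σ t‖ ≤ C := by
  obtain ⟨M, hM⟩ := hρ.exists_norm_root_le
  obtain ⟨c, hc, h⟩ := hρ.exists_le_norm_detBdry hl hσ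
  have hM0 : 0 ≤ M := (norm_nonneg _).trans (hM 0)
  refine ⟨M * c⁻¹, fun t => ?_⟩
  rcases le_or_gt t 0 with ht | ht
  · simp only [quot, hρ.root_of_nonpos ht, zero_mul, norm_zero]
    positivity
  · rw [quot, norm_mul, norm_inv]
    gcongr
    · exact hM t
    · exact h t ht.le

theorem measurable_quot (hρ : Weight ρ) (lam σ : ℝ) : Measurable (quot ρ lam σ) :=
  hρ.continuous_root.measurable.mul (hρ.continuous_detBdry lam σ).measurable.inv

theorem memLp_top_quot (hρ : Weight ρ) {lam : ℝ} (hl : lam ≠ critical ρ) {σ : ℝ}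
    (hσ : σ = 1 ∨ σ = -1) : MemLp (quot ρ lam σ) ∞ volume := by
  obtain ⟨C, hC⟩ := hρ.exists_norm_quot_le hl hσ
  exact memLp_top_of_bound (hρ.measurable_quot lam σ).aestronglyMeasurable C (Eventually.of_forall hC)

theorem conj_quot (hρ : Weight ρ) (lam : ℝ) {σ : ℝ} (hσ : σ = 1 ∨ σ = -1) (t : ℝ) :
    conj (quot ρ lam σ t) = quot ρ lam (-σ) t := by
  rw [quot, quot, map_mul, map_inv₀, conj_root, hρ.conj_detBdry lam hσ]

/-- The operator `Ω - 1` in the spectral representation. -/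
def waveOp (ρ : ℝ → ℝ) (lam σ : ℝ) (hσ : σ = 1 ∨ σ = -1) : L2R →L[ℂ] L2R :=
  (lam : ℂ) • (mulOp (root ρ) ∘L bdryOp (-σ) (neg_sign hσ) ∘L mulOp (quot ρ lam σ))

/-- The adjoint of `waveOp`. -/
def waveAdj (ρ : ℝ → ℝ) (lam σ : ℝ) (hσ : σ = 1 ∨ σ = -1) : L2R →L[ℂ] L2R :=
  -(lam : ℂ) • (mulOp (quot ρ lam (-σ)) ∘L bdryOp (-σ) (neg_sign hσ) ∘L mulOp (root ρ))

theorem waveOp_apply (ρ : ℝ → ℝ) (lam σ : ℝ) (hσ : σ = 1 ∨ σ = -1) (u : L2R) :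
    waveOp ρ lam σ hσ u = (lam : ℂ) • mulOp (root ρ) (bdryOp (-σ) (neg_sign hσ)
      (mulOp (quot ρ lam σ) u)) := rfl

theorem waveAdj_apply (ρ : ℝ → ℝ) (lam σ : ℝ) (hσ : σ = 1 ∨ σ = -1) (u : L2R) :
    waveAdj ρ lam σ hσ u = -(lam : ℂ) • mulOp (quot ρ lam (-σ)) (bdryOp (-σ) (neg_sign hσ)
      (mulOp (root ρ) u)) := rfl

theorem inner_mulOp_root (hρ : Weight ρ) (a b : L2R) :
    inner ℂ (mulOp (root ρ) a) b = inner ℂ a (mulOp (root ρ) b) := by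
  rw [inner_mulOp_left hρ.memLp_top_root]
  simp_rw [conj_root]

theorem inner_waveOp_left (hρ : Weight ρ) {lam : ℝ} (hl : lam ≠ critical ρ) {σ : ℝ}
    (hσ : σ = 1 ∨ σ = -1) (a b : L2R) :
    inner ℂ (waveOp ρ lam σ hσ a) b = inner ℂ a (waveAdj ρ lam σ hσ b) := by
  rw [waveOp_apply, waveAdj_apply, inner_smul_left, inner_smul_right, hρ.inner_mulOp_root,
    inner_bdryOp_left, inner_mulOp_left (hρ.memLp_top_quot hl hσ)]
  simp_rw [hρ.conj_quot lam hσ]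
  simp

theorem inner_waveOp_add (hρ : Weight ρ) {lam : ℝ} (hl : lam ≠ critical ρ) {σ : ℝ}
    (hσ : σ = 1 ∨ σ = -1) (u : L2R) :
    inner ℂ u (waveOp ρ lam σ hσ u) + inner ℂ (waveOp ρ lam σ hσ u) u +
      inner ℂ (waveOp ρ lam σ hσ u) (waveOp ρ lam σ hσ u) = 0 := by
  rw [waveOp_apply]
  set w := mulOp (quot ρ lam σ) u with hw
  set b := bdryOp (-σ) (neg_sign hσ) w with hb
  set x := mulOp (cauchyBdry (fun t => (ρ t : ℂ)) σ) w with hx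
  have hq := hρ.memLp_top_quot hl hσ
  have hF := memLp_top_cauchyBdry hρ.nice hσ
  have h1 : mulOp (root ρ) u = w + (lam : ℂ) • x := by
    refine mulOp_congr hρ.memLp_top_root ?_
    filter_upwards [Lp.coeFn_add w ((lam : ℂ) • x), Lp.coeFn_smul (lam : ℂ) x, coeFn_mulOp hq u,
      coeFn_mulOp hF w] with t h1 h2 h3 h4
    rw [h1, Pi.add_apply, h2, Pi.smul_apply, h4, smul_eq_mul]
    have e : ∀ c : ℂ, c + lam * (cauchyBdry (fun t => (ρ t : ℂ)) σ t * c) =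
      detBdry ρ lam σ t * c := fun c => by rw [detBdry]; ring
    rw [e, hw, h3, quot]
    rcases le_or_gt t 0 with ht | ht
    · simp [hρ.root_of_nonpos ht]
    · have := hρ.detBdry_ne_zero_of_pos lam hσ ht
      field_simp
  have h2 : inner ℂ w b + inner ℂ b w = 0 := by
    rw [hb, inner_bdryOp_left]
    ring
  have h3 : inner ℂ x b + inner ℂ b x = -inner ℂ b (mulOp (fun t => (ρ t : ℂ)) b) := by
    have h := inner_mulOp_bdryOp hρ.nice (neg_sign hσ) w w
    simp_rw [conj_cauchyBdry hρ.nice (fun t => conj_ofReal _) (neg_sign hσ), neg_neg] at h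
    exact h.symm
  have h4 : inner ℂ (mulOp (root ρ) b) (mulOp (root ρ) b) =
      inner ℂ b (mulOp (fun t => (ρ t : ℂ)) b) := by
    have e : (fun t => root ρ t * root ρ t) = fun t => (ρ t : ℂ) := funext hρ.root_mul_root
    rw [hρ.inner_mulOp_root, mulOp_mulOp hρ.memLp_top_root hρ.memLp_top_root, e]
    rw [e]
    exact hρ.nice.memLp_top
  simp only [inner_smul_left, inner_smul_right, conj_ofReal]
  rw [h4, hρ.inner_mulOp_root, ← hρ.inner_mulOp_root u, h1, inner_add_left, inner_add_right,
    inner_smul_left, inner_smul_right, conj_ofReal]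
  linear_combination (lam : ℂ) * h2 + (lam : ℂ) ^ 2 * h3

theorem coeFn_waveOp_of_nonpos (hρ : Weight ρ) (lam : ℝ) {σ : ℝ} (hσ : σ = 1 ∨ σ = -1) (u : L2R) :
    ∀ᵐ t, t ≤ 0 → waveOp ρ lam σ hσ u t = 0 := by
  rw [waveOp_apply]
  set b := bdryOp (-σ) (neg_sign hσ) (mulOp (quot ρ lam σ) u)
  filter_upwards [Lp.coeFn_smul (lam : ℂ) (mulOp (root ρ) b), coeFn_mulOp hρ.memLp_top_root b]
    with t h1 h2 ht
  rw [h1, Pi.smul_apply, h2, hρ.root_of_nonpos ht, zero_mul, smul_zero]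

theorem coeFn_waveAdj (hρ : Weight ρ) {lam : ℝ} (hl : lam ≠ critical ρ) {σ : ℝ}
    (hσ : σ = 1 ∨ σ = -1) (u : L2R) :
    waveAdj ρ lam σ hσ u =ᵐ[volume] fun t => -(lam : ℂ) * (quot ρ lam (-σ) t *
      bdryOp (-σ) (neg_sign hσ) (mulOp (root ρ) u) t) := by
  rw [waveAdj_apply]
  set b := bdryOp (-σ) (neg_sign hσ) (mulOp (root ρ) u)
  filter_upwards [Lp.coeFn_smul (-(lam : ℂ)) (mulOp (quot ρ lam (-σ)) b),
    coeFn_mulOp (hρ.memLp_top_quot hl (neg_sign hσ)) b] with t h1 h2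
  rw [h1, Pi.smul_apply, h2, smul_eq_mul]

theorem coeFn_waveAdj_of_nonpos (hρ : Weight ρ) {lam : ℝ} (hl : lam ≠ critical ρ) {σ : ℝ}
    (hσ : σ = 1 ∨ σ = -1) (u : L2R) :
    ∀ᵐ t, t ≤ 0 → waveAdj ρ lam σ hσ u t = 0 := by
  filter_upwards [hρ.coeFn_waveAdj hl hσ u] with t h ht
  rw [h, quot, hρ.root_of_nonpos ht]
  simp

theorem memLp_root_mul (hρ : Weight ρ) (u : L2R) : MemLp (fun t => root ρ t * u t) 2 :=
  (Lp.memLp (mulOp (root ρ) u)).ae_eq (coeFn_mulOp hρ.memLp_top_root u)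

theorem toLp_root_mul (hρ : Weight ρ) (u : L2R) :
    (hρ.memLp_root_mul u).toLp _ = mulOp (root ρ) u :=
  Lp.ext ((hρ.memLp_root_mul u).coeFn_toLp.trans (coeFn_mulOp hρ.memLp_top_root u).symm)

theorem integrable_root_mul (hρ : Weight ρ) (u : L2R) : Integrable fun t => root ρ t * u t :=
  hρ.memLp_root.integrable_mul (Lp.memLp u)

theorem detBdry_mul_bdryOp (hρ : Weight ρ) {lam : ℝ} (hl : lam ≠ critical ρ) {σ : ℝ}
    (hσ : σ = 1 ∨ σ = -1) {u : L2R} (hu : u + waveAdj ρ lam σ hσ u = 0) :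
    ∀ᵐ t, detBdry ρ lam (-1) t * bdryOp 1 (Or.inl rfl) (mulOp (root ρ) u) t =
      detBdry ρ lam 1 t * bdryOp (-1) (Or.inr rfl) (mulOp (root ρ) u) t := by
  have h1 : ∀ᵐ t, u t = lam * (quot ρ lam (-σ) t *
      bdryOp (-σ) (neg_sign hσ) (mulOp (root ρ) u) t) := by
    filter_upwards [hρ.coeFn_waveAdj hl hσ u, Lp.coeFn_add u (waveAdj ρ lam σ hσ u),
      Lp.coeFn_zero ℂ 2 volume] with t h1 h2 h3
    rw [hu, h3, Pi.add_apply, h1] at h2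
    simp only [Pi.zero_apply] at h2
    linear_combination -h2
  have h2 : ∀ᵐ t, detBdry ρ lam (-σ) t * mulOp (root ρ) u t =
      lam * ρ t * bdryOp (-σ) (neg_sign hσ) (mulOp (root ρ) u) t := by
    filter_upwards [h1, coeFn_mulOp hρ.memLp_top_root u] with t h1 h2
    rw [h2]
    rcases le_or_gt t 0 with ht | ht
    · simp [hρ.root_of_nonpos ht, hρ.eq_zero t ht]
    · rw [h1, quot, ← hρ.root_mul_root]
      have := hρ.detBdry_ne_zero_of_pos lam (neg_sign hσ) ht
      field_simp
  have h3 : ∀ᵐ t, bdryOp 1 (Or.inl rfl) (mulOp (root ρ) u) t -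
      bdryOp (-1) (Or.inr rfl) (mulOp (root ρ) u) t = 2 * Real.pi * I * mulOp (root ρ) u t := by
    have h := bdryOp_sub_bdryOp (mulOp (root ρ) u)
    filter_upwards [Lp.coeFn_sub (bdryOp 1 (Or.inl rfl) (mulOp (root ρ) u))
      (bdryOp (-1) (Or.inr rfl) (mulOp (root ρ) u)),
      Lp.coeFn_smul (2 * Real.pi * I) (mulOp (root ρ) u)] with t h1 h2
    rw [← Pi.sub_apply, ← h1, h, h2, Pi.smul_apply, smul_eq_mul]
  filter_upwards [h2, h3] with t h2 h3
  have h4 := detBdry_sub_detBdry ρ lam t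
  rcases hσ with rfl | rfl
  · linear_combination detBdry ρ lam (-1) t * h3 + 2 * Real.pi * I * h2 -
      bdryOp (-1) (Or.inr rfl) (mulOp (root ρ) u) t * h4
  · rw [bdryOp_congr (neg_neg 1) _ (Or.inl rfl), neg_neg] at h2
    linear_combination detBdry ρ lam 1 t * h3 + 2 * Real.pi * I * h2 -
      bdryOp 1 (Or.inl rfl) (mulOp (root ρ) u) t * h4

theorem eq_zero_of_bdryOp_eq_zero {lam σ : ℝ}
    (hσ : σ = 1 ∨ σ = -1) {u : L2R} (hu : u + waveAdj ρ lam σ hσ u = 0)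
    (h : bdryOp (-σ) (neg_sign hσ) (mulOp (root ρ) u) = 0) : u = 0 := by
  rw [waveAdj_apply, h, map_zero, smul_zero, add_zero] at hu
  exact hu

theorem eq_zero_of_bdryOps_eq_zero {lam σ : ℝ}
    (hσ : σ = 1 ∨ σ = -1) {u : L2R} (hu : u + waveAdj ρ lam σ hσ u = 0)
    (h : bdryOp 1 (Or.inl rfl) (mulOp (root ρ) u) = 0)
    (h' : bdryOp (-1) (Or.inr rfl) (mulOp (root ρ) u) = 0) : u = 0 := by
  refine eq_zero_of_bdryOp_eq_zero hσ hu ?_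
  rcases hσ with rfl | rfl
  · exact h'
  · rwa [bdryOp_congr (neg_neg 1) _ (Or.inl rfl)]

theorem one_add_cauchyExt (hρ : Weight ρ) (lam : ℝ) {σ : ℝ} (hσ : σ = 1 ∨ σ = -1) (s : ℝ) {ε : ℝ}
    (hε : 0 < ε) :
    1 + cauchyExt (fun t => (lam : ℂ) * ρ t) σ s ε = det ρ lam (s + (σ * ε : ℝ) * I) := by
  rw [det, ← cauchy_const_mul, cauchy_eq_cauchyExt (hρ.nice.const_mul lam).int hσ hε]

theorem one_add_cauchyBdry (hρ : Weight ρ) (lam : ℝ) {σ : ℝ} (hσ : σ = 1 ∨ σ = -1) (s : ℝ) :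
    1 + cauchyBdry (fun t => (lam : ℂ) * ρ t) σ s = detBdry ρ lam σ s := by
  rw [detBdry, cauchyBdry_const_mul hρ.nice _ hσ]

/-- Above the critical coupling the adjoint wave operator is injective. -/
theorem eq_zero_of_add_waveAdj (hρ : Weight ρ) {lam : ℝ} (hl : critical ρ < lam) {σ : ℝ}
    (hσ : σ = 1 ∨ σ = -1) {u : L2R} (hu : u + waveAdj ρ lam σ hσ u = 0) : u = 0 := by
  have hne : ∀ σ : ℝ, (σ = 1 ∨ σ = -1) → ∀ s ε, 0 ≤ ε →
      1 + cauchyExt (fun t => (lam : ℂ) * ρ t) σ s ε ≠ 0 := by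
    intro σ hσ s ε hε
    rcases hε.eq_or_lt with rfl | hε
    · rw [← cauchyBdry, hρ.one_add_cauchyBdry lam hσ]
      rcases le_or_gt s 0 with hs | hs
      · rw [hρ.detBdry_of_nonpos lam σ hs, Complex.ofReal_ne_zero]
        exact (hρ.one_add_mul_stieltjes_pos hl hs).ne'
      · exact hρ.detBdry_ne_zero_of_pos lam hσ hs
    · rw [hρ.one_add_cauchyExt lam hσ s hε]
      exact hρ.det_ne_zero_of_im lam (by
        rw [im_ofReal_add_mul_I]; exact sign_mul_ne_zero hσ hε)
  have hN := hρ.nice.const_mul lam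
  have h := bdryOp_eq_zero_of_cross hN hN (hne 1 (Or.inl rfl)) (hne (-1) (Or.inr rfl))
    (hρ.integrable_root_mul u) (hρ.memLp_root_mul u) (hρ.integrable_root_mul u)
    (hρ.memLp_root_mul u) (by
      rw [hρ.toLp_root_mul]
      filter_upwards [hρ.detBdry_mul_bdryOp hl.ne' hσ hu] with t ht
      rwa [hρ.one_add_cauchyBdry lam (Or.inl rfl), hρ.one_add_cauchyBdry lam (Or.inr rfl)])
  rw [hρ.toLp_root_mul] at h
  exact eq_zero_of_bdryOps_eq_zero hσ hu h.1 h.2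

end Weight
end CauchyTransform

end

noncomputable section

namespace CauchyTransform
open Complex
open scoped ComplexConjugate ENNReal NNReal

/-- A bounded Lipschitz function which agrees with `(t - x)⁻¹` for `t ≥ 0`. -/
def poleFactor (x t : ℝ) : ℂ := ((max t 0 - x)⁻¹ : ℝ)

theorem poleFactor_of_nonneg (x : ℝ) {t : ℝ} (ht : 0 ≤ t) : poleFactor x t = ((t : ℂ) - x)⁻¹ := by
  rw [poleFactor, max_eq_left ht]
  push_cast
  rfl

theorem norm_poleFactor_le {x : ℝ} (hx : x < 0) (t : ℝ) : ‖poleFactor x t‖ ≤ (-x)⁻¹ := by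
  have h : 0 ≤ max t 0 := le_max_right _ _
  rw [poleFactor, Complex.norm_real, norm_inv, Real.norm_of_nonneg (by linarith)]
  exact inv_anti₀ (by linarith) (by linarith)

theorem lipschitzWith_poleFactor {x : ℝ} (hx : x < 0) :
    LipschitzWith (Real.toNNReal ((-x)⁻¹ ^ 2)) (poleFactor x) := by
  refine LipschitzWith.of_dist_le_mul fun s t => ?_
  have hs : 0 ≤ max s 0 := le_max_right _ _
  have ht : 0 ≤ max t 0 := le_max_right _ _
  have h1 : 0 < max s 0 - x := by linarith
  have h2 : 0 < max t 0 - x := by linarith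
  have hx' : 0 < -x := by linarith
  rw [dist_eq_norm, poleFactor, poleFactor, ← Complex.ofReal_sub, Complex.norm_real,
    Real.coe_toNNReal _ (by positivity), inv_sub_inv h1.ne' h2.ne', norm_div,
    Real.norm_of_nonneg (mul_pos h1 h2).le, div_eq_inv_mul]
  have h3 : ‖max t 0 - x - (max s 0 - x)‖ ≤ dist s t := by
    rw [sub_sub_sub_cancel_right, Real.norm_eq_abs, Real.dist_eq, abs_sub_comm s t]
    simpa using abs_max_sub_max_le_max t 0 s 0
  have h4 : ((max s 0 - x) * (max t 0 - x))⁻¹ ≤ (-x)⁻¹ ^ 2 := by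
    rw [inv_pow, sq]
    refine inv_anti₀ (by positivity) ?_
    gcongr <;> linarith
  gcongr

namespace Weight

variable {ρ : ℝ → ℝ}

theorem nice_pole (hρ : Weight ρ) {x : ℝ} (hx : x < 0) :
    Nice fun t => (ρ t : ℂ) * poleFactor x t :=
  hρ.nice.mul (lipschitzWith_poleFactor hx) (norm_poleFactor_le hx)

theorem cauchy_mul_pole {φ : ℝ → ℂ} (hφ : Integrable φ) (hφ0 : ∀ t ≤ 0, φ t = 0) {x : ℝ} (hx : x < 0)
    {z : ℂ} (hz : z.im ≠ 0) :
    (z - x) * cauchy (fun t => φ t * poleFactor x t) z = cauchy φ z - cauchy φ x := by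
  have hne : ∀ t : ℝ, φ t ≠ 0 → 0 < t := fun t ht => by
    by_contra! h
    exact ht (hφ0 t h)
  have hzx : (x : ℂ) ≠ z := by
    rintro rfl
    simp at hz
  have hfun : (fun t => φ t * poleFactor x t) = fun t => φ t * ((t : ℂ) - (x : ℂ))⁻¹ := by
    funext t
    by_cases h : φ t = 0
    · simp [h]
    · rw [poleFactor_of_nonneg x (hne t h).le]
  have hint : Integrable fun t => φ t * ((t : ℂ) - (x : ℂ))⁻¹ := by
    rw [← hfun]
    exact hφ.mul_bdd (lipschitzWith_poleFactor hx).continuous.aestronglyMeasurable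
      (Eventually.of_forall (norm_poleFactor_le hx))
  rw [hfun, cauchy_mul_kernel hint (integrable_mul_kernel hφ hz) (fun t ht => ?_)
    (fun t _ => ofReal_sub_ne_zero hz t) hzx]
  · have : (x : ℂ) - z ≠ 0 := sub_ne_zero.mpr hzx
    field_simp
    ring
  · have := hne t ht
    rw [← Complex.ofReal_sub, Complex.ofReal_ne_zero]
    linarith

theorem det_mul_pole (hρ : Weight ρ) {lam x : ℝ} (hx : x < 0) (hx0 : 1 + lam * stieltjes ρ x = 0)
    {z : ℂ} (hz : z.im ≠ 0) :
    (z - x) * (lam * cauchy (fun t => (ρ t : ℂ) * poleFactor x t) z) = det ρ lam z := by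
  have h := cauchy_mul_pole hρ.nice.int (fun t ht => by simp [hρ.eq_zero t ht]) hx hz
  have h2 : (1 : ℂ) + lam * cauchy (fun t => (ρ t : ℂ)) x = 0 := by
    have h3 := det_ofReal ρ lam x
    rw [hx0, det] at h3
    simpa using h3
  rw [det]
  linear_combination (lam : ℂ) * h - h2

theorem detBdry_mul_pole (hρ : Weight ρ) {lam x : ℝ} (hx : x < 0)
    (hx0 : 1 + lam * stieltjes ρ x = 0) {σ : ℝ} (hσ : σ = 1 ∨ σ = -1) (s : ℝ) :
    ((s : ℂ) - x) * (lam * cauchyBdry (fun t => (ρ t : ℂ) * poleFactor x t) σ s) =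
      detBdry ρ lam σ s := by
  have h1 : Tendsto (fun ε : ℝ => (s : ℂ) + (σ * ε : ℝ) * I - x) (𝓝[>] 0) (𝓝 ((s : ℂ) - x)) := by
    have : Continuous fun ε : ℝ => (s : ℂ) + (σ * ε : ℝ) * I - x := by fun_prop
    have h := (this.tendsto 0).mono_left (nhdsWithin_le_nhds (s := Ioi 0))
    simpa using h
  refine tendsto_nhds_unique (h1.mul ((tendsto_cauchy_bdry (hρ.nice_pole hx) hσ s).const_mul _))
    ((hρ.tendsto_det lam hσ s).congr' ?_)
  filter_upwards [self_mem_nhdsWithin] with ε hε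
  rw [hρ.det_mul_pole hx hx0]
  rw [im_ofReal_add_mul_I]
  exact sign_mul_ne_zero hσ hε

theorem cauchyBdry_pole_at (hρ : Weight ρ) {x : ℝ} (hx : x < 0) (σ : ℝ) :
    cauchyBdry (fun t => (ρ t : ℂ) * poleFactor x t) σ x =
      (∫ t, ρ t / ((t - x) * (t - x)) : ℝ) := by
  rw [cauchyBdry, cauchyExt, ← integral_complex_ofReal]
  simp only [hρ.eq_zero x hx.le, regIntegrand]
  simp only [ofReal_zero, zero_mul, indicator_zero, mul_zero, sub_zero, add_zero]
  refine integral_congr_ae (Eventually.of_forall fun t => ?_)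
  simp only
  by_cases h : ρ t = 0
  · simp [h]
  · rw [poleFactor_of_nonneg x (hρ.pos_of_ne h).le]
    push_cast
    rw [div_eq_mul_inv, mul_inv, mul_assoc]

/-- The density with its determinant's zero at `x` moved off the closed half-plane. -/
def shifted (ρ : ℝ → ℝ) (lam x σ t : ℝ) : ℂ := lam * ρ t + lam * (σ * I) * (ρ t * poleFactor x t)

theorem nice_add {ρ₁ ρ₂ : ℝ → ℂ} (h₁ : Nice ρ₁) (h₂ : Nice ρ₂) : Nice fun t => ρ₁ t + ρ₂ t := by
  obtain ⟨K, hK⟩ := h₁.lip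
  obtain ⟨L, hL⟩ := h₂.lip
  exact ⟨⟨K + L, hK.add hL⟩, h₁.int.add h₂.int, by simpa using h₁.zero.add h₂.zero⟩

theorem nice_shifted (hρ : Weight ρ) (lam : ℝ) {x : ℝ} (hx : x < 0) (σ : ℝ) :
    Nice (shifted ρ lam x σ) :=
  nice_add (hρ.nice.const_mul lam) ((hρ.nice_pole hx).const_mul _)

theorem cauchy_shifted (hρ : Weight ρ) {lam x : ℝ} (hx : x < 0)
    (hx0 : 1 + lam * stieltjes ρ x = 0) (σ : ℝ) {z : ℂ} (hz : z.im ≠ 0) :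
    (z - x) * (1 + cauchy (shifted ρ lam x σ) z) = (z - x + σ * I) * det ρ lam z := by
  have h1 : cauchy (shifted ρ lam x σ) z = lam * cauchy (fun t => (ρ t : ℂ)) z +
      lam * (σ * I) * cauchy (fun t => (ρ t : ℂ) * poleFactor x t) z := by
    rw [← cauchy_const_mul, ← cauchy_const_mul]
    exact cauchy_add (hρ.nice.const_mul lam).memLp ((hρ.nice_pole hx).const_mul _).memLp hz
  have h2 := hρ.det_mul_pole hx hx0 hz
  rw [h1]
  have h3 : det ρ lam z = 1 + lam * cauchy (fun t => (ρ t : ℂ)) z := rfl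
  linear_combination (σ * I) * h2 - (z - x) * h3

theorem cauchyBdry_shifted_eq (hρ : Weight ρ) {lam x : ℝ} (hx : x < 0) {σ : ℝ}
    (hσ : σ = 1 ∨ σ = -1) (s : ℝ) : cauchyBdry (shifted ρ lam x σ) σ s =
      lam * cauchyBdry (fun t => (ρ t : ℂ)) σ s +
      lam * (σ * I) * cauchyBdry (fun t => (ρ t : ℂ) * poleFactor x t) σ s := by
  refine tendsto_nhds_unique (tendsto_cauchy_bdry (hρ.nice_shifted lam hx σ) hσ s)
    ((((tendsto_cauchy_bdry hρ.nice hσ s).const_mul _).add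
      ((tendsto_cauchy_bdry (hρ.nice_pole hx) hσ s).const_mul _)).congr' ?_)
  filter_upwards [self_mem_nhdsWithin] with ε hε
  rw [← cauchy_const_mul, ← cauchy_const_mul]
  refine (cauchy_add (hρ.nice.const_mul lam).memLp ((hρ.nice_pole hx).const_mul _).memLp ?_).symm
  rw [im_ofReal_add_mul_I]
  exact sign_mul_ne_zero hσ hε

theorem cauchyBdry_shifted (hρ : Weight ρ) {lam x : ℝ} (hx : x < 0)
    (hx0 : 1 + lam * stieltjes ρ x = 0) {σ : ℝ} (hσ : σ = 1 ∨ σ = -1) (s : ℝ) :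
    ((s : ℂ) - x) * (1 + cauchyBdry (shifted ρ lam x σ) σ s) =
      ((s : ℂ) - x + σ * I) * detBdry ρ lam σ s := by
  have h2 := hρ.detBdry_mul_pole hx hx0 hσ s
  rw [hρ.cauchyBdry_shifted_eq hx hσ]
  have h3 : detBdry ρ lam σ s = 1 + lam * cauchyBdry (fun t => (ρ t : ℂ)) σ s := rfl
  linear_combination (σ * I) * h2 - ((s : ℂ) - x) * h3

theorem sub_add_ne_zero {σ : ℝ} (hσ : σ = 1 ∨ σ = -1) {ε : ℝ} (hε : 0 ≤ ε) (s x : ℝ) :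
    (s : ℂ) + (σ * ε : ℝ) * I - x + σ * I ≠ 0 := by
  intro h
  have := congrArg Complex.im h
  simp at this
  rcases hσ with rfl | rfl <;> linarith

theorem one_add_cauchyExt_shifted_ne_zero (hρ : Weight ρ) {lam x : ℝ} (hx : x < 0)
    (hx0 : 1 + lam * stieltjes ρ x = 0) {σ : ℝ} (hσ : σ = 1 ∨ σ = -1) (s ε : ℝ) (hε : 0 ≤ ε) :
    1 + cauchyExt (shifted ρ lam x σ) σ s ε ≠ 0 := by
  rcases hε.eq_or_lt with rfl | hε
  · rw [← cauchyBdry]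
    rcases eq_or_ne s x with rfl | hs
    · rw [hρ.cauchyBdry_shifted_eq hx hσ, hρ.cauchyBdry_of_nonpos σ hx.le, hρ.cauchyBdry_pole_at hx,
        ← add_assoc]
      have h0 : (1 : ℂ) + lam * stieltjes ρ s = 0 := by exact_mod_cast hx0
      rw [h0, zero_add]
      have hl : lam ≠ 0 := by rintro rfl; simp at hx0
      have h1 := (hρ.integral_div_mul_pos hx.le hx).ne'
      have h2 : σ ≠ 0 := by rcases hσ with rfl | rfl <;> norm_num
      have h3 : ((∫ t, ρ t / ((t - s) * (t - s)) : ℝ) : ℂ) ≠ 0 := Complex.ofReal_ne_zero.mpr h1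
      exact mul_ne_zero (mul_ne_zero (Complex.ofReal_ne_zero.mpr hl)
        (mul_ne_zero (Complex.ofReal_ne_zero.mpr h2) I_ne_zero)) h3
    · intro h
      have h1 := hρ.cauchyBdry_shifted hx hx0 hσ s
      rw [h, mul_zero] at h1
      have h2 := sub_add_ne_zero hσ le_rfl s x
      simp only [mul_zero, ofReal_zero, zero_mul, add_zero] at h2
      have h3 : detBdry ρ lam σ s = 0 := (mul_eq_zero.mp h1.symm).resolve_left h2
      rcases le_or_gt s 0 with hs' | hs'
      · rw [hρ.detBdry_of_nonpos lam σ hs', Complex.ofReal_eq_zero] at h3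
        exact hs (hρ.zero_unique hs' hx.le h3 hx0)
      · exact hρ.detBdry_ne_zero_of_pos lam hσ hs' h3
  · rw [← cauchy_eq_cauchyExt (hρ.nice_shifted lam hx σ).int hσ hε]
    intro h
    have hz : ((s : ℂ) + (σ * ε : ℝ) * I).im ≠ 0 := by
      rw [im_ofReal_add_mul_I]
      exact sign_mul_ne_zero hσ hε
    have h1 := hρ.cauchy_shifted hx hx0 σ hz
    rw [h, mul_zero] at h1
    rcases mul_eq_zero.mp h1.symm with h2 | h2
    · exact sub_add_ne_zero hσ hε.le s x h2
    · exact hρ.det_ne_zero_of_im lam hz h2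

/-- The counterpart of `shifted` for the numerators. -/
def shiftedFun (φ : ℝ → ℂ) (x σ t : ℝ) : ℂ := φ t + σ * I * (φ t * poleFactor x t)

theorem integrable_mul_pole {φ : ℝ → ℂ} (hφ : Integrable φ) {x : ℝ} (hx : x < 0) :
    Integrable fun t => φ t * poleFactor x t :=
  hφ.mul_bdd (lipschitzWith_poleFactor hx).continuous.aestronglyMeasurable
      (Eventually.of_forall (norm_poleFactor_le hx))

theorem memLp_mul_pole {φ : ℝ → ℂ} (hφ : MemLp φ 2) {x : ℝ} (hx : x < 0) :
    MemLp (fun t => φ t * poleFactor x t) 2 := by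
  refine MemLp.of_le_mul (c := (-x)⁻¹) hφ
    (hφ.1.mul (lipschitzWith_poleFactor hx).continuous.aestronglyMeasurable)
    (Eventually.of_forall fun t => ?_)
  rw [norm_mul, mul_comm]
  gcongr
  exact norm_poleFactor_le hx t

theorem integrable_shiftedFun {φ : ℝ → ℂ} (hφ : Integrable φ) {x : ℝ} (hx : x < 0) (σ : ℝ) :
    Integrable (shiftedFun φ x σ) := hφ.add ((integrable_mul_pole hφ hx).const_mul _)

theorem memLp_shiftedFun {φ : ℝ → ℂ} (hφ : MemLp φ 2) {x : ℝ} (hx : x < 0) (σ : ℝ) :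
    MemLp (shiftedFun φ x σ) 2 := hφ.add ((memLp_mul_pole hφ hx).const_mul _)

theorem bdryOp_shiftedFun {φ : ℝ → ℂ} (hφ : Integrable φ) (hφ2 : MemLp φ 2)
    (hφ0 : ∀ t ≤ 0, φ t = 0) {x : ℝ} (hx : x < 0) (hφx : cauchy φ x = 0) {σ : ℝ}
    (hσ : σ = 1 ∨ σ = -1) :
    ∀ᵐ s : ℝ, ((s : ℂ) - x) * bdryOp σ hσ ((memLp_shiftedFun hφ2 hx σ).toLp _) s =
      ((s : ℂ) - x + σ * I) * bdryOp σ hσ (hφ2.toLp φ) s := by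
  refine ae_eq_of_tendsto_of_tendsto
    (m := fun ε s => (s : ℂ) + (σ * ε : ℝ) * I - x)
    (m' := fun ε s => (s : ℂ) + (σ * ε : ℝ) * I - x + σ * I) (fun ε hε => ?_)
    (tendsto_lineOp' hσ _) (tendsto_lineOp' hσ _) (fun t => ?_) (fun t => ?_)
  · have hne := sign_mul_ne_zero hσ hε
    rw [lineOp'_eq hne]
    filter_upwards [coeFn_lineOp hne ((memLp_shiftedFun hφ2 hx σ).toLp _),
      coeFn_lineOp hne (hφ2.toLp φ)] with s h1 h2
    rw [h1, h2, cauchy_congr (memLp_shiftedFun hφ2 hx σ).coeFn_toLp, cauchy_congr hφ2.coeFn_toLp]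
    have hz : ((s : ℂ) + (σ * ε : ℝ) * I).im ≠ 0 := by rwa [im_ofReal_add_mul_I]
    set z := (s : ℂ) + (σ * ε : ℝ) * I
    have h3 : cauchy (shiftedFun φ x σ) z = cauchy φ z +
        σ * I * cauchy (fun t => φ t * poleFactor x t) z := by
      rw [← cauchy_const_mul]
      exact cauchy_add hφ2 ((memLp_mul_pole hφ2 hx).const_mul _) hz
    have h4 := cauchy_mul_pole hφ hφ0 hx hz
    rw [hφx, sub_zero] at h4
    rw [h3]
    linear_combination (σ * I) * h4
  · have : Continuous fun ε : ℝ => (t : ℂ) + (σ * ε : ℝ) * I - x := by fun_prop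
    have h := (this.tendsto 0).mono_left (nhdsWithin_le_nhds (s := Ioi 0))
    simpa using h
  · have : Continuous fun ε : ℝ => (t : ℂ) + (σ * ε : ℝ) * I - x + σ * I := by fun_prop
    have h := (this.tendsto 0).mono_left (nhdsWithin_le_nhds (s := Ioi 0))
    simpa using h

theorem bdryOp_eq_zero_of_shiftedFun {φ : ℝ → ℂ} {hφ2 : MemLp φ 2} {x : ℝ} {hx : x < 0} {σ : ℝ}
    {hσ : σ = 1 ∨ σ = -1}
    (h : ∀ᵐ s : ℝ, ((s : ℂ) - x) * bdryOp σ hσ ((memLp_shiftedFun hφ2 hx σ).toLp _) s =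
      ((s : ℂ) - x + σ * I) * bdryOp σ hσ (hφ2.toLp φ) s)
    (h0 : bdryOp σ hσ ((memLp_shiftedFun hφ2 hx σ).toLp _) = 0) :
    bdryOp σ hσ (hφ2.toLp φ) = 0 := by
  rw [h0] at h
  refine Lp.ext ?_
  filter_upwards [h, Lp.coeFn_zero ℂ 2 volume] with s h1 h2
  rw [h2, Pi.zero_apply, mul_zero] at h1
  rw [h2, Pi.zero_apply]
  refine (mul_eq_zero.mp h1.symm).resolve_left ?_
  have := sub_add_ne_zero hσ le_rfl s x
  simpa using this

/-- Below the critical coupling the kernel of the adjoint wave operator meets the orthogonal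
complement of the bound state trivially. -/
theorem eq_zero_of_add_waveAdj_of_cauchy (hρ : Weight ρ) {lam : ℝ} (hl : lam ≠ critical ρ) {x : ℝ}
    (hx : x < 0) (hx0 : 1 + lam * stieltjes ρ x = 0) {σ : ℝ}
    (hσ : σ = 1 ∨ σ = -1) {u : L2R} (hu : u + waveAdj ρ lam σ hσ u = 0)
    (hux : cauchy (fun t => root ρ t * u t) x = 0) : u = 0 := by
  have hi := hρ.integrable_root_mul u
  have h2 := hρ.memLp_root_mul u
  have h0 : ∀ t ≤ 0, root ρ t * u t = 0 := fun t ht => by simp [hρ.root_of_nonpos ht]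
  have hp := bdryOp_shiftedFun hi h2 h0 hx hux (Or.inl rfl : (1 : ℝ) = 1 ∨ (1 : ℝ) = -1)
  have hm := bdryOp_shiftedFun hi h2 h0 hx hux (Or.inr rfl : (-1 : ℝ) = 1 ∨ (-1 : ℝ) = -1)
  have h := bdryOp_eq_zero_of_cross (hρ.nice_shifted lam hx 1) (hρ.nice_shifted lam hx (-1))
    (hρ.one_add_cauchyExt_shifted_ne_zero hx hx0 (Or.inl rfl))
    (hρ.one_add_cauchyExt_shifted_ne_zero hx hx0 (Or.inr rfl))
    (integrable_shiftedFun hi hx 1) (memLp_shiftedFun h2 hx 1)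
    (integrable_shiftedFun hi hx (-1)) (memLp_shiftedFun h2 hx (-1)) (by
      have hne : ∀ᵐ t : ℝ, t ≠ x := by simp [ae_iff, measure_singleton]
      filter_upwards [hp, hm, hρ.detBdry_mul_bdryOp hl hσ hu, hne] with t h3 h4 h5 h6
      rw [hρ.toLp_root_mul] at h3 h4
      have h7 := hρ.cauchyBdry_shifted hx hx0 (Or.inl rfl : (1 : ℝ) = 1 ∨ (1 : ℝ) = -1) t
      have h8 := hρ.cauchyBdry_shifted hx hx0 (Or.inr rfl : (-1 : ℝ) = 1 ∨ (-1 : ℝ) = -1) t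
      have h9 : (t : ℂ) - x ≠ 0 := by
        rw [← Complex.ofReal_sub, Complex.ofReal_ne_zero, sub_ne_zero]
        exact h6
      refine mul_left_cancel₀ (mul_ne_zero h9 h9) ?_
      rw [mul_mul_mul_comm, h3, h8, mul_mul_mul_comm ((t : ℂ) - x), h4, h7]
      linear_combination ((t : ℂ) - x + (-1 : ℝ) * I) * ((t : ℂ) - x + (1 : ℝ) * I) * h5)
  have k1 := bdryOp_eq_zero_of_shiftedFun (hx := hx) hp h.1
  have k2 := bdryOp_eq_zero_of_shiftedFun (hx := hx) hm h.2
  rw [hρ.toLp_root_mul] at k1 k2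
  exact eq_zero_of_bdryOps_eq_zero hσ hu k1 k2

/-- The bound state `√ρ(t) / (t - x)`. -/
def bound (ρ : ℝ → ℝ) (x t : ℝ) : ℂ := root ρ t * poleFactor x t

theorem memLp_bound (hρ : Weight ρ) {x : ℝ} (hx : x < 0) : MemLp (bound ρ x) 2 :=
  memLp_mul_pole hρ.memLp_root hx

theorem add_waveAdj_bound (hρ : Weight ρ) {lam : ℝ} (hl : lam ≠ critical ρ) {x : ℝ}
    (hx : x < 0) (hx0 : 1 + lam * stieltjes ρ x = 0) {σ : ℝ} (hσ : σ = 1 ∨ σ = -1) :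
    (hρ.memLp_bound hx).toLp _ + waveAdj ρ lam σ hσ ((hρ.memLp_bound hx).toLp _) = 0 := by
  have h1 : mulOp (root ρ) ((hρ.memLp_bound hx).toLp _) = (hρ.nice_pole hx).memLp.toLp _ := by
    refine mulOp_congr hρ.memLp_top_root ?_
    filter_upwards [(hρ.memLp_bound hx).coeFn_toLp, (hρ.nice_pole hx).memLp.coeFn_toLp]
      with t h1 h2
    rw [h1, h2, bound, ← mul_assoc, hρ.root_mul_root]
  refine Lp.ext ?_
  filter_upwards [Lp.coeFn_add ((hρ.memLp_bound hx).toLp _)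
    (waveAdj ρ lam σ hσ ((hρ.memLp_bound hx).toLp _)), hρ.coeFn_waveAdj hl hσ
    ((hρ.memLp_bound hx).toLp _), (hρ.memLp_bound hx).coeFn_toLp, Lp.coeFn_zero ℂ 2 volume,
    coeFn_bdryOp_of_nice (hρ.nice_pole hx) (neg_sign hσ)] with t h2 h3 h4 h5 h6
  rw [h2, Pi.add_apply, h3, h4, h5, h1, h6, bound, quot, Pi.zero_apply]
  rcases le_or_gt t 0 with ht | ht
  · simp [hρ.root_of_nonpos ht]
  · rw [poleFactor_of_nonneg x ht.le]
    have h7 := hρ.detBdry_mul_pole hx hx0 (neg_sign hσ) t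
    have h8 := hρ.detBdry_ne_zero_of_pos lam (neg_sign hσ) ht
    have h9 : (t : ℂ) - x ≠ 0 := by
      rw [← Complex.ofReal_sub, Complex.ofReal_ne_zero]
      linarith
    field_simp
    linear_combination -root ρ t * h7

theorem norm_bound_sq (hρ : Weight ρ) {x : ℝ} (hx : x < 0) :
    ‖(hρ.memLp_bound hx).toLp _‖ ^ 2 = ∫ t, ρ t / ((t - x) * (t - x)) := by
  rw [norm_toLp_sq]
  refine integral_congr_ae (Eventually.of_forall fun t => ?_)
  simp only
  rw [bound, norm_mul, mul_pow, hρ.norm_root_sq]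
  by_cases h : ρ t = 0
  · simp [h]
  have ht := hρ.pos_of_ne h
  rw [poleFactor_of_nonneg x ht.le, norm_inv, ← Complex.ofReal_sub, Complex.norm_real, inv_pow,
    ← sq, Real.norm_eq_abs, sq_abs, div_eq_mul_inv]

theorem inner_bound (hρ : Weight ρ) {x : ℝ} (hx : x < 0) (u : L2R) :
    inner ℂ ((hρ.memLp_bound hx).toLp _) u = cauchy (fun t => root ρ t * u t) x := by
  rw [inner_eq_integral, cauchy]
  refine integral_congr_ae ?_
  filter_upwards [(hρ.memLp_bound hx).coeFn_toLp] with t h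
  rw [h, bound, map_mul, conj_root]
  rcases le_or_gt t 0 with ht | ht
  · simp [hρ.root_of_nonpos ht]
  · have : conj (poleFactor x t) = poleFactor x t := conj_ofReal _
    rw [this, poleFactor_of_nonneg x ht.le]
    ring

theorem hasDerivAt_det (hρ : Weight ρ) (lam : ℝ) {x : ℝ} (hx : x < 0) :
    HasDerivAt (det ρ lam) (lam * (∫ t, ρ t / ((t - x) * (t - x)) : ℝ)) x := by
  have h := (hasDerivAt_cauchy hρ.nice.int (z := x) (δ := -x) (by linarith) (fun t ht => by
    have := hρ.pos_of_ne (by simpa using ht)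
    rw [← Complex.ofReal_sub, Complex.norm_real, Real.norm_eq_abs, abs_of_pos (by linarith)]
    linarith)).const_mul (lam : ℂ) |>.const_add 1
  have e : ((∫ t, ρ t / ((t - x) * (t - x)) : ℝ) : ℂ) =
      ∫ t : ℝ, (ρ t : ℂ) * (((t : ℂ) - x)⁻¹) ^ 2 := by
    rw [← integral_complex_ofReal]
    congr 1
    funext t
    push_cast
    rw [div_eq_mul_inv, inv_pow, sq]
  rw [e]
  exact h

end Weight
end CauchyTransform

end

noncomputable section

namespace PairModel
open scoped ComplexConjugate ENNReal NNReal

variable {H : Type*} [NormedAddCommGroup H] [InnerProductSpace ℂ H]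

theorem IsResolvent.resolv_eq {A : H →ₗ.[ℂ] H} {z : ℂ} {R : H →L[ℂ] H} (hR : IsResolvent A z R) :
    resolv A z = R := by
  have h : ∃ R : H →L[ℂ] H, IsResolvent A z R := ⟨R, hR⟩
  rw [resolv, dif_pos h]
  ext f
  obtain ⟨h1, h2⟩ := hR.1 f
  have h3 := h.choose_spec.2 ⟨R f, h1⟩
  rw [h2] at h3
  exact h3

theorem IsResolvent.comp_neg {A : H →ₗ.[ℂ] H} {ζ : ℂ} {R R' : H →L[ℂ] H} (hR : IsResolvent A ζ R)
    (hR' : IsResolvent A (-ζ) R') : IsResolvent (sq A) (ζ ^ 2) (R ∘L R') := by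
  constructor
  · intro f
    obtain ⟨h1, h2⟩ := hR'.1 f
    obtain ⟨h3, h4⟩ := hR.1 (R' f)
    have h5 : A ⟨R (R' f), h3⟩ = ζ • R (R' f) + R' f := sub_eq_iff_eq_add'.mp h4
    have h6 : ζ • R (R' f) + R' f ∈ A.domain := A.domain.add_mem (A.domain.smul_mem _ h3) h1
    have h7 : A ⟨R (R' f), h3⟩ ∈ A.domain := by rwa [h5]
    refine ⟨⟨h3, h7⟩, ?_⟩
    have h8 : sq A ⟨R (R' f), ⟨h3, h7⟩⟩ = A ⟨A ⟨R (R' f), h3⟩, h7⟩ := rfl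
    have h9 : (⟨A ⟨R (R' f), h3⟩, h7⟩ : A.domain) = ζ • ⟨R (R' f), h3⟩ + ⟨R' f, h1⟩ :=
      Subtype.ext h5
    have h10 : A ⟨R' f, h1⟩ = f - ζ • R' f := by
      rw [neg_smul, sub_neg_eq_add] at h2
      exact eq_sub_of_add_eq h2
    change sq A ⟨R (R' f), ⟨h3, h7⟩⟩ - ζ ^ 2 • R (R' f) = f
    rw [h8, h9, A.map_add, A.map_smul, h5, h10, pow_two, mul_smul, smul_add]
    abel
  · rintro ⟨v, h1, h2⟩
    have h3 : A ⟨v, h1⟩ - ζ • v ∈ A.domain := A.domain.sub_mem h2 (A.domain.smul_mem _ h1)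
    have h4 : sq A ⟨v, ⟨h1, h2⟩⟩ = A ⟨A ⟨v, h1⟩, h2⟩ := rfl
    have h5 := hR'.2 ⟨A ⟨v, h1⟩ - ζ • v, h3⟩
    have h6 : (⟨A ⟨v, h1⟩ - ζ • v, h3⟩ : A.domain) = ⟨A ⟨v, h1⟩, h2⟩ - ζ • ⟨v, h1⟩ := rfl
    have h7 := hR.2 ⟨v, h1⟩
    change R (R' (sq A ⟨v, ⟨h1, h2⟩⟩ - ζ ^ 2 • v)) = v
    have h8 : sq A ⟨v, ⟨h1, h2⟩⟩ - ζ ^ 2 • v =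
        A ⟨A ⟨v, h1⟩ - ζ • v, h3⟩ - (-ζ) • (A ⟨v, h1⟩ - ζ • v) := by
      rw [h6, A.map_sub, A.map_smul, h4, pow_two, mul_smul, neg_smul, smul_sub]
      abel
    rw [h8]
    exact (congrArg R h5).trans h7

theorem inner_self_eq_ofReal (v : H) : inner ℂ v v = ((‖v‖ ^ 2 : ℝ) : ℂ) := by
  rw [inner_self_eq_norm_sq_to_K]
  simp

variable [CompleteSpace H]

theorem inner_symm {T : H →ₗ.[ℂ] H} (hT : IsSelfAdjoint T) (v w : T.domain) :
    inner ℂ (T v) (w : H) = inner ℂ (v : H) (T w) := by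
  have h := LinearPMap.adjoint_isFormalAdjoint hT.dense_domain
  rw [LinearPMap.isSelfAdjoint_def.mp hT] at h
  exact h v w

theorem mem_domain_of_inner {T : H →ₗ.[ℂ] H} (hT : IsSelfAdjoint T) {y w : H}
    (h : ∀ x : T.domain, inner ℂ w (x : H) = inner ℂ y (T x)) :
    ∃ hy : y ∈ T.domain, T ⟨y, hy⟩ = w := by
  have hd := hT.dense_domain
  have h0 := LinearPMap.isSelfAdjoint_def.mp hT
  have h1 : y ∈ T.adjoint.domain := LinearPMap.mem_adjoint_domain_of_exists y ⟨w, h⟩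
  have h2 := LinearPMap.adjoint_apply_eq hd ⟨y, h1⟩ h
  have h3 : ∀ S : H →ₗ.[ℂ] H, S = T → ∀ (h1 : y ∈ S.domain), S ⟨y, h1⟩ = w →
      ∃ hy : y ∈ T.domain, T ⟨y, hy⟩ = w := by
    rintro S rfl h1 h2
    exact ⟨h1, h2⟩
  exact h3 _ h0 h1 h2

theorem exists_isResolvent {T : H →ₗ.[ℂ] H} (hT : IsSelfAdjoint T) {ζ : ℂ} {c : ℝ} (hc : 0 < c)
    (h : ∀ v : T.domain, c * ‖(v : H)‖ ≤ ‖T v - ζ • (v : H)‖)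
    (h' : ∀ v : T.domain, T v = conj ζ • (v : H) → (v : H) = 0) :
    ∃ R : H →L[ℂ] H, IsResolvent T ζ R := by
  set A : T.domain →ₗ[ℂ] H := T.toFun - ζ • T.domain.subtype with hA
  have hAv : ∀ v : T.domain, A v = T v - ζ • (v : H) := fun v => rfl
  have hclosed : IsClosed (LinearMap.range A : Set H) := by
    have hg : IsClosed (T.graph : Set (H × H)) := hT.isClosed
    let F : T.graph → H := fun p => p.1.2 - ζ • p.1.1
    have hF : ∀ p : T.graph, ∃ v : T.domain, p.1 = ((v : H), T v) := by
      rintro ⟨⟨x, y⟩, hp⟩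
      obtain ⟨v, hv⟩ := LinearPMap.mem_graph_iff _ |>.mp hp
      exact ⟨v, Prod.ext hv.1.symm hv.2.symm⟩
    have hrange : (LinearMap.range A : Set H) = range F := by
      ext y
      constructor
      · rintro ⟨v, rfl⟩
        exact ⟨⟨((v : H), T v), LinearPMap.mem_graph T v⟩, rfl⟩
      · rintro ⟨p, rfl⟩
        obtain ⟨v, hv⟩ := hF p
        refine ⟨v, ?_⟩
        rw [hAv]
        simp [F, hv]
    rw [hrange]
    have : CompleteSpace T.graph := hg.completeSpace_coe
    have hlip : AntilipschitzWith (Real.toNNReal (1 + (1 + ‖ζ‖) * c⁻¹)) F := by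
      refine AntilipschitzWith.of_le_mul_dist fun p q => ?_
      obtain ⟨v, hv⟩ := hF (p - q)
      have e1 : F p - F q = T v - ζ • (v : H) := by
        have h1 : (p - q).1.1 = v := by rw [hv]
        have h2 : (p - q).1.2 = T v := by rw [hv]
        have h3 : p.1.1 - q.1.1 = (v : H) := h1
        have h4 : p.1.2 - q.1.2 = T v := h2
        rw [← h3, ← h4]
        simp only [F, smul_sub]
        abel
      rw [Real.coe_toNNReal _ (by positivity), dist_eq_norm, dist_eq_norm, e1]
      have e2 : ‖p - q‖ = max ‖(v : H)‖ ‖T v‖ := by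
        change ‖(p - q).1‖ = _
        rw [hv, Prod.norm_def]
      rw [e2]
      have h1 := h v
      set N := ‖T v - ζ • (v : H)‖
      have h2 : ‖(v : H)‖ ≤ c⁻¹ * N := by
        rw [inv_mul_eq_div, le_div_iff₀ hc]
        linarith
      have h3 : ‖T v‖ ≤ N + ‖ζ‖ * ‖(v : H)‖ := by
        rw [← norm_smul]
        calc ‖T v‖ = ‖(T v - ζ • (v : H)) + ζ • (v : H)‖ := by rw [sub_add_cancel]
          _ ≤ _ := norm_add_le _ _
      have hN : 0 ≤ N := norm_nonneg _
      have hci : 0 < c⁻¹ := inv_pos.mpr hc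
      have h4 : ‖ζ‖ * ‖(v : H)‖ ≤ ‖ζ‖ * (c⁻¹ * N) := by gcongr
      have h5 : 0 ≤ ‖ζ‖ * (c⁻¹ * N) := by positivity
      have h6 : 0 ≤ c⁻¹ * N := by positivity
      refine max_le ?_ ?_ <;> nlinarith
    refine hlip.isClosed_range ?_
    have : LipschitzWith (1 + ‖ζ‖₊) F := by
      refine LipschitzWith.of_dist_le_mul fun p q => ?_
      rw [dist_eq_norm, dist_eq_norm]
      have e : F p - F q = (p - q).1.2 - ζ • (p - q).1.1 := by
        have h3 : (p - q).1.1 = p.1.1 - q.1.1 := rfl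
        have h4 : (p - q).1.2 = p.1.2 - q.1.2 := rfl
        rw [h3, h4]
        simp only [F, smul_sub]
        abel
      have h1 : ‖(p - q).1.1‖ ≤ ‖p - q‖ := norm_fst_le (p - q).1
      have h2 : ‖(p - q).1.2‖ ≤ ‖p - q‖ := norm_snd_le (p - q).1
      rw [e]
      calc _ ≤ ‖(p - q).1.2‖ + ‖ζ • (p - q).1.1‖ := norm_sub_le _ _
        _ ≤ ‖p - q‖ + ‖ζ‖ * ‖p - q‖ := by
          rw [norm_smul]
          gcongr
        _ = _ := by
          push_cast
          ring
    exact this.uniformContinuous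
  have htop : LinearMap.range A = ⊤ := by
    have : CompleteSpace (LinearMap.range A) := hclosed.completeSpace_coe
    rw [← Submodule.orthogonal_eq_bot_iff, Submodule.eq_bot_iff]
    intro y hy
    obtain ⟨hy1, hy2⟩ := mem_domain_of_inner hT (y := y) (w := conj ζ • y) (fun x => by
      have h1 := (Submodule.mem_orthogonal' _ _).mp hy (A x) ⟨x, rfl⟩
      rw [hAv, inner_sub_right, sub_eq_zero, inner_smul_right] at h1
      rw [inner_smul_left, Complex.conj_conj, h1])
    exact h' ⟨y, hy1⟩ hy2
  have hinj : Function.Injective A := by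
    rw [← LinearMap.ker_eq_bot, LinearMap.ker_eq_bot']
    intro v hv
    have h1 := h v
    rw [← hAv, hv, norm_zero] at h1
    have h2 : ‖(v : H)‖ = 0 := by
      have := norm_nonneg (v : H)
      nlinarith
    exact Subtype.ext (norm_eq_zero.mp h2)
  let e : T.domain ≃ₗ[ℂ] H := LinearEquiv.ofBijective A ⟨hinj, LinearMap.range_eq_top.mp htop⟩
  have he : ∀ f, A (e.symm f) = f := fun f => e.apply_symm_apply f
  let R : H →L[ℂ] H := LinearMap.mkContinuous (T.domain.subtype ∘ₗ e.symm.toLinearMap) c⁻¹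
    (fun f => by
      have h1 := h (e.symm f)
      rw [← hAv, he] at h1
      change ‖((e.symm f : T.domain) : H)‖ ≤ _
      rw [inv_mul_eq_div, le_div_iff₀ hc]
      linarith)
  have hR : ∀ f, R f = (e.symm f : T.domain) := fun f => rfl
  refine ⟨R, fun f => ⟨?_, ?_⟩, fun v => ?_⟩
  · rw [hR]
    exact (e.symm f).2
  · exact he f
  · rw [hR]
    have : T v - ζ • (v : H) = e v := rfl
    rw [this, e.symm_apply_apply]

theorem exists_isResolvent_of_im {T : H →ₗ.[ℂ] H} (hT : IsSelfAdjoint T) {ζ : ℂ} (hζ : ζ.im ≠ 0) :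
    ∃ R : H →L[ℂ] H, IsResolvent T ζ R := by
  have key : ∀ ζ : ℂ, ∀ v : T.domain, |ζ.im| * ‖(v : H)‖ ≤ ‖T v - ζ • (v : H)‖ := by
    intro ζ v
    have h1 : (inner ℂ (v : H) (T v)).im = 0 := by
      have h := inner_symm hT v v
      rw [← inner_conj_symm] at h
      exact Complex.conj_eq_iff_im.mp h
    have h2 : (inner ℂ (v : H) (T v - ζ • (v : H))).im = -(ζ.im * ‖(v : H)‖ ^ 2) := by
      rw [inner_sub_right, inner_smul_right, Complex.sub_im, h1, inner_self_eq_ofReal,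
        Complex.im_mul_ofReal, zero_sub]
    have h3 : |ζ.im| * ‖(v : H)‖ ^ 2 ≤ ‖(v : H)‖ * ‖T v - ζ • (v : H)‖ := by
      calc |ζ.im| * ‖(v : H)‖ ^ 2 = |(inner ℂ (v : H) (T v - ζ • (v : H))).im| := by
            rw [h2, abs_neg, abs_mul, abs_of_nonneg (sq_nonneg ‖(v : H)‖)]
        _ ≤ ‖inner ℂ (v : H) (T v - ζ • (v : H))‖ := Complex.abs_im_le_norm _
        _ ≤ _ := norm_inner_le_norm _ _
    rcases (norm_nonneg (v : H)).eq_or_lt with h4 | h4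
    · rw [← h4, mul_zero]
      positivity
    · refine le_of_mul_le_mul_left ?_ h4
      linarith
  refine exists_isResolvent hT (abs_pos.mpr hζ) (key ζ) fun v hv => ?_
  have h := key (conj ζ) v
  rw [hv, sub_self, norm_zero, Complex.conj_im, abs_neg] at h
  have h1 := abs_pos.mpr hζ
  have h2 : ‖(v : H)‖ = 0 := by
    have := norm_nonneg (v : H)
    nlinarith
  exact norm_eq_zero.mp h2

theorem exists_isResolvent_of_neg {T : H →ₗ.[ℂ] H} (hT : IsSelfAdjoint T)
    (hpos : ∀ f : T.domain, 0 ≤ (inner ℂ (f : H) (T f)).re) {x : ℝ} (hx : x < 0) :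
    ∃ R : H →L[ℂ] H, IsResolvent T x R := by
  have key : ∀ v : T.domain, -x * ‖(v : H)‖ ≤ ‖T v - (x : ℂ) • (v : H)‖ := by
    intro v
    have h2 : (inner ℂ (v : H) (T v - (x : ℂ) • (v : H))).re =
        (inner ℂ (v : H) (T v)).re - x * ‖(v : H)‖ ^ 2 := by
      rw [inner_sub_right, inner_smul_right, Complex.sub_re, inner_self_eq_ofReal,
        ← Complex.ofReal_mul, Complex.ofReal_re]
    have h3 : -x * ‖(v : H)‖ ^ 2 ≤ ‖(v : H)‖ * ‖T v - (x : ℂ) • (v : H)‖ := by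
      calc -x * ‖(v : H)‖ ^ 2 ≤ (inner ℂ (v : H) (T v - (x : ℂ) • (v : H))).re := by
            rw [h2]
            have := hpos v
            linarith
        _ ≤ ‖inner ℂ (v : H) (T v - (x : ℂ) • (v : H))‖ := Complex.re_le_norm _
        _ ≤ _ := norm_inner_le_norm _ _
    rcases (norm_nonneg (v : H)).eq_or_lt with h4 | h4
    · rw [← h4, mul_zero]
      positivity
    · refine le_of_mul_le_mul_left ?_ h4
      linarith
  have hx' : 0 < -x := by linarith
  refine exists_isResolvent hT hx' key fun v hv => ?_
  have h := key v
  rw [hv, Complex.conj_ofReal, sub_self, norm_zero] at h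
  have h2 : ‖(v : H)‖ = 0 := by
    have := norm_nonneg (v : H)
    nlinarith
  exact norm_eq_zero.mp h2

theorem lowestEnergy_nonneg {T : H →ₗ.[ℂ] H} (hT : IsSelfAdjoint T)
    (hpos : ∀ f : T.domain, 0 ≤ (inner ℂ (f : H) (T f)).re) : 0 ≤ lowestEnergy T := by
  refine Real.sInf_nonneg fun x hx => ?_
  by_contra! h
  exact hx (exists_isResolvent_of_neg hT hpos h)

theorem exists_isResolvent_of_lt {T : H →ₗ.[ℂ] H} (hT : IsSelfAdjoint T)
    (hpos : ∀ f : T.domain, 0 ≤ (inner ℂ (f : H) (T f)).re) {x : ℝ} (hx : x < lowestEnergy T) :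
    ∃ R : H →L[ℂ] H, IsResolvent T x R := by
  by_contra h
  refine hx.not_ge (csInf_le ⟨0, fun y hy => ?_⟩ h)
  by_contra! hy'
  exact hy (exists_isResolvent_of_neg hT hpos hy')

/-- The resolvent set of `T²` contains the complement of `[E₀², ∞)`. -/
theorem exists_isResolvent_sq {T : H →ₗ.[ℂ] H} (hT : IsSelfAdjoint T)
    (hpos : ∀ f : T.domain, 0 ≤ (inner ℂ (f : H) (T f)).re) {z : ℂ}
    (hz : z.im ≠ 0 ∨ z.re < lowestEnergy T ^ 2) :
    ∃ R : H →L[ℂ] H, IsResolvent (sq T) z R := by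
  suffices h : ∃ ζ : ℂ, ζ ^ 2 = z ∧ (ζ.im ≠ 0 ∨ ∃ x : ℝ, 0 ≤ x ∧ x < lowestEnergy T ∧ ζ = x) by
    obtain ⟨ζ, rfl, h⟩ := h
    rcases h with h | ⟨x, hx0, hx, rfl⟩
    · obtain ⟨R, hR⟩ := exists_isResolvent_of_im hT h
      obtain ⟨R', hR'⟩ := exists_isResolvent_of_im hT (ζ := -ζ) (by simpa using h)
      exact ⟨_, hR.comp_neg hR'⟩
    · obtain ⟨R, hR⟩ := exists_isResolvent_of_lt hT hpos hx
      obtain ⟨R', hR'⟩ := exists_isResolvent_of_lt hT hpos (x := -x) (by linarith)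
      rw [Complex.ofReal_neg] at hR'
      exact ⟨_, hR.comp_neg hR'⟩
  have hE := lowestEnergy_nonneg hT hpos
  obtain ⟨ζ, hζ⟩ := IsAlgClosed.exists_pow_nat_eq z (n := 2) (by norm_num)
  by_cases hi : ζ.im = 0
  · have hre : ζ = (ζ.re : ℂ) := Complex.ext rfl (by simpa using hi)
    refine ⟨(|ζ.re| : ℝ), ?_, Or.inr ⟨|ζ.re|, abs_nonneg _, ?_, rfl⟩⟩
    · rw [← hζ]
      conv_rhs => rw [hre]
      rw [← Complex.ofReal_pow, sq_abs, Complex.ofReal_pow]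
    · have h1 : z = ((ζ.re ^ 2 : ℝ) : ℂ) := by
        rw [← hζ]
        conv_lhs => rw [hre]
        push_cast
        rfl
      rcases hz with hz | hz
      · rw [h1] at hz
        exact absurd (Complex.ofReal_im _) hz
      · rw [h1, Complex.ofReal_re] at hz
        exact abs_lt_of_sq_lt_sq hz hE
  · exact ⟨ζ, hζ, Or.inl hi⟩

end PairModel

end

noncomputable section

namespace PairModel
open scoped ComplexConjugate ENNReal NNReal

section VectorMeasureDensity

variable {X : Type*} [MeasurableSpace X] {μ : Measure X} {h : X → ℂ}
  {V : Type*} [NormedAddCommGroup V] [NormedSpace ℝ V]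
  {G : Type*} [NormedAddCommGroup G] [NormedSpace ℝ G]

theorem integrable_of_integrable_norm_mul {V : Type*} [NormedAddCommGroup V] (hh : Integrable h μ) {F : X → V}
    (hF : AEStronglyMeasurable F μ) (hFh : Integrable (fun x => ‖F x‖ * ‖h x‖) μ) :
    (μ.withDensityᵥ h).Integrable F := by
  have hm : AEMeasurable (fun x => ‖h x‖ₑ) μ := hh.1.enorm
  rw [VectorMeasure.Integrable, Measure.variation_withDensityᵥ hh]
  refine ⟨hF.mono_ac (withDensity_absolutelyContinuous _ _), ?_⟩
  rw [HasFiniteIntegral, lintegral_withDensity_eq_lintegral_mul₀ hm hF.enorm]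
  have h1 := hFh.2
  rw [HasFiniteIntegral] at h1
  refine lt_of_le_of_lt (le_of_eq ?_) h1
  refine lintegral_congr fun x => ?_
  simp [enorm_mul, mul_comm]

theorem aestronglyMeasurable_apply_density (hh : Integrable h μ) {F : X → V}
    (hF : AEStronglyMeasurable F (μ.withDensity fun x => ‖h x‖ₑ)) (B : V →L[ℝ] ℂ →L[ℝ] G) :
    AEStronglyMeasurable (fun x => B (F x) (h x)) μ := by
  have hm : AEMeasurable (fun x => ‖h x‖ₑ) μ := hh.1.enorm
  refine (B.aestronglyMeasurable_comp₂ hF.stronglyMeasurable_mk.aestronglyMeasurable hh.1).congr ?_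
  filter_upwards [(ae_withDensity_iff' hm).mp hF.ae_eq_mk] with x hx
  by_cases h0 : h x = 0
  · simp [h0]
  · rw [hx (by simpa using h0)]

theorem lintegral_apply_density_le (hh : Integrable h μ) {F : X → V}
    (hF : AEStronglyMeasurable F (μ.withDensity fun x => ‖h x‖ₑ)) (B : V →L[ℝ] ℂ →L[ℝ] G) :
    ∫⁻ x, ‖B (F x) (h x)‖ₑ ∂μ ≤ ‖B‖ₑ * ∫⁻ x, ‖F x‖ₑ ∂(μ.withDensity fun x => ‖h x‖ₑ) := by
  have hm : AEMeasurable (fun x => ‖h x‖ₑ) μ := hh.1.enorm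
  rw [lintegral_withDensity_eq_lintegral_mul₀' hm hF.enorm, ← lintegral_const_mul' _ _ enorm_ne_top]
  refine lintegral_mono fun x => ?_
  calc ‖B (F x) (h x)‖ₑ ≤ ‖B (F x)‖ₑ * ‖h x‖ₑ := (B (F x)).le_opENorm (h x)
    _ ≤ ‖B‖ₑ * ‖F x‖ₑ * ‖h x‖ₑ := by
      gcongr
      exact B.le_opENorm (F x)
    _ = _ := by
      simp only [Pi.mul_apply]
      ring

theorem integrable_apply_density (hh : Integrable h μ) {F : X → V}
    (hF : (μ.withDensityᵥ h).Integrable F) (B : V →L[ℝ] ℂ →L[ℝ] G) :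
    Integrable (fun x => B (F x) (h x)) μ := by
  rw [VectorMeasure.Integrable, Measure.variation_withDensityᵥ hh] at hF
  refine ⟨aestronglyMeasurable_apply_density hh hF.1 B, ?_⟩
  exact (lintegral_apply_density_le hh hF.1 B).trans_lt (ENNReal.mul_lt_top (by simp) hF.2)

theorem integral_withDensity [CompleteSpace G] (hh : Integrable h μ) (B : V →L[ℝ] ℂ →L[ℝ] G)
    {F : X → V} (hF : (μ.withDensityᵥ h).Integrable F) :
    (μ.withDensityᵥ h).integral F B = ∫ x, B (F x) (h x) ∂μ := by
  have hm : AEMeasurable (fun x => ‖h x‖ₑ) μ := hh.1.enorm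
  have hvar := Measure.variation_withDensityᵥ hh
  have hfin : IsFiniteMeasure (μ.withDensityᵥ h).variation := by
    rw [hvar]
    exact isFiniteMeasure_withDensity hh.2.ne
  refine Integrable.induction (μ := (μ.withDensityᵥ h).variation)
    (P := fun F => (μ.withDensityᵥ h).integral F B = ∫ x, B (F x) (h x) ∂μ) ?_ ?_ ?_ ?_ hF
  · intro c s hs _
    have e1 := VectorMeasure.integral_indicator (μ := μ.withDensityᵥ h) (B := B)
      (f := fun _ => c) hs
    rw [e1]
    have : IsFiniteMeasure ((μ.withDensityᵥ h).restrict s).variation := inferInstance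
    rw [VectorMeasure.integral_const, VectorMeasure.restrict_apply _ hs MeasurableSet.univ,
      univ_inter, withDensityᵥ_apply hh hs, ← ContinuousLinearMap.integral_comp_comm _
      hh.integrableOn, ← integral_indicator hs]
    refine integral_congr_ae (Eventually.of_forall fun x => ?_)
    by_cases hx : x ∈ s <;> simp [hx]
  · intro f g _ hf hg h1 h2
    rw [VectorMeasure.integral_add hf hg, h1, h2, ← integral_add (integrable_apply_density hh hf B)
      (integrable_apply_density hh hg B)]
    simp
  · refine isClosed_eq VectorMeasure.continuous_integral ?_
    refine (LipschitzWith.continuous (K := ‖B‖₊) fun f g => ?_)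
    have hf := L1.integrable_coeFn f
    have hg := L1.integrable_coeFn g
    rw [edist_eq_enorm_sub, ← integral_sub (integrable_apply_density hh hf B)
      (integrable_apply_density hh hg B)]
    refine (enorm_integral_le_lintegral_enorm _).trans ?_
    have e : ∀ x, B (f x) (h x) - B (g x) (h x) = B (f x - g x) (h x) := fun x => by simp
    simp_rw [e]
    have hsub : AEStronglyMeasurable (fun x => f x - g x) (μ.withDensity fun x => ‖h x‖ₑ) :=
      hvar ▸ (hf.sub hg).1
    refine (lintegral_apply_density_le hh hsub B).trans (le_of_eq ?_)
    rw [Lp.edist_def, eLpNorm_one_eq_lintegral_enorm, ← hvar]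
    rfl
  · intro f g hfg _ h1
    rw [← VectorMeasure.integral_congr_ae hfg, h1]
    refine integral_congr_ae ?_
    rw [hvar] at hfg
    filter_upwards [(ae_withDensity_iff' hm).mp hfg] with x hx
    by_cases h0 : h x = 0
    · simp [h0]
    · rw [hx (by simpa using h0)]

end VectorMeasureDensity

variable {H : Type*} [NormedAddCommGroup H] [InnerProductSpace ℂ H] [CompleteSpace H]

namespace PVM

theorem measure_apply (E : PVM H) (f : H) {B : Set ℝ} (hB : MeasurableSet B) :
    E.measure f B = ENNReal.ofReal (‖E.proj B f‖ ^ 2) :=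
  Measure.ofMeasurable_apply B hB

instance (E : PVM H) (f : H) : IsFiniteMeasure (E.measure f) :=
  ⟨by rw [E.measure_apply f MeasurableSet.univ]; exact ENNReal.ofReal_lt_top⟩

theorem measure_real_apply (E : PVM H) (f : H) {B : Set ℝ} (hB : MeasurableSet B) :
    (E.measure f).real B = ‖E.proj B f‖ ^ 2 := by
  rw [Measure.real, E.measure_apply f hB, ENNReal.toReal_ofReal (by positivity)]

theorem cmeasure_apply (E : PVM H) (u f : H) {B : Set ℝ} (hB : MeasurableSet B) :
    E.cmeasure u f B = inner ℂ u (E.proj B f) := by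
  exact if_pos hB

theorem inner_proj_left (E : PVM H) {B : Set ℝ} (hB : MeasurableSet B) (u v : H) :
    inner ℂ (E.proj B u) v = inner ℂ u (E.proj B v) := by
  have h : ContinuousLinearMap.adjoint (E.proj B) = E.proj B := (E.isStarProjection B hB).isSelfAdjoint
  conv_lhs => rw [← h]
  exact ContinuousLinearMap.adjoint_inner_left _ _ _

theorem proj_proj (E : PVM H) {A B : Set ℝ} (hA : MeasurableSet A) (hB : MeasurableSet B) (u : H) :
    E.proj A (E.proj B u) = E.proj (A ∩ B) u := by
  rw [E.inter A B hA hB]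
  rfl

variable (E : PVM H) (g : H)

/-- Linear combinations of indicator functions. -/
def stepFun : ({B : Set ℝ // MeasurableSet B} →₀ ℂ) →ₗ[ℂ] Lp ℂ 2 (E.measure g) :=
  Finsupp.linearCombination ℂ fun B => indicatorConstLp 2 B.2 (measure_ne_top _ _) (1 : ℂ)

/-- Linear combinations of the vectors `E(B) g`. -/
def stepVec : ({B : Set ℝ // MeasurableSet B} →₀ ℂ) →ₗ[ℂ] H :=
  Finsupp.linearCombination ℂ fun B => E.proj B.1 g

theorem inner_stepVec (x y : {B : Set ℝ // MeasurableSet B} →₀ ℂ) :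
    inner ℂ (E.stepVec g x) (E.stepVec g y) = inner ℂ (E.stepFun g x) (E.stepFun g y) := by
  simp only [stepVec, stepFun, Finsupp.linearCombination_apply, Finsupp.sum, sum_inner, inner_sum,
    inner_smul_left, inner_smul_right]
  refine Finset.sum_congr rfl fun B _ => congrArg _ (Finset.sum_congr rfl fun A _ => ?_)
  congr 1
  rw [L2.inner_indicatorConstLp_one_indicatorConstLp_one, E.inner_proj_left A.2,
    E.proj_proj A.2 B.2, E.inner_self (A.2.inter B.2), E.measure_real_apply g (A.2.inter B.2)]
  rfl

theorem norm_stepVec (x : {B : Set ℝ // MeasurableSet B} →₀ ℂ) :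
    ‖E.stepVec g x‖ = ‖E.stepFun g x‖ := by
  have h := E.inner_stepVec g x x
  rw [inner_self_eq_ofReal, inner_self_eq_ofReal] at h
  have h2 := Complex.ofReal_injective h
  exact (sq_eq_sq₀ (norm_nonneg _) (norm_nonneg _)).mp h2

theorem stepFun_single {B : Set ℝ} (hB : MeasurableSet B) (c : ℂ) :
    E.stepFun g (Finsupp.single ⟨B, hB⟩ c) = indicatorConstLp 2 hB (measure_ne_top _ _) c := by
  rw [stepFun, Finsupp.linearCombination_single]
  refine Lp.ext ?_
  filter_upwards [Lp.coeFn_smul c (indicatorConstLp 2 hB (measure_ne_top (E.measure g) B) (1 : ℂ)),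
    indicatorConstLp_coeFn (p := 2) (hs := hB) (hμs := measure_ne_top (E.measure g) B) (c := (1 : ℂ)),
    indicatorConstLp_coeFn (p := 2) (hs := hB) (hμs := measure_ne_top (E.measure g) B) (c := c)]
    with x h1 h2 h3
  rw [h1, Pi.smul_apply, h2, h3]
  by_cases hx : x ∈ B <;> simp [hx]

theorem denseRange_stepFun : DenseRange (E.stepFun g) := by
  intro a
  have h : ∀ a, a ∈ (LinearMap.range (E.stepFun g)).topologicalClosure := by
    intro a
    refine Lp.induction (by norm_num)
      (motive := fun a => a ∈ (LinearMap.range (E.stepFun g)).topologicalClosure) ?_ ?_ ?_ a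
    · intro c s hs _
      refine Submodule.le_topologicalClosure _ ⟨Finsupp.single ⟨s, hs⟩ c, ?_⟩
      rw [E.stepFun_single g hs, Lp.simpleFunc.coe_indicatorConst]
    · intro f g hf hg _ h1 h2
      exact Submodule.add_mem _ h1 h2
    · exact Submodule.isClosed_topologicalClosure _
  exact h a

/-- The isometry `a ↦ (∫ a dE) g` of `L²(‖E(·)g‖²)` onto the cyclic subspace of `g`. -/
def cyc : Lp ℂ 2 (E.measure g) →ₗᵢ[ℂ] H where
  toLinearMap := ((E.stepVec g).extendOfNorm (E.stepFun g)).toLinearMap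
  norm_map' := by
    intro a
    refine (E.denseRange_stepFun g).induction_on (p := fun a =>
      ‖(E.stepVec g).extendOfNorm (E.stepFun g) a‖ = ‖a‖) a
      (isClosed_eq (by fun_prop) (by fun_prop)) fun x => ?_
    rw [LinearMap.extendOfNorm_eq (E.denseRange_stepFun g)
      ⟨1, fun x => by rw [one_mul, E.norm_stepVec g]⟩, E.norm_stepVec g]

theorem cyc_stepFun (x : {B : Set ℝ // MeasurableSet B} →₀ ℂ) :
    E.cyc g (E.stepFun g x) = E.stepVec g x :=
  LinearMap.extendOfNorm_eq (E.denseRange_stepFun g)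
      ⟨1, fun x => by rw [one_mul, E.norm_stepVec g]⟩ x

theorem cyc_indicator {B : Set ℝ} (hB : MeasurableSet B) (c : ℂ) :
    E.cyc g (indicatorConstLp 2 hB (measure_ne_top _ _) c) = c • E.proj B g := by
  rw [← E.stepFun_single g hB, E.cyc_stepFun, stepVec, Finsupp.linearCombination_single]

theorem inner_cyc (a b : Lp ℂ 2 (E.measure g)) :
    inner ℂ (E.cyc g a) (E.cyc g b) = inner ℂ a b := (E.cyc g).inner_map_map a b

/-- The adjoint of `cyc`. -/
def coeff : H →L[ℂ] Lp ℂ 2 (E.measure g) :=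
  ContinuousLinearMap.adjoint (E.cyc g).toContinuousLinearMap

theorem inner_coeff_left (u : H) (a : Lp ℂ 2 (E.measure g)) :
    inner ℂ (E.coeff g u) a = inner ℂ u (E.cyc g a) :=
  ContinuousLinearMap.adjoint_inner_left _ _ _

theorem inner_Lp_eq_integral {μ : Measure ℝ} (f g : Lp ℂ 2 μ) :
    inner ℂ f g = ∫ t, conj (f t) * g t ∂μ := by
  rw [L2.inner_def]
  refine integral_congr_ae (Eventually.of_forall fun t => ?_)
  simp only [RCLike.inner_apply, mul_comm]

theorem integrable_conj_mul {μ : Measure ℝ} (f g : Lp ℂ 2 μ) :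
    Integrable (fun t => conj (f t) * g t) μ :=
  (Lp.memLp f).star.integrable_mul (Lp.memLp g)

theorem inner_proj_cyc {B : Set ℝ} (hB : MeasurableSet B) (u : H) (a : Lp ℂ 2 (E.measure g)) :
    inner ℂ u (E.proj B (E.cyc g a)) = ∫ x in B, conj (E.coeff g u x) * a x ∂E.measure g := by
  have hm : MemLp (B.indicator (E.coeff g u)) 2 (E.measure g) := (Lp.memLp _).indicator hB
  have e : ∀ a : Lp ℂ 2 (E.measure g),
      ∫ x in B, conj (E.coeff g u x) * a x ∂E.measure g = inner ℂ (hm.toLp _) a := by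
    intro a
    rw [inner_Lp_eq_integral, ← integral_indicator hB]
    refine integral_congr_ae ?_
    filter_upwards [hm.coeFn_toLp] with x hx
    rw [hx]
    by_cases h : x ∈ B <;> simp [h]
  rw [e]
  refine (E.denseRange_stepFun g).induction_on (p := fun a =>
      inner ℂ u (E.proj B (E.cyc g a)) = inner ℂ (hm.toLp _) a) a
      (isClosed_eq (by fun_prop) (by fun_prop)) fun x => ?_
  induction x using Finsupp.induction_linear with
  | zero => simp
  | add x y hx hy => simp only [map_add, inner_add_right, hx, hy]
  | single C c =>
    obtain ⟨C, hC⟩ := C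
    rw [E.stepFun_single g hC, E.cyc_indicator g hC, map_smul, E.proj_proj hB hC,
      ← E.cyc_indicator g (hB.inter hC), ← E.inner_coeff_left, ← e, inner_Lp_eq_integral,
      ← integral_indicator hB]
    refine integral_congr_ae ?_
    filter_upwards [indicatorConstLp_coeFn (p := 2) (hs := hB.inter hC)
      (hμs := measure_ne_top (E.measure g) (B ∩ C)) (c := c), indicatorConstLp_coeFn (p := 2) (hs := hC)
      (hμs := measure_ne_top (E.measure g) C) (c := c)] with x h1 h2
    rw [h1]
    by_cases hx : x ∈ B <;> by_cases hx' : x ∈ C <;> simp [hx, hx', h2]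

theorem cmeasure_cyc (u : H) (a : Lp ℂ 2 (E.measure g)) :
    E.cmeasure u (E.cyc g a) = (E.measure g).withDensityᵥ (fun x => conj (E.coeff g u x) * a x) := by
  refine VectorMeasure.ext fun B hB => ?_
  rw [E.cmeasure_apply _ _ hB, withDensityᵥ_apply (integrable_conj_mul _ _) hB,
    E.inner_proj_cyc g hB]

theorem cmeasure_cyc_left (a : Lp ℂ 2 (E.measure g)) (f : H) :
    E.cmeasure (E.cyc g a) f = (E.measure g).withDensityᵥ (fun x => conj (a x) * E.coeff g f x) := by
  refine VectorMeasure.ext fun B hB => ?_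
  rw [E.cmeasure_apply _ _ hB, withDensityᵥ_apply (integrable_conj_mul _ _) hB,
    ← E.inner_proj_left hB, ← inner_conj_symm, E.inner_proj_cyc g hB, ← integral_conj]
  refine integral_congr_ae (Eventually.of_forall fun x => ?_)
  simp [mul_comm]

theorem proj_cyc {B : Set ℝ} (hB : MeasurableSet B) {a : ℝ → ℂ} (ha : MemLp a 2 (E.measure g)) :
    E.proj B (E.cyc g (ha.toLp a)) = E.cyc g ((ha.indicator hB).toLp _) := by
  refine ext_inner_left ℂ fun u => ?_
  rw [E.inner_proj_cyc g hB, ← E.inner_coeff_left, inner_Lp_eq_integral, ← integral_indicator hB]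
  refine integral_congr_ae ?_
  filter_upwards [ha.coeFn_toLp, (ha.indicator hB).coeFn_toLp] with x h1 h2
  rw [h2]
  by_cases h : x ∈ B <;> simp [h, h1]

theorem measure_cyc {a : ℝ → ℂ} (ha : MemLp a 2 (E.measure g)) :
    E.measure (E.cyc g (ha.toLp a)) = (E.measure g).withDensity (fun x => ‖a x‖ₑ ^ 2) := by
  refine Measure.ext fun B hB => ?_
  rw [E.measure_apply _ hB, withDensity_apply _ hB, E.proj_cyc g hB, LinearIsometry.norm_map,
    Lp.norm_toLp, ENNReal.ofReal_pow ENNReal.toReal_nonneg,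
    ENNReal.ofReal_toReal (ha.indicator hB).2.ne,
    eLpNorm_eq_lintegral_rpow_enorm_toReal (by norm_num) (by norm_num), ← ENNReal.rpow_natCast,
    ← ENNReal.rpow_mul, ← lintegral_indicator hB]
  simp only [ENNReal.toReal_ofNat, one_div, Nat.cast_ofNat, ne_eq, OfNat.ofNat_ne_zero,
    not_false_eq_true, inv_mul_cancel₀, ENNReal.rpow_one]
  refine lintegral_congr fun x => ?_
  by_cases hx : x ∈ B <;> simp [hx]

theorem memDomain_cyc {F a : ℝ → ℂ} (hF : Measurable F) (ha : MemLp a 2 (E.measure g))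
    (hFa : MemLp (fun x => F x * a x) 2 (E.measure g)) :
    E.MemDomain F (E.cyc g (ha.toLp a)) := by
  rw [MemDomain, E.measure_cyc g ha, memLp_two_iff_integrable_sq_norm hF.aestronglyMeasurable]
  refine ⟨(hF.norm.pow_const 2).aestronglyMeasurable, ?_⟩
  have h := (memLp_two_iff_integrable_sq_norm hFa.1).mp hFa
  have hm : AEMeasurable (fun x => ‖a x‖ₑ ^ 2) (E.measure g) := ha.1.enorm.pow_const 2
  rw [HasFiniteIntegral, lintegral_withDensity_eq_lintegral_mul₀ hm
    (hF.norm.pow_const 2).enorm.aemeasurable]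
  refine lt_of_le_of_lt (le_of_eq ?_) h.2
  refine lintegral_congr fun x => ?_
  simp only [Pi.mul_apply, enorm_pow, enorm_norm, enorm_mul]
  ring

theorem isApply_cyc {F a : ℝ → ℂ} (hF : Measurable F) (ha : MemLp a 2 (E.measure g))
    (hFa : MemLp (fun x => F x * a x) 2 (E.measure g)) :
    E.IsApply F (E.cyc g (ha.toLp a)) (E.cyc g (hFa.toLp _)) := by
  intro u
  have hh := integrable_conj_mul (E.coeff g u) (ha.toLp a)
  have hi : Integrable (fun x => ‖F x‖ * ‖conj (E.coeff g u x) * (ha.toLp a) x‖) (E.measure g) := by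
    refine (integrable_conj_mul (E.coeff g u) (hFa.toLp _)).norm.congr ?_
    filter_upwards [ha.coeFn_toLp, hFa.coeFn_toLp] with x h1 h2
    rw [h1, h2]
    simp only [norm_mul]
    ring
  rw [E.cmeasure_cyc g, integral_withDensity hh _
    (integrable_of_integrable_norm_mul hh hF.aestronglyMeasurable hi), ← E.inner_coeff_left,
    inner_Lp_eq_integral]
  refine integral_congr_ae ?_
  filter_upwards [ha.coeFn_toLp, hFa.coeFn_toLp] with x h1 h2
  rw [h1, h2, ContinuousLinearMap.mul_apply']
  ring

theorem IsApply.unique {F : ℝ → ℂ} {f v w : H} (hv : E.IsApply F f v) (hw : E.IsApply F f w) :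
    v = w := ext_inner_left ℂ fun u => (hv u).trans (hw u).symm

theorem apply_cyc {F a : ℝ → ℂ} (hF : Measurable F) (ha : MemLp a 2 (E.measure g))
    (hFa : MemLp (fun x => F x * a x) 2 (E.measure g)) :
    E.apply F (E.cyc g (ha.toLp a)) = E.cyc g (hFa.toLp _) := by
  have h : ∃ v, E.IsApply F (E.cyc g (ha.toLp a)) v := ⟨_, E.isApply_cyc g hF ha hFa⟩
  rw [apply, dif_pos h]
  exact IsApply.unique E h.choose_spec (E.isApply_cyc g hF ha hFa)

theorem cyc_one : E.cyc g ((memLp_const 1).toLp _) = g := by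
  have h := E.cyc_indicator g MeasurableSet.univ 1
  rw [E.univ, one_smul] at h
  refine Eq.trans (congrArg _ ?_) h
  refine Lp.ext ?_
  filter_upwards [indicatorConstLp_coeFn (p := 2) (hs := MeasurableSet.univ)
      (hμs := measure_ne_top (E.measure g) Set.univ) (c := (1 : ℂ)),
    (memLp_const (1 : ℂ)).coeFn_toLp] with x h1 h2
  rw [h1, h2]
  simp

end PVM
end PairModel

end

noncomputable section

namespace PairModel
open scoped ComplexConjugate ENNReal NNReal

variable {H : Type*} [NormedAddCommGroup H] [InnerProductSpace ℂ H] [CompleteSpace H]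

namespace PVM

variable {E : PVM H} {T : H →ₗ.[ℂ] H} {g : H}

theorem IsSpectralMeasureOf.apply_cyc (hE : E.IsSpectralMeasureOf T) {a : ℝ → ℂ}
    (ha : MemLp a 2 (E.measure g)) (hxa : MemLp (fun x : ℝ => (x : ℂ) * a x) 2 (E.measure g)) :
    ∃ h : E.cyc g (ha.toLp a) ∈ T.domain, T ⟨_, h⟩ = E.cyc g (hxa.toLp _) := by
  have h : E.cyc g (ha.toLp a) ∈ T.domain :=
    (hE.1 _).mpr (E.memDomain_cyc g (by fun_prop) ha hxa)
  exact ⟨h, IsApply.unique E (hE.2 ⟨_, h⟩) (E.isApply_cyc g (by fun_prop) ha hxa)⟩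

theorem IsSpectralMeasureOf.sq_apply_cyc (hE : E.IsSpectralMeasureOf T) {a : ℝ → ℂ}
    (ha : MemLp a 2 (E.measure g)) (hxa : MemLp (fun x : ℝ => (x : ℂ) * a x) 2 (E.measure g))
    (hxxa : MemLp (fun x : ℝ => (x : ℂ) * (x * a x)) 2 (E.measure g)) :
    ∃ h : E.cyc g (ha.toLp a) ∈ (sq T).domain, sq T ⟨_, h⟩ = E.cyc g (hxxa.toLp _) := by
  obtain ⟨h1, h2⟩ := hE.apply_cyc ha hxa
  obtain ⟨h3, h4⟩ := hE.apply_cyc hxa hxxa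
  have h5 : T ⟨_, h1⟩ ∈ T.domain := by rwa [h2]
  refine ⟨⟨h1, h5⟩, ?_⟩
  rw [← h4]
  change T ⟨T ⟨_, h1⟩, h5⟩ = T ⟨_, h3⟩
  congr 1
  exact Subtype.ext h2

theorem IsSpectralMeasureOf.resolv_sq_cyc (hE : E.IsSpectralMeasureOf T) {z : ℂ}
    (hz : ∃ R : H →L[ℂ] H, IsResolvent (sq T) z R) {a b : ℝ → ℂ}
    (ha : MemLp a 2 (E.measure g)) (hb : MemLp b 2 (E.measure g))
    (hxb : MemLp (fun x : ℝ => (x : ℂ) * b x) 2 (E.measure g))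
    (hxxb : MemLp (fun x : ℝ => (x : ℂ) * (x * b x)) 2 (E.measure g))
    (hab : ∀ᵐ x : ℝ ∂E.measure g, a x = ((x : ℂ) ^ 2 - z) * b x) :
    resolv (sq T) z (E.cyc g (ha.toLp a)) = E.cyc g (hb.toLp b) := by
  obtain ⟨R, hR⟩ := hz
  obtain ⟨h1, h2⟩ := hE.sq_apply_cyc hb hxb hxxb
  have h3 := hR.2 ⟨_, h1⟩
  rw [h2] at h3
  rw [hR.resolv_eq]
  refine Eq.trans (congrArg R ?_) h3
  rw [← map_smul, ← map_sub]
  congr 1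
  refine Lp.ext ?_
  filter_upwards [ha.coeFn_toLp, hb.coeFn_toLp, hxxb.coeFn_toLp, Lp.coeFn_sub (hxxb.toLp _)
    (z • hb.toLp b), Lp.coeFn_smul z (hb.toLp b), hab] with x k1 k2 k3 k4 k5 k6
  rw [k1, k4, Pi.sub_apply, k5, Pi.smul_apply, k2, k3, k6, smul_eq_mul]
  ring

theorem IsSpectralMeasureOf.measure_ball_eq_zero (hE : E.IsSpectralMeasureOf T) {x : ℝ}
    {R : H →L[ℂ] H} (hR : IsResolvent T x R) : ∃ δ > 0, E.measure g (Metric.ball x δ) = 0 := by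
  set δ : ℝ := (2 * (‖R‖ + 1))⁻¹ with hδ
  have hδ0 : 0 < δ := by positivity
  refine ⟨δ, hδ0, ?_⟩
  set B := Metric.ball x δ with hB
  have hBm : MeasurableSet B := Metric.isOpen_ball.measurableSet
  have ha : MemLp (B.indicator fun _ => (1 : ℂ)) 2 (E.measure g) :=
    (memLp_const 1).indicator hBm
  have hxa : MemLp (fun y : ℝ => (y : ℂ) * B.indicator (fun _ => (1 : ℂ)) y) 2 (E.measure g) := by
    refine MemLp.of_bound (Measurable.aestronglyMeasurable ?_) (|x| + δ)
      (Eventually.of_forall fun y => ?_)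
    · exact Complex.measurable_ofReal.mul (measurable_const.indicator hBm)
    · by_cases hy : y ∈ B
      · simp only [indicator_of_mem hy, mul_one, Complex.norm_real, Real.norm_eq_abs]
        have h1 : |y - x| < δ := by simpa [hB, Real.dist_eq] using hy
        have h2 := abs_sub_abs_le_abs_sub y x
        linarith
      · simp only [indicator_of_notMem hy, mul_zero, norm_zero]
        positivity
  obtain ⟨h1, h2⟩ := hE.apply_cyc ha hxa
  have h3 := hR.2 ⟨_, h1⟩
  rw [h2] at h3
  simp only at h3
  rw [← map_smul, ← map_sub] at h3
  have h4 : ‖hxa.toLp _ - (x : ℂ) • ha.toLp _‖ ≤ δ * ‖ha.toLp _‖ := by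
    refine Lp.norm_le_mul_norm_of_ae_le_mul ?_
    filter_upwards [ha.coeFn_toLp, hxa.coeFn_toLp, Lp.coeFn_sub (hxa.toLp _)
      ((x : ℂ) • ha.toLp _), Lp.coeFn_smul (x : ℂ) (ha.toLp _)] with y k1 k2 k3 k4
    rw [k3, Pi.sub_apply, k4, Pi.smul_apply, k1, k2, smul_eq_mul, ← sub_mul, norm_mul]
    by_cases hy : y ∈ B
    · gcongr
      have h1 : |y - x| < δ := by simpa [hB, Real.dist_eq] using hy
      rw [← Complex.ofReal_sub, Complex.norm_real]
      exact h1.le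
    · simp [hy]
  have h5 : ‖E.cyc g (ha.toLp _)‖ ≤ ‖R‖ * (δ * ‖ha.toLp _‖) := by
    conv_lhs => rw [← h3]
    refine (R.le_opNorm _).trans ?_
    gcongr
    rw [LinearIsometry.norm_map]
    exact h4
  rw [LinearIsometry.norm_map] at h5
  have h6 : ‖R‖ * δ ≤ 1 / 2 := by
    rw [hδ, ← div_eq_mul_inv, div_le_iff₀ (by positivity)]
    linarith
  have h7 : ‖ha.toLp _‖ = 0 := by
    have := norm_nonneg (ha.toLp _)
    nlinarith
  have h8 : E.proj B g = 0 := by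
    have h := E.cyc_indicator g hBm 1
    rw [one_smul] at h
    rw [← h, ← norm_eq_zero, LinearIsometry.norm_map, ← h7]
    rfl
  rw [E.measure_apply g hBm, h8]
  simp

theorem measure_zero (E : PVM H) : E.measure 0 = 0 := by
  refine Measure.ext fun B hB => ?_
  simp [E.measure_apply 0 hB]

end PVM

variable {T : H →ₗ.[ℂ] H} {g : H}

theorem measure_Iio_eq_zero (hT : IsSelfAdjoint T)
    (hpos : ∀ f : T.domain, 0 ≤ (inner ℂ (f : H) (T f)).re) {E : PVM H}
    (hE : E.IsSpectralMeasureOf T) : E.measure g (Iio (lowestEnergy T)) = 0 := by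
  refine measure_null_of_locally_null _ fun x hx => ?_
  obtain ⟨R, hR⟩ := exists_isResolvent_of_lt hT hpos hx
  obtain ⟨δ, hδ, h⟩ := hE.measure_ball_eq_zero (g := g) hR
  exact ⟨_, mem_nhdsWithin_of_mem_nhds (Metric.ball_mem_nhds x hδ), h⟩

theorem Assumption.measure_ne_zero (h : Assumption T g) : (spectralPVM T).measure g ≠ 0 := by
  intro h0
  obtain ⟨ψ, h1, -, -, h2, -⟩ := h.density
  rw [h0] at h1
  have h3 : ∀ᵐ x : ℝ, x ∉ Ioi (lowestEnergy T) := by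
    filter_upwards [h1, Measure.rnDeriv_zero (volume : Measure ℝ)] with x k1 k2 hx
    have := h2 x hx
    rw [k1, k2] at this
    simp at this
  have h4 : volume (Ioi (lowestEnergy T)) = 0 := by
    rw [ae_iff] at h3
    simp only [not_not] at h3
    exact h3
  simp at h4

theorem Assumption.isSpectralMeasureOf (h : Assumption T g) :
    (spectralPVM T).IsSpectralMeasureOf T := by
  by_cases hE : ∃ E : PVM H, E.IsSpectralMeasureOf T
  · rw [spectralPVM, dif_pos hE]
    exact hE.choose_spec
  · exfalso
    have e : spectralPVM T = PVM.diracZero := by rw [spectralPVM, dif_neg hE]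
    have h1 := h.absCont g (Real.volume_singleton (a := 0))
    rw [PVM.measure_apply _ _ (measurableSet_singleton 0), e] at h1
    have h2 : (PVM.diracZero (H := H)).proj {0} = 1 := if_pos rfl
    rw [h2] at h1
    simp only [one_apply_eq_self, ENNReal.ofReal_eq_zero] at h1
    have h3 : g = 0 := by
      rw [← norm_eq_zero]
      have := sq_nonneg ‖g‖
      exact pow_eq_zero_iff (n := 2) (by norm_num) |>.mp (le_antisymm h1 this)
    apply h.measure_ne_zero
    rw [h3, PVM.measure_zero]

end PairModel

end

noncomputable section

namespace PairModel
open scoped ComplexConjugate ENNReal NNReal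
open CauchyTransform

/-- The density in the variable `t = x² - e²`. -/
def weight (ψ : ℝ → ℝ) (e t : ℝ) : ℝ := if 0 < t then ψ (√(t + e ^ 2)) / 2 else 0

theorem weight_of_pos (ψ : ℝ → ℝ) (e : ℝ) {t : ℝ} (ht : 0 < t) :
    weight ψ e t = ψ (√(t + e ^ 2)) / 2 := if_pos ht

theorem weight_of_nonpos (ψ : ℝ → ℝ) (e : ℝ) {t : ℝ} (ht : t ≤ 0) :
    weight ψ e t = 0 := if_neg ht.not_gt

theorem lt_sqrt_add_sq {e t : ℝ} (he : 0 ≤ e) (ht : 0 < t) : e < √(t + e ^ 2) := by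
  rw [Real.lt_sqrt he]
  linarith

theorem hasDerivAt_sqrt_add_sq {e t : ℝ} (ht : 0 < t) :
    HasDerivAt (fun t => √(t + e ^ 2)) (1 / (2 * √(t + e ^ 2))) t := by
  have h : t + e ^ 2 ≠ 0 := by positivity
  have := ((hasDerivAt_id t).add_const (e ^ 2)).sqrt h
  simpa using this

theorem exists_bound_of_tendsto {f : ℝ → ℝ} {e : ℝ} (hf : ContinuousOn f (Ioi e))
    (h0 : Tendsto f (𝓝[>] e) (𝓝 0)) (h1 : Tendsto f atTop (𝓝 0)) :
    ∃ C, 0 ≤ C ∧ ∀ x ∈ Ioi e, |f x| ≤ C := by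
  have h2 : ∀ᶠ x in 𝓝[>] e, |f x| < 1 := by
    have := h0.abs
    rw [abs_zero] at this
    exact this.eventually_lt_const one_pos
  have h3 : ∀ᶠ x in atTop, |f x| < 1 := by
    have := h1.abs
    rw [abs_zero] at this
    exact this.eventually_lt_const one_pos
  obtain ⟨u, hu, hu'⟩ := mem_nhdsGT_iff_exists_Ioo_subset.mp h2
  obtain ⟨M, hM⟩ := eventually_atTop.mp h3
  obtain ⟨C, hC⟩ := (isCompact_Icc (a := u) (b := M)).exists_bound_of_continuousOn
    (hf.mono fun x hx => lt_of_lt_of_le hu hx.1)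
  refine ⟨max C 1, le_max_of_le_right zero_le_one, fun x hx => ?_⟩
  rcases lt_or_ge x u with h | h
  · exact (hu' ⟨hx, h⟩).le.trans (le_max_right _ _)
  · rcases le_or_gt x M with h' | h'
    · exact (hC x ⟨h, h'⟩).trans (le_max_left _ _)
    · exact (hM x h'.le).le.trans (le_max_right _ _)

theorem abs_weight_sub_le {ψ : ℝ → ℝ} {e : ℝ} (he : 0 ≤ e) (hψ : ContDiffOn ℝ 1 ψ (Ioi e))
    {C : ℝ} (hC : ∀ x ∈ Ioi e, |x⁻¹ * deriv ψ x| ≤ C) {s t : ℝ} (hs : 0 < s) (ht : 0 < t) :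
    |weight ψ e s - weight ψ e t| ≤ C / 4 * |s - t| := by
  have h : ∀ t ∈ Ioi (0 : ℝ), HasDerivWithinAt (weight ψ e)
      ((√(t + e ^ 2))⁻¹ * deriv ψ (√(t + e ^ 2)) / 4) (Ioi 0) t := by
    intro t ht
    have hk := lt_sqrt_add_sq he ht
    have h1 : HasDerivAt ψ (deriv ψ (√(t + e ^ 2))) (√(t + e ^ 2)) :=
      ((hψ.differentiableOn (by norm_num)).differentiableAt (Ioi_mem_nhds hk)).hasDerivAt
    have h2 := (h1.comp t (hasDerivAt_sqrt_add_sq (e := e) ht)).div_const 2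
    refine (h2.hasDerivWithinAt (s := Ioi 0)).congr_deriv ?_ |>.congr
      (fun y hy => ?_) ?_
    · have : √(t + e ^ 2) ≠ 0 := (he.trans_lt hk).ne'
      field_simp
      norm_num
    · exact weight_of_pos ψ e hy
    · exact weight_of_pos ψ e ht
  have h3 := (convex_Ioi (0 : ℝ)).norm_image_sub_le_of_norm_hasDerivWithin_le (C := C / 4) h
    (fun t ht => by
      rw [Real.norm_eq_abs, abs_div, abs_of_pos (by norm_num : (0 : ℝ) < 4)]
      gcongr
      exact hC _ (lt_sqrt_add_sq he ht)) ht hs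
  simpa using h3

theorem lintegral_inv_Ioc_eq_top {r : ℝ} (hr : 0 < r) :
    ∫⁻ t in Ioc 0 r, ENNReal.ofReal t⁻¹ = ∞ := by
  by_contra h
  have h1 : IntegrableOn (fun t : ℝ => t⁻¹) (Ioc 0 r) := by
    refine ⟨by fun_prop, ?_⟩
    rw [hasFiniteIntegral_iff_ofReal]
    · exact lt_top_iff_ne_top.mpr h
    · filter_upwards [ae_restrict_mem measurableSet_Ioc] with t ht
      exact inv_nonneg.mpr ht.1.le
  have h2 := (intervalIntegrable_iff_integrableOn_Ioc_of_le hr.le).mpr h1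
  rw [intervalIntegrable_inv_iff] at h2
  rcases h2 with h2 | h2
  · exact hr.ne h2
  · exact h2 ⟨by simp [hr.le], by simp [hr.le]⟩

theorem weight_le {ψ : ℝ → ℝ} {e : ℝ} (he : 0 ≤ e) (hψ : ContDiffOn ℝ 1 ψ (Ioi e))
    {C : ℝ} (hC : ∀ x ∈ Ioi e, |x⁻¹ * deriv ψ x| ≤ C)
    (hinv : ∫⁻ t in Ioi 0, ENNReal.ofReal (weight ψ e t / t) ≠ ∞) {t : ℝ} (ht : 0 < t) :
    weight ψ e t ≤ C / 4 * t := by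
  by_contra! h
  set η := weight ψ e t - C / 4 * t with hη
  have hη0 : 0 < η := by linarith
  apply hinv
  have h1 : ∀ s ∈ Ioc 0 t, ENNReal.ofReal η * ENNReal.ofReal s⁻¹ ≤
      ENNReal.ofReal (weight ψ e s / s) := by
    intro s hs
    rw [← ENNReal.ofReal_mul hη0.le, div_eq_mul_inv]
    refine ENNReal.ofReal_le_ofReal ?_
    have hs0 := hs.1
    have h2 := abs_weight_sub_le he hψ hC ht hs.1
    rw [abs_of_nonneg (sub_nonneg.mpr hs.2)] at h2
    have h3 := (abs_le.mp h2).2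
    have hC0 : 0 ≤ C := (abs_nonneg _).trans (hC (e + 1) (by simp))
    gcongr
    nlinarith
  refine top_unique ?_
  calc ∞ = ENNReal.ofReal η * ∫⁻ s in Ioc 0 t, ENNReal.ofReal s⁻¹ := by
        rw [lintegral_inv_Ioc_eq_top ht, ENNReal.mul_top (by simpa using hη0)]
    _ = ∫⁻ s in Ioc 0 t, ENNReal.ofReal η * ENNReal.ofReal s⁻¹ := by
        rw [lintegral_const_mul' _ _ ENNReal.ofReal_ne_top]
    _ ≤ ∫⁻ s in Ioc 0 t, ENNReal.ofReal (weight ψ e s / s) :=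
        setLIntegral_mono' measurableSet_Ioc h1
    _ ≤ _ := lintegral_mono_set Ioc_subset_Ioi_self

/-- The density of the push-forward of `ψ dx` on `(e, ∞)` under `x ↦ x² - e²`. -/
theorem map_withDensity_sq {ψ : ℝ → ℝ} {e : ℝ} (he : 0 ≤ e) {μ : Measure ℝ}
    (hμ : μ = (volume.restrict (Ioi e)).withDensity fun x => ENNReal.ofReal (ψ x)) :
    μ.map (fun x => x ^ 2 - e ^ 2) =
      volume.withDensity fun t => ENNReal.ofReal (weight ψ e t / √(t + e ^ 2)) := by
  have hm : Measurable fun x : ℝ => x ^ 2 - e ^ 2 := by fun_prop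
  refine Measure.ext fun B hB => ?_
  rw [Measure.map_apply hm hB, hμ, withDensity_apply _ (hm hB), withDensity_apply _ hB,
    Measure.restrict_restrict (hm hB)]
  have himg : (fun t => √(t + e ^ 2)) '' (B ∩ Ioi 0) = (fun x => x ^ 2 - e ^ 2) ⁻¹' B ∩ Ioi e := by
    ext x
    constructor
    · rintro ⟨t, ⟨h1, h2⟩, rfl⟩
      refine ⟨?_, lt_sqrt_add_sq he h2⟩
      have h2' : 0 < t := h2
      simpa [Real.sq_sqrt (show 0 ≤ t + e ^ 2 by positivity)] using h1
    · rintro ⟨h1, h2⟩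
      have h2' : e < x := h2
      refine ⟨x ^ 2 - e ^ 2, ⟨h1, ?_⟩, ?_⟩
      · simp only [mem_Ioi]
        nlinarith
      · simp [Real.sqrt_sq (he.trans h2'.le)]
  rw [← himg, lintegral_image_eq_lintegral_abs_deriv_mul (hB.inter measurableSet_Ioi)
    (fun t ht => (hasDerivAt_sqrt_add_sq ht.2).hasDerivWithinAt)]
  · have h0 : ∫⁻ t in B, ENNReal.ofReal (weight ψ e t / √(t + e ^ 2)) =
        ∫⁻ t in B ∩ Ioi 0, ENNReal.ofReal (weight ψ e t / √(t + e ^ 2)) := by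
      rw [inter_comm, ← Measure.restrict_restrict measurableSet_Ioi,
        ← lintegral_indicator measurableSet_Ioi]
      refine lintegral_congr fun t => ?_
      by_cases ht : 0 < t
      · rw [indicator_of_mem (by exact ht)]
      · rw [indicator_of_notMem (by exact ht), weight_of_nonpos ψ e (not_lt.mp ht)]
        simp
    rw [h0]
    refine setLIntegral_congr_fun (hB.inter measurableSet_Ioi) fun t ht => ?_
    have ht0 : 0 < t := ht.2
    have hk : 0 < √(t + e ^ 2) := he.trans_lt (lt_sqrt_add_sq he ht0)
    rw [weight_of_pos ψ e ht0, ← ENNReal.ofReal_mul (abs_nonneg _), abs_of_pos (by positivity)]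
    congr 1
    field_simp
  · intro s hs t ht hst
    have hs0 : 0 < s := hs.2
    have ht0 : 0 < t := ht.2
    have := (Real.sqrt_inj (by positivity) (by positivity)).mp hst
    linarith

variable {H : Type*} [NormedAddCommGroup H] [InnerProductSpace ℂ H] [CompleteSpace H]
  {T : H →ₗ.[ℂ] H} {g : H}

/-- `ρ` represents `‖E(·)g‖²` in the variable `t = x² - E₀²`. -/
structure IsWeight (T : H →ₗ.[ℂ] H) (g : H) (ρ : ℝ → ℝ) : Prop where
  weight : Weight ρ
  ae_gt : ∀ᵐ x ∂(spectralPVM T).measure g, lowestEnergy T < x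
  map : ((spectralPVM T).measure g).map (fun x => x ^ 2 - lowestEnergy T ^ 2) =
    volume.withDensity fun t => ENNReal.ofReal (ρ t / √(t + lowestEnergy T ^ 2))

theorem Assumption.exists_measure_eq (h : Assumption T g) {ψ : ℝ → ℝ}
    (hψ : ψ =ᵐ[volume] fun x => (((spectralPVM T).measure g).rnDeriv volume x).toReal) :
    (spectralPVM T).measure g =
      (volume.restrict (Ioi (lowestEnergy T))).withDensity fun x => ENNReal.ofReal (ψ x) := by
  set μ := (spectralPVM T).measure g with hμ
  have h1 : μ = volume.withDensity fun x => ENNReal.ofReal (ψ x) := by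
    conv_lhs => rw [← Measure.withDensity_rnDeriv_eq μ volume (h.absCont g)]
    refine withDensity_congr_ae ?_
    filter_upwards [hψ, Measure.rnDeriv_lt_top μ volume] with x h1 h2
    rw [h1, ENNReal.ofReal_toReal h2.ne]
  have h2 : μ (Ioi (lowestEnergy T))ᶜ = 0 := by
    rw [compl_Ioi, ← Iio_union_right]
    refine measure_union_null (measure_Iio_eq_zero h.selfAdjoint h.nonneg h.isSpectralMeasureOf) ?_
    exact h.absCont g Real.volume_singleton
  have h3 : μ.restrict (Ioi (lowestEnergy T)) = μ := Measure.restrict_eq_self_of_ae_mem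
    (by rwa [← mem_ae_iff] at h2)
  rw [← h3]
  conv_lhs => rw [h1]
  exact restrict_withDensity measurableSet_Ioi _

theorem lintegral_comp_mul {ρ : ℝ → ℝ} {e : ℝ} (he : 0 ≤ e) {μ : Measure ℝ}
    (hgt : ∀ᵐ x ∂μ, e < x) (hρm : Measurable ρ) (hρ0 : ∀ t ≤ 0, ρ t = 0)
    (hmap : μ.map (fun x => x ^ 2 - e ^ 2) =
      volume.withDensity fun t => ENNReal.ofReal (ρ t / √(t + e ^ 2)))
    {f : ℝ → ℝ≥0∞} (hf : Measurable f) :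
    ∫⁻ x, ENNReal.ofReal x * f (x ^ 2 - e ^ 2) ∂μ = ∫⁻ t, ENNReal.ofReal (ρ t) * f t := by
  have hm : Measurable fun x : ℝ => x ^ 2 - e ^ 2 := by fun_prop
  have hF : Measurable fun t : ℝ => ENNReal.ofReal (√(t + e ^ 2)) * f t := by fun_prop
  calc ∫⁻ x, ENNReal.ofReal x * f (x ^ 2 - e ^ 2) ∂μ
      = ∫⁻ x, (fun t => ENNReal.ofReal (√(t + e ^ 2)) * f t) (x ^ 2 - e ^ 2) ∂μ := by
        refine lintegral_congr_ae ?_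
        filter_upwards [hgt] with x hx
        simp [Real.sqrt_sq (he.trans hx.le)]
    _ = ∫⁻ t, ENNReal.ofReal (√(t + e ^ 2)) * f t ∂μ.map (fun x => x ^ 2 - e ^ 2) :=
        (lintegral_map hF hm).symm
    _ = _ := by
        rw [hmap, lintegral_withDensity_eq_lintegral_mul _ (by fun_prop) hF]
        refine lintegral_congr fun t => ?_
        simp only [Pi.mul_apply]
        rcases le_or_gt t 0 with ht | ht
        · simp [hρ0 t ht]
        · have hk : 0 < √(t + e ^ 2) := he.trans_lt (lt_sqrt_add_sq he ht)
          rw [← mul_assoc, mul_comm (ENNReal.ofReal (ρ t / _)), ← ENNReal.ofReal_mul hk.le]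
          congr 2
          field_simp

theorem Assumption.exists_weight (h : Assumption T g) : ∃ ρ : ℝ → ℝ, IsWeight T g ρ := by
  obtain ⟨ψ, hψ, ⟨M, hM⟩, -, hpos, hC1, hl0, hl1⟩ := h.density
  set e := lowestEnergy T with he'
  have he : 0 ≤ e := lowestEnergy_nonneg h.selfAdjoint h.nonneg
  set μ := (spectralPVM T).measure g with hμ'
  have hμ := h.exists_measure_eq hψ
  have hmap := map_withDensity_sq he hμ
  have hgt : ∀ᵐ x ∂μ, e < x := by
    rw [hμ', hμ]
    exact (withDensity_absolutelyContinuous _ _).ae_le (ae_restrict_mem measurableSet_Ioi)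
  have hderiv : ContinuousOn (fun x => x⁻¹ * deriv ψ x) (Ioi e) := by
    have h1 : ContinuousOn (deriv ψ) (Ioi e) :=
      hC1.continuousOn_deriv_of_isOpen isOpen_Ioi le_rfl
    refine ContinuousOn.mul (continuousOn_id.inv₀ fun x hx => ?_) h1
    exact (he.trans_lt hx).ne'
  obtain ⟨C, hC0, hC⟩ := exists_bound_of_tendsto hderiv hl0 hl1
  set ρ := weight ψ e with hρ
  have hρ0 : ∀ t ≤ 0, ρ t = 0 := fun t ht => weight_of_nonpos ψ e ht
  have hρpos : ∀ t, 0 < t → 0 < ρ t := fun t ht => by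
    rw [hρ, weight_of_pos ψ e ht]
    exact half_pos (hpos _ (lt_sqrt_add_sq he ht))
  have hρnn : ∀ t, 0 ≤ ρ t := fun t => by
    rcases le_or_gt t 0 with ht | ht
    · exact (hρ0 t ht).ge
    · exact (hρpos t ht).le
  have hcont : ContinuousOn ρ (Ioi 0) := by
    have h1 : ContinuousOn (fun t => ψ (√(t + e ^ 2)) / 2) (Ioi 0) :=
      (hC1.continuousOn.comp (by fun_prop) fun t ht => lt_sqrt_add_sq he ht).div_const 2
    exact h1.congr fun t ht => weight_of_pos ψ e ht
  have hρm : Measurable ρ := by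
    have h1 : ρ = (Ioi 0).piecewise ρ fun _ => 0 := by
      funext t
      by_cases ht : 0 < t
      · rw [piecewise_eq_of_mem _ _ _ (by exact ht)]
      · rw [piecewise_eq_of_notMem _ _ _ (by exact ht), hρ0 t (not_lt.mp ht)]
    rw [h1]
    exact hcont.measurable_piecewise continuousOn_const measurableSet_Ioi
  have hint : Integrable ρ := by
    refine ⟨hρm.aestronglyMeasurable, ?_⟩
    rw [hasFiniteIntegral_iff_ofReal (Eventually.of_forall hρnn)]
    have h1 := lintegral_comp_mul he hgt hρm hρ0 hmap (f := fun _ => 1) measurable_const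
    simp only [mul_one] at h1
    rw [← h1]
    have h2 := (memLp_two_iff_integrable_sq_norm h.mem_sqrt.1).mp h.mem_sqrt
    have h3 : Integrable (fun x => x) μ := by
      refine h2.congr ?_
      filter_upwards [hgt] with x hx
      rw [Complex.norm_real, Real.norm_eq_abs, sq_abs, Real.sq_sqrt (he.trans hx.le)]
    rw [← hasFiniteIntegral_iff_ofReal]
    · exact h3.2
    · filter_upwards [hgt] with x hx using he.trans hx.le
  have hinv : Integrable fun t => ρ t / t := by
    have h0 : ∀ t, 0 ≤ ρ t / t := fun t => by
      rcases le_or_gt t 0 with ht | ht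
      · simp [hρ0 t ht]
      · have := hρnn t
        positivity
    refine ⟨(hρm.div measurable_id).aestronglyMeasurable, ?_⟩
    rw [hasFiniteIntegral_iff_ofReal (Eventually.of_forall h0)]
    have h1 := lintegral_comp_mul he hgt hρm hρ0 hmap (f := fun t => ENNReal.ofReal t⁻¹)
      (by fun_prop)
    have h2 : ∫⁻ t, ENNReal.ofReal (ρ t / t) = ∫⁻ t, ENNReal.ofReal (ρ t) * ENNReal.ofReal t⁻¹ := by
      refine lintegral_congr fun t => ?_
      rw [← ENNReal.ofReal_mul (hρnn t), div_eq_mul_inv]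
    rw [h2, ← h1]
    have h3 := (memLp_two_iff_integrable_sq_norm h.mem_invSqrt.1).mp h.mem_invSqrt
    refine lt_of_le_of_lt (lintegral_mono_ae ?_) h3.2
    filter_upwards [hgt] with x hx
    rw [← ENNReal.ofReal_mul (he.trans hx.le), ← ofReal_norm]
    refine ENNReal.ofReal_le_ofReal ?_
    have hx1 : 0 < x - e := by linarith
    have hx2 : 0 < x + e := by linarith
    rw [Complex.norm_real, norm_pow, norm_norm, Real.norm_eq_abs, sq_abs, inv_pow,
      Real.sq_sqrt hx1.le, show x ^ 2 - e ^ 2 = (x + e) * (x - e) by ring, mul_inv, ← mul_assoc]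
    have h4 : x * (x + e)⁻¹ ≤ 1 := by
      rw [← div_eq_mul_inv, div_le_one hx2]
      linarith
    have h5 : 0 < (x - e)⁻¹ := inv_pos.mpr hx1
    nlinarith
  have hinv' : ∫⁻ t in Ioi 0, ENNReal.ofReal (weight ψ e t / t) ≠ ∞ := by
    have h0 : ∀ t, 0 ≤ ρ t / t := fun t => by
      rcases le_or_gt t 0 with ht | ht
      · simp [hρ0 t ht]
      · have := hρnn t
        positivity
    have h1 := hinv.2
    rw [hasFiniteIntegral_iff_ofReal (Eventually.of_forall h0)] at h1
    exact (lt_of_le_of_lt (setLIntegral_le_lintegral _ _) h1).ne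
  have hle : ∀ t, 0 < t → ρ t ≤ C / 4 * t := fun t ht => weight_le he hC1 hC hinv' ht
  have hlip : ∀ s t, |ρ s - ρ t| ≤ C / 4 * |s - t| := by
    have key : ∀ s t, 0 < s → t ≤ 0 → |ρ s - ρ t| ≤ C / 4 * |s - t| := by
      intro s t hs ht
      rw [hρ0 t ht, sub_zero, abs_of_nonneg (hρnn s), abs_of_nonneg (by linarith)]
      refine (hle s hs).trans ?_
      gcongr
      linarith
    intro s t
    rcases le_or_gt s 0 with hs | hs <;> rcases le_or_gt t 0 with ht | ht
    · rw [hρ0 s hs, hρ0 t ht, sub_self, abs_zero]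
      positivity
    · rw [abs_sub_comm, abs_sub_comm s]
      exact key t s ht hs
    · exact key s t hs ht
    · exact abs_weight_sub_le he hC1 hC hs ht
  refine ⟨ρ, ⟨⟨⟨⟨Real.toNNReal (C / 4), ?_⟩, hint.ofReal, ?_⟩, hρ0, hρpos, hinv⟩, hgt, hmap⟩⟩
  · refine LipschitzWith.of_dist_le_mul fun s t => ?_
    rw [Real.coe_toNNReal _ (by positivity), dist_eq_norm, ← Complex.ofReal_sub, Complex.norm_real,
      Real.dist_eq]
    exact hlip s t
  · have h1 : Tendsto ρ (cocompact ℝ) (𝓝 0) := by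
      rw [cocompact_eq_atBot_atTop]
      refine Tendsto.sup ?_ ?_
      · refine tendsto_const_nhds.congr' ?_
        filter_upwards [eventually_le_atBot 0] with t ht
        exact (hρ0 t ht).symm
      · have h2 : Tendsto (fun t : ℝ => M / 2 * (√(t + e ^ 2))⁻¹) atTop (𝓝 0) := by
          have h3 : Tendsto (fun t : ℝ => √(t + e ^ 2)) atTop atTop :=
            Real.tendsto_sqrt_atTop.comp (tendsto_atTop_add_const_right _ _ tendsto_id)
          simpa using h3.inv_tendsto_atTop.const_mul (M / 2)
        refine squeeze_zero' (Eventually.of_forall hρnn) ?_ h2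
        filter_upwards [eventually_gt_atTop 0] with t ht
        have hk := lt_sqrt_add_sq he ht
        have hk0 : 0 < √(t + e ^ 2) := he.trans_lt hk
        have h4 := hM (mem_image_of_mem _ hk)
        rw [hρ, weight_of_pos ψ e ht, ← div_eq_mul_inv, le_div_iff₀ hk0]
        linarith
    have h2 := (Complex.continuous_ofReal.tendsto 0).comp h1
    rw [Complex.ofReal_zero] at h2
    exact h2

end PairModel

end

noncomputable section

namespace PairModel
open scoped ComplexConjugate ENNReal NNReal
open CauchyTransform

variable {H : Type*} [NormedAddCommGroup H] [InnerProductSpace ℂ H] {T : H →ₗ.[ℂ] H}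

/-- The spectral variable `x² - E₀²` of `T² - E₀²`. -/
def shiftSq (T : H →ₗ.[ℂ] H) (x : ℝ) : ℝ := x ^ 2 - lowestEnergy T ^ 2

theorem measurable_shiftSq (T : H →ₗ.[ℂ] H) : Measurable (shiftSq T) := by
  unfold shiftSq
  fun_prop

theorem sqrt_shiftSq_add {x : ℝ} (hx : 0 ≤ x) : √(shiftSq T x + lowestEnergy T ^ 2) = x := by
  rw [shiftSq, sub_add_cancel, Real.sqrt_sq hx]

/-- The density of the image of `‖E(·)g‖²` under `shiftSq`. -/
def imageDensity (T : H →ₗ.[ℂ] H) (ρ : ℝ → ℝ) (t : ℝ) : ℝ := ρ t / √(t + lowestEnergy T ^ 2)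

/-- The factor that turns square integrable functions on the half-line into square integrable
functions with respect to the image measure. -/
def scale (T : H →ₗ.[ℂ] H) (ρ : ℝ → ℝ) (t : ℝ) : ℝ := (√(imageDensity T ρ t))⁻¹

namespace IsWeight

variable [CompleteSpace H] {g : H} {ρ : ℝ → ℝ}

theorem measurable_imageDensity (hw : IsWeight T g ρ) : Measurable (imageDensity T ρ) := by
  have := hw.weight.continuous.measurable
  unfold imageDensity
  fun_prop

theorem measurable_scale (hw : IsWeight T g ρ) : Measurable (scale T ρ) :=
  hw.measurable_imageDensity.sqrt.inv

theorem imageDensity_nonneg (hw : IsWeight T g ρ) (t : ℝ) : 0 ≤ imageDensity T ρ t :=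
  div_nonneg (hw.weight.nonneg t) (Real.sqrt_nonneg _)

theorem imageDensity_of_nonpos (hw : IsWeight T g ρ) {t : ℝ} (ht : t ≤ 0) :
    imageDensity T ρ t = 0 := by
  rw [imageDensity, hw.weight.eq_zero t ht, zero_div]

theorem imageDensity_pos (hw : IsWeight T g ρ) {t : ℝ} (ht : 0 < t) : 0 < imageDensity T ρ t :=
  div_pos (hw.weight.pos t ht) (Real.sqrt_pos.mpr (by positivity))

theorem imageDensity_mul_scale_sq (hw : IsWeight T g ρ) {t : ℝ} (ht : 0 < t) :
    imageDensity T ρ t * scale T ρ t ^ 2 = 1 := by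
  have h := hw.imageDensity_pos ht
  rw [scale, inv_pow, Real.sq_sqrt h.le, mul_inv_cancel₀ h.ne']

theorem map_shiftSq (hw : IsWeight T g ρ) : ((spectralPVM T).measure g).map (shiftSq T) =
    volume.withDensity fun t => ENNReal.ofReal (imageDensity T ρ t) := hw.map

theorem quasiMeasurePreserving (hw : IsWeight T g ρ) :
    Measure.QuasiMeasurePreserving (shiftSq T) ((spectralPVM T).measure g) volume := by
  refine ⟨measurable_shiftSq T, ?_⟩
  have h := hw.map_shiftSq
  rw [h]
  exact withDensity_absolutelyContinuous _ _

variable {V : Type*} [NormedAddCommGroup V] [NormedSpace ℝ V]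

theorem integral_comp (hw : IsWeight T g ρ) {F : ℝ → V} (hF : AEStronglyMeasurable F volume) :
    ∫ x, F (shiftSq T x) ∂(spectralPVM T).measure g = ∫ t, imageDensity T ρ t • F t := by
  have h := hw.map_shiftSq
  rw [← integral_map (measurable_shiftSq T).aemeasurable
    (hF.mono_ac (by rw [h]; exact withDensity_absolutelyContinuous _ _)), h,
    integral_withDensity_eq_integral_toReal_smul hw.measurable_imageDensity.ennreal_ofReal
      (Eventually.of_forall fun t => ENNReal.ofReal_lt_top)]
  refine integral_congr_ae (Eventually.of_forall fun t => ?_)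
  dsimp only
  rw [ENNReal.toReal_ofReal (hw.imageDensity_nonneg t)]

theorem integrable_comp (hw : IsWeight T g ρ) {F : ℝ → V} (hF : AEStronglyMeasurable F volume)
    (hi : Integrable fun t => imageDensity T ρ t • F t) :
    Integrable (fun x => F (shiftSq T x)) ((spectralPVM T).measure g) := by
  have h := hw.map_shiftSq
  refine (integrable_map_measure
    (hF.mono_ac (by rw [h]; exact withDensity_absolutelyContinuous _ _))
    (measurable_shiftSq T).aemeasurable).mp ?_
  rw [h, integrable_withDensity_iff_integrable_smul' hw.measurable_imageDensity.ennreal_ofReal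
      (Eventually.of_forall fun t => ENNReal.ofReal_lt_top)]
  refine hi.congr (Eventually.of_forall fun t => ?_)
  dsimp only
  rw [ENNReal.toReal_ofReal (hw.imageDensity_nonneg t)]

theorem imageDensity_smul (hw : IsWeight T g ρ) (F : ℝ → V) (t : ℝ) :
    imageDensity T ρ t • (scale T ρ t ^ 2 • F t) = (Ioi 0).indicator F t := by
  rw [smul_smul]
  by_cases ht : 0 < t
  · rw [hw.imageDensity_mul_scale_sq ht, one_smul, indicator_of_mem (by exact ht)]
  · rw [hw.imageDensity_of_nonpos (not_lt.mp ht), zero_mul, zero_smul,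
      indicator_of_notMem (by exact ht)]

theorem memLp_lift (hw : IsWeight T g ρ) (a : L2R) :
    MemLp (fun x => (scale T ρ (shiftSq T x) : ℂ) * a (shiftSq T x)) 2
      ((spectralPVM T).measure g) := by
  have hm : AEStronglyMeasurable (fun t => (scale T ρ t : ℂ) * a t) volume :=
    (Complex.measurable_ofReal.comp hw.measurable_scale).aestronglyMeasurable.mul (Lp.memLp a).1
  have hm' := hm.comp_quasiMeasurePreserving hw.quasiMeasurePreserving
  refine (memLp_two_iff_integrable_sq_norm hm').mpr ?_
  refine hw.integrable_comp (F := fun t => ‖(scale T ρ t : ℂ) * a t‖ ^ 2) (hm.norm.pow 2) ?_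
  have h := ((memLp_two_iff_integrable_sq_norm (Lp.memLp a).1).mp (Lp.memLp a)).indicator
    (s := Ioi 0) measurableSet_Ioi
  refine h.congr (Eventually.of_forall fun t => ?_)
  dsimp only
  rw [← hw.imageDensity_smul, norm_mul, mul_pow, Complex.norm_real, Real.norm_eq_abs, sq_abs, smul_eq_mul,
    smul_eq_mul, smul_eq_mul]

theorem inner_toLp_lift (hw : IsWeight T g ρ) (a b : L2R) :
    inner ℂ ((hw.memLp_lift a).toLp _) ((hw.memLp_lift b).toLp _) =
      ∫ t in Ioi 0, conj (a t) * b t := by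
  rw [PVM.inner_Lp_eq_integral, ← integral_indicator measurableSet_Ioi]
  have hm : AEStronglyMeasurable (fun t => conj (a t) * b t) volume :=
    (PVM.integrable_conj_mul a b).1
  have hs : AEStronglyMeasurable (fun t => scale T ρ t ^ 2) volume :=
    (hw.measurable_scale.pow_const 2).aestronglyMeasurable
  calc _ = ∫ x, (fun t => scale T ρ t ^ 2 • (conj (a t) * b t)) (shiftSq T x)
        ∂(spectralPVM T).measure g := by
        refine integral_congr_ae ?_
        filter_upwards [(hw.memLp_lift a).coeFn_toLp, (hw.memLp_lift b).coeFn_toLp] with x h1 h2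
        rw [h1, h2, map_mul, Complex.conj_ofReal, Complex.real_smul, Complex.ofReal_pow]
        ring
    _ = ∫ t, imageDensity T ρ t • (scale T ρ t ^ 2 • (conj (a t) * b t)) :=
        hw.integral_comp (hs.smul hm)
    _ = _ := integral_congr_ae (Eventually.of_forall fun t =>
        hw.imageDensity_smul (fun t => conj (a t) * b t) t)

theorem norm_toLp_lift_le (hw : IsWeight T g ρ) (a : L2R) :
    ‖(hw.memLp_lift a).toLp _‖ ≤ ‖a‖ := by
  have h1 := hw.inner_toLp_lift a a
  have h2 := inner_eq_integral a a
  rw [inner_self_eq_ofReal] at h1 h2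
  have e : ∀ t, conj (a t) * a t = ((‖a t‖ ^ 2 : ℝ) : ℂ) := fun t => by
    rw [mul_comm, Complex.mul_conj, Complex.normSq_eq_norm_sq]
  simp only [e] at h1 h2
  rw [integral_complex_ofReal] at h1 h2
  have h3 := Complex.ofReal_injective h1
  have h4 := Complex.ofReal_injective h2
  refine (sq_le_sq₀ (norm_nonneg _) (norm_nonneg _)).mp ?_
  rw [h3, h4]
  exact setIntegral_le_integral ((memLp_two_iff_integrable_sq_norm (Lp.memLp a).1).mp (Lp.memLp a))
    (Eventually.of_forall fun t => by positivity)

/-- Square integrable functions of `x² - E₀²` as square integrable functions with respect to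
`‖E(·)g‖²`. -/
def lift (hw : IsWeight T g ρ) : L2R →L[ℂ] Lp ℂ 2 ((spectralPVM T).measure g) :=
  LinearMap.mkContinuous
    { toFun := fun a => (hw.memLp_lift a).toLp _
      map_add' := by
        intro a b
        rw [← MemLp.toLp_add]
        refine MemLp.toLp_congr _ _ ?_
        filter_upwards [hw.quasiMeasurePreserving.ae (Lp.coeFn_add a b)] with x hx
        rw [hx]
        simp only [Pi.add_apply, mul_add]
      map_smul' := by
        intro c a
        rw [RingHom.id_apply, ← MemLp.toLp_const_smul]
        refine MemLp.toLp_congr _ _ ?_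
        filter_upwards [hw.quasiMeasurePreserving.ae (Lp.coeFn_smul c a)] with x hx
        rw [hx]
        simp only [Pi.smul_apply, smul_eq_mul]
        ring }
    1 fun a => by
      rw [one_mul]
      exact hw.norm_toLp_lift_le a

theorem coeFn_lift (hw : IsWeight T g ρ) (a : L2R) :
    hw.lift a =ᵐ[(spectralPVM T).measure g]
      fun x => (scale T ρ (shiftSq T x) : ℂ) * a (shiftSq T x) := (hw.memLp_lift a).coeFn_toLp

/-- The embedding of functions of `T² - E₀²` into the cyclic subspace of `g`. -/
def embed (hw : IsWeight T g ρ) : L2R →L[ℂ] H :=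
  ((spectralPVM T).cyc g).toContinuousLinearMap ∘L hw.lift

theorem embed_apply (hw : IsWeight T g ρ) (a : L2R) :
    hw.embed a = (spectralPVM T).cyc g (hw.lift a) := rfl

/-- The adjoint of `embed`. -/
def restr (hw : IsWeight T g ρ) : H →L[ℂ] L2R := ContinuousLinearMap.adjoint hw.embed

theorem inner_restr_left (hw : IsWeight T g ρ) (u : H) (a : L2R) :
    inner ℂ (hw.restr u) a = inner ℂ u (hw.embed a) := ContinuousLinearMap.adjoint_inner_left _ _ _

theorem inner_restr_right (hw : IsWeight T g ρ) (a : L2R) (u : H) :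
    inner ℂ a (hw.restr u) = inner ℂ (hw.embed a) u := ContinuousLinearMap.adjoint_inner_right _ _ _

theorem inner_embed (hw : IsWeight T g ρ) (a : L2R) {b : L2R} (hb : ∀ᵐ t, t ≤ 0 → b t = 0) :
    inner ℂ (hw.embed a) (hw.embed b) = inner ℂ a b := by
  rw [embed_apply, embed_apply, PVM.inner_cyc, inner_eq_integral]
  refine (hw.inner_toLp_lift a b).trans ?_
  rw [← integral_indicator measurableSet_Ioi]
  refine integral_congr_ae ?_
  filter_upwards [hb] with t ht
  by_cases h : 0 < t
  · rw [indicator_of_mem (by exact h)]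
  · rw [indicator_of_notMem (by exact h), ht (not_lt.mp h), mul_zero]

theorem restr_embed (hw : IsWeight T g ρ) {b : L2R} (hb : ∀ᵐ t, t ≤ 0 → b t = 0) :
    hw.restr (hw.embed b) = b :=
  ext_inner_left ℂ fun a => by rw [inner_restr_right, hw.inner_embed a hb]

theorem restrict_Ici (hw : IsWeight T g ρ) :
    ((spectralPVM T).measure g).restrict (Ici (lowestEnergy T)) = (spectralPVM T).measure g := by
  refine Measure.restrict_eq_self_of_ae_mem ?_
  filter_upwards [hw.ae_gt] with x hx using le_of_lt hx

theorem imageDensity_smul_mul (hw : IsWeight T g ρ) (t : ℝ) (w : ℂ) :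
    imageDensity T ρ t • (((√(t + lowestEnergy T ^ 2) : ℝ) : ℂ) * w) = ρ t * w := by
  rcases le_or_gt t 0 with ht | ht
  · rw [hw.imageDensity_of_nonpos ht, hw.weight.eq_zero t ht]
    simp
  · have h : √(t + lowestEnergy T ^ 2) ≠ 0 := (Real.sqrt_pos.mpr (by positivity)).ne'
    rw [Complex.real_smul, imageDensity, ← mul_assoc, ← Complex.ofReal_mul, div_mul_cancel₀ _ h]

theorem D_eq (h : Assumption T g) (hw : IsWeight T g ρ) (lam : ℝ) (z : ℂ) :
    D T g lam z = Weight.det ρ lam z := by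
  have he := lowestEnergy_nonneg h.selfAdjoint h.nonneg
  rw [D, Weight.det, hw.restrict_Ici, cauchy]
  congr 2
  have hF : Measurable fun t : ℝ => ((√(t + lowestEnergy T ^ 2) : ℝ) : ℂ) * ((t : ℂ) - z)⁻¹ := by
    fun_prop
  calc _ = ∫ x, (fun t : ℝ => ((√(t + lowestEnergy T ^ 2) : ℝ) : ℂ) * ((t : ℂ) - z)⁻¹) (shiftSq T x)
        ∂(spectralPVM T).measure g := by
        refine integral_congr_ae ?_
        filter_upwards [hw.ae_gt] with x hx
        rw [sqrt_shiftSq_add (he.trans hx.le), shiftSq, div_eq_mul_inv]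
        push_cast
        rfl
    _ = _ := by
        rw [hw.integral_comp hF.aestronglyMeasurable]
        exact integral_congr_ae (Eventually.of_forall fun t => hw.imageDensity_smul_mul t _)

theorem lamC_eq (h : Assumption T g) (hw : IsWeight T g ρ) : lamC T g = Weight.critical ρ := by
  have he := lowestEnergy_nonneg h.selfAdjoint h.nonneg
  rw [lamC, Weight.critical, hw.restrict_Ici]
  congr 2
  have hF : Measurable fun t : ℝ => √(t + lowestEnergy T ^ 2) / t := by
    fun_prop
  calc _ = ∫ x, (fun t : ℝ => √(t + lowestEnergy T ^ 2) / t) (shiftSq T x)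
        ∂(spectralPVM T).measure g := by
        refine integral_congr_ae ?_
        filter_upwards [hw.ae_gt] with x hx
        rw [sqrt_shiftSq_add (he.trans hx.le), shiftSq]
    _ = _ := by
        rw [hw.integral_comp hF.aestronglyMeasurable]
        refine integral_congr_ae (Eventually.of_forall fun t => ?_)
        dsimp only
        rcases le_or_gt t 0 with ht | ht
        · rw [hw.imageDensity_of_nonpos ht, hw.weight.eq_zero t ht]
          simp
        · have h : √(t + lowestEnergy T ^ 2) ≠ 0 := (Real.sqrt_pos.mpr (by positivity)).ne'
          rw [imageDensity, smul_eq_mul]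
          field_simp

theorem tendsto_D (h : Assumption T g) (hw : IsWeight T g ρ) (lam : ℝ) {σ : ℝ}
    (hσ : σ = 1 ∨ σ = -1) (s : ℝ) :
    Tendsto (fun ε : ℝ => D T g lam (s + σ * ε * Complex.I)) (𝓝[>] 0)
      (𝓝 (Weight.detBdry ρ lam σ s)) := by
  refine (hw.weight.tendsto_det lam hσ s).congr fun ε => ?_
  rw [D_eq h hw]
  push_cast
  rfl

theorem Dbdry_eq (h : Assumption T g) (hw : IsWeight T g ρ) (lam : ℝ) {σ : ℝ}
    (hσ : σ = 1 ∨ σ = -1) (s : ℝ) : Dbdry T g lam σ s = Weight.detBdry ρ lam σ s :=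
  (tendsto_D h hw lam hσ s).limUnder_eq

theorem sqrtVec_eq (h : Assumption T g) :
    sqrtVec T g = (spectralPVM T).cyc g (MemLp.toLp _ h.mem_sqrt) := by
  have h1 := (spectralPVM T).apply_cyc g (F := fun x => (√x : ℝ)) (a := fun _ => 1) (by fun_prop)
    (memLp_const 1) (by simpa only [mul_one] using (show MemLp _ _ _ from h.mem_sqrt))
  rw [(spectralPVM T).cyc_one g] at h1
  rw [sqrtVec, h1]
  congr 1
  exact MemLp.toLp_congr _ _ (Eventually.of_forall fun x => mul_one _)

theorem scale_mul_root (h : Assumption T g) (hw : IsWeight T g ρ) :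
    ∀ᵐ x ∂(spectralPVM T).measure g,
      (scale T ρ (shiftSq T x) : ℂ) * Weight.root ρ (shiftSq T x) = (√x : ℝ) := by
  have he := lowestEnergy_nonneg h.selfAdjoint h.nonneg
  filter_upwards [hw.ae_gt] with x hx
  have hx0 : 0 < x := he.trans_lt hx
  have hs : 0 < shiftSq T x := by
    rw [shiftSq]
    nlinarith
  have hr := hw.weight.pos _ hs
  rw [Weight.root, ← Complex.ofReal_mul, scale, imageDensity, sqrt_shiftSq_add hx0.le,
    Real.sqrt_div hr.le, inv_div, div_mul_cancel₀ _ (Real.sqrt_pos.mpr hr).ne']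

end IsWeight
end PairModel

end

noncomputable section

namespace PairModel
open scoped ComplexConjugate ENNReal NNReal
open CauchyTransform

variable {H : Type*} [NormedAddCommGroup H] [InnerProductSpace ℂ H] [CompleteSpace H]
  {T : H →ₗ.[ℂ] H} {g : H}

theorem PVM.inner_coeff_right (E : PVM H) (g : H) (a : Lp ℂ 2 (E.measure g)) (u : H) :
    inner ℂ a (E.coeff g u) = inner ℂ (E.cyc g a) u :=
  ContinuousLinearMap.adjoint_inner_right _ _ _

namespace IsWeight

variable {ρ : ℝ → ℝ}

theorem exists_le_norm_sq_sub (h : Assumption T g) {z : ℂ}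
    (hz : z.im ≠ 0 ∨ z.re < lowestEnergy T ^ 2) :
    ∃ δ > 0, ∀ x : ℝ, lowestEnergy T < x → δ ≤ ‖(x : ℂ) ^ 2 - z‖ := by
  have he := lowestEnergy_nonneg h.selfAdjoint h.nonneg
  rcases hz with hz | hz
  · refine ⟨|z.im|, abs_pos.mpr hz, fun x _ => ?_⟩
    refine le_trans (le_of_eq ?_) (Complex.abs_im_le_norm _)
    rw [Complex.sub_im, ← Complex.ofReal_pow, Complex.ofReal_im, zero_sub, abs_neg]
  · refine ⟨lowestEnergy T ^ 2 - z.re, sub_pos.mpr hz, fun x hx => ?_⟩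
    refine le_trans ?_ (Complex.re_le_norm _)
    rw [Complex.sub_re, ← Complex.ofReal_pow, Complex.ofReal_re]
    gcongr

theorem resolv_sqrtVec (h : Assumption T g) (hw : IsWeight T g ρ) {z : ℂ}
    (hz : z.im ≠ 0 ∨ z.re < lowestEnergy T ^ 2) {k : L2R}
    (hk : k =ᵐ[volume] fun t =>
      Weight.root ρ t * ((t : ℂ) - (z - (lowestEnergy T : ℂ) ^ 2))⁻¹) :
    resolv (sq T) z (sqrtVec T g) = hw.embed k := by
  obtain ⟨δ, hδ, hle⟩ := exists_le_norm_sq_sub h hz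
  have hm : MemLp (fun x : ℝ => ((√x : ℝ) : ℂ)) 2 ((spectralPVM T).measure g) := h.mem_sqrt
  have hB : ∀ x : ℝ, lowestEnergy T < x → ‖((x : ℂ) ^ 2 - z)⁻¹‖ ≤ δ⁻¹ := fun x hx => by
    rw [norm_inv]
    exact inv_anti₀ hδ (hle x hx)
  have hne : ∀ x : ℝ, lowestEnergy T < x → (x : ℂ) ^ 2 - z ≠ 0 := fun x hx h0 => by
    have := hle x hx
    rw [h0, norm_zero] at this
    linarith
  have hB2 : ∀ x : ℝ, lowestEnergy T < x → ‖(x : ℂ) ^ 2 * ((x : ℂ) ^ 2 - z)⁻¹‖ ≤ 1 + ‖z‖ * δ⁻¹ :=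
    fun x hx => by
      have e : (x : ℂ) ^ 2 * ((x : ℂ) ^ 2 - z)⁻¹ = 1 + z * ((x : ℂ) ^ 2 - z)⁻¹ := by
        have := hne x hx
        field_simp
        ring
      rw [e]
      refine (norm_add_le _ _).trans ?_
      rw [norm_one, norm_mul]
      gcongr
      exact hB x hx
  have key : ∀ (p : ℝ → ℂ) (C : ℝ), Measurable p →
      (∀ x : ℝ, lowestEnergy T < x → ‖p x * ((x : ℂ) ^ 2 - z)⁻¹‖ ≤ C) →
      MemLp (fun x : ℝ => p x * (((√x : ℝ) : ℂ) * ((x : ℂ) ^ 2 - z)⁻¹)) 2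
        ((spectralPVM T).measure g) := by
    intro p C hp hC
    refine hm.of_le_mul (c := C) (Measurable.aestronglyMeasurable (by fun_prop)) ?_
    filter_upwards [hw.ae_gt] with x hx
    have e : p x * (((√x : ℝ) : ℂ) * ((x : ℂ) ^ 2 - z)⁻¹) =
      (p x * ((x : ℂ) ^ 2 - z)⁻¹) * ((√x : ℝ) : ℂ) := by ring
    rw [e, norm_mul]
    gcongr
    exact hC x hx
  have hb : MemLp (fun x : ℝ => ((√x : ℝ) : ℂ) * ((x : ℂ) ^ 2 - z)⁻¹) 2
      ((spectralPVM T).measure g) := by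
    simpa only [one_mul] using key (fun _ => 1) δ⁻¹ measurable_const
      (fun x hx => by rw [one_mul]; exact hB x hx)
  have hxb := key (fun x => (x : ℂ)) (δ⁻¹ + (1 + ‖z‖ * δ⁻¹)) (by fun_prop) fun x hx => by
    have h1 := hB x hx
    have h2 := hB2 x hx
    rw [norm_mul, norm_pow] at h2
    rw [norm_mul]
    set a := ‖(x : ℂ)‖
    set b := ‖((x : ℂ) ^ 2 - z)⁻¹‖
    have hb0 : 0 ≤ b := norm_nonneg _
    have : a * b ≤ b + a ^ 2 * b := by nlinarith [sq_nonneg (a - 1), sq_nonneg a]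
    linarith
  have hxxb : MemLp (fun x : ℝ => (x : ℂ) * (x * (((√x : ℝ) : ℂ) * ((x : ℂ) ^ 2 - z)⁻¹))) 2
      ((spectralPVM T).measure g) := by
    refine (key (fun x => (x : ℂ) ^ 2) _ (by fun_prop) hB2).congr_norm
      (Measurable.aestronglyMeasurable (by fun_prop)) (Eventually.of_forall fun x => ?_)
    congr 1
    ring
  rw [sqrtVec_eq h, h.isSpectralMeasureOf.resolv_sq_cyc
    (exists_isResolvent_sq h.selfAdjoint h.nonneg hz) hm hb hxb hxxb, embed_apply]
  · congr 1
    refine Lp.ext ?_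
    filter_upwards [hb.coeFn_toLp, hw.coeFn_lift k, hw.quasiMeasurePreserving.ae hk,
      scale_mul_root h hw] with x h1 h2 h3 h4
    rw [h1, h2, h3, ← mul_assoc, h4, shiftSq]
    push_cast
    ring_nf
  · filter_upwards [hw.ae_gt] with x hx
    have := hne x hx
    field_simp

theorem memLp_root_mul_kernel (hw : IsWeight T g ρ) {z : ℂ} (hz : z.im ≠ 0) :
    MemLp (fun t => Weight.root ρ t * ((t : ℂ) - z)⁻¹) 2 := by
  refine hw.weight.memLp_root.of_le_mul (c := |z.im|⁻¹)
    ((hw.weight.continuous_root.mul (continuous_kernel hz)).aestronglyMeasurable)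
    (Eventually.of_forall fun t => ?_)
  rw [norm_mul, mul_comm]
  gcongr
  exact norm_kernel_le hz t

/-- The function `t ↦ √ρ(t) / (t - z)`. -/
def rootKernel (hw : IsWeight T g ρ) {z : ℂ} (hz : z.im ≠ 0) : L2R :=
  (hw.memLp_root_mul_kernel hz).toLp _

theorem coeFn_rootKernel (hw : IsWeight T g ρ) {z : ℂ} (hz : z.im ≠ 0) :
    hw.rootKernel hz =ᵐ[volume] fun t => Weight.root ρ t * ((t : ℂ) - z)⁻¹ :=
  (hw.memLp_root_mul_kernel hz).coeFn_toLp

theorem norm_rootKernel_le (hw : IsWeight T g ρ) {z : ℂ} (hz : z.im ≠ 0) :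
    ‖hw.rootKernel hz‖ ≤ |z.im|⁻¹ * ‖hw.weight.memLp_root.toLp _‖ := by
  refine Lp.norm_le_mul_norm_of_ae_le_mul ?_
  filter_upwards [hw.coeFn_rootKernel hz, hw.weight.memLp_root.coeFn_toLp] with t h1 h2
  rw [h1, h2, norm_mul, mul_comm]
  gcongr
  exact norm_kernel_le hz t

theorem norm_rootKernel_sub_le (hw : IsWeight T g ρ) {z y : ℂ} (hz : z.im ≠ 0) (hy : y.im ≠ 0) :
    ‖hw.rootKernel hz - hw.rootKernel hy‖ ≤
      ‖z - y‖ * (|z.im|⁻¹ * |y.im|⁻¹) * ‖hw.weight.memLp_root.toLp _‖ := by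
  refine Lp.norm_le_mul_norm_of_ae_le_mul ?_
  filter_upwards [hw.coeFn_rootKernel hz, hw.coeFn_rootKernel hy,
    hw.weight.memLp_root.coeFn_toLp, Lp.coeFn_sub (hw.rootKernel hz) (hw.rootKernel hy)]
    with t h1 h2 h3 h4
  have e : Weight.root ρ t * ((t : ℂ) - z)⁻¹ - Weight.root ρ t * ((t : ℂ) - y)⁻¹ =
      (z - y) * (((t : ℂ) - z)⁻¹ * ((t : ℂ) - y)⁻¹) * Weight.root ρ t := by
    have := ofReal_sub_ne_zero hz t
    have := ofReal_sub_ne_zero hy t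
    field_simp
    ring
  rw [h4, Pi.sub_apply, h1, h2, h3, e, norm_mul, norm_mul, norm_mul]
  gcongr
  · exact norm_kernel_le hz t
  · exact norm_kernel_le hy t

theorem im_line {κ : ℝ} (hκ : κ ≠ 0) (s : ℝ) : ((s : ℂ) + κ * Complex.I).im ≠ 0 := by
  rwa [im_ofReal_add_mul_I]

theorem continuous_rootKernel (hw : IsWeight T g ρ) {κ : ℝ} (hκ : κ ≠ 0) :
    Continuous fun s : ℝ => hw.rootKernel (im_line hκ s) := by
  refine (LipschitzWith.of_dist_le_mul
    (K := Real.toNNReal ((|κ|⁻¹ * |κ|⁻¹) * ‖hw.weight.memLp_root.toLp _‖)) fun s t => ?_).continuous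
  rw [Real.coe_toNNReal _ (by positivity), dist_eq_norm, Real.dist_eq]
  refine (hw.norm_rootKernel_sub_le (im_line hκ s) (im_line hκ t)).trans (le_of_eq ?_)
  rw [im_ofReal_add_mul_I, im_ofReal_add_mul_I, add_sub_add_right_eq_sub, ← Complex.ofReal_sub,
    Complex.norm_real, Real.norm_eq_abs]
  ring

theorem kernelVec_eq (h : Assumption T g) (hw : IsWeight T g ρ) (lam : ℝ) {σ : ℝ}
    (hσ : σ = 1 ∨ σ = -1) {ε : ℝ} (hε : 0 < ε) (x : ℝ) :
    kernelVec T g lam σ ε x = (Weight.detBdry ρ lam σ (shiftSq T x))⁻¹ •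
      hw.embed (hw.rootKernel (im_line (sign_mul_ne_zero hσ hε) (shiftSq T x))) := by
  have hκ := sign_mul_ne_zero hσ hε
  rw [kernelVec, Dbdry_eq h hw lam hσ, shiftSq, resolv_sqrtVec h hw]
  · left
    have := im_line hκ (x ^ 2)
    push_cast at this
    exact this
  · filter_upwards [hw.coeFn_rootKernel (im_line hκ (x ^ 2 - lowestEnergy T ^ 2))] with t ht
    rw [ht]
    push_cast
    ring_nf

theorem aestronglyMeasurable_kernelVec (h : Assumption T g) (hw : IsWeight T g ρ) (lam : ℝ) {σ : ℝ}
    (hσ : σ = 1 ∨ σ = -1) {ε : ℝ} (hε : 0 < ε) :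
    AEStronglyMeasurable (kernelVec T g lam σ ε) ((spectralPVM T).measure g) := by
  have hκ := sign_mul_ne_zero hσ hε
  have h1 : kernelVec T g lam σ ε = fun x => (Weight.detBdry ρ lam σ (shiftSq T x))⁻¹ •
      hw.embed (hw.rootKernel (im_line hκ (shiftSq T x))) :=
    funext fun x => kernelVec_eq h hw lam hσ hε x
  rw [h1]
  have h2 : StronglyMeasurable fun s : ℝ => hw.embed (hw.rootKernel (im_line hκ s)) :=
    (hw.embed.continuous.comp (hw.continuous_rootKernel hκ)).stronglyMeasurable
  have h3 : StronglyMeasurable fun s : ℝ => (Weight.detBdry ρ lam σ s)⁻¹ :=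
    (hw.weight.continuous_detBdry lam σ).measurable.inv.stronglyMeasurable
  exact ((h3.smul h2).comp_measurable (measurable_shiftSq T)).aestronglyMeasurable

theorem exists_norm_kernelVec_le (h : Assumption T g) (hw : IsWeight T g ρ) {lam : ℝ}
    (hl : lam ≠ lamC T g) {σ : ℝ} (hσ : σ = 1 ∨ σ = -1) {ε : ℝ} (hε : 0 < ε) :
    ∃ C, ∀ᵐ x ∂(spectralPVM T).measure g, ‖kernelVec T g lam σ ε x‖ ≤ C := by
  have he := lowestEnergy_nonneg h.selfAdjoint h.nonneg
  have hκ := sign_mul_ne_zero hσ hε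
  rw [lamC_eq h hw] at hl
  obtain ⟨c, hc, hle⟩ := hw.weight.exists_le_norm_detBdry hl hσ
  refine ⟨c⁻¹ * (‖hw.embed‖ * (|σ * ε|⁻¹ * ‖hw.weight.memLp_root.toLp _‖)), ?_⟩
  filter_upwards [hw.ae_gt] with x hx
  have hs : 0 ≤ shiftSq T x := by
    rw [shiftSq]
    nlinarith
  rw [kernelVec_eq h hw lam hσ hε, norm_smul, norm_inv]
  gcongr
  · exact hle _ hs
  · refine (hw.embed.le_opNorm _).trans ?_
    gcongr
    refine (hw.norm_rootKernel_le _).trans (le_of_eq ?_)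
    rw [im_ofReal_add_mul_I]

theorem cmeasure_sqrtVec (h : Assumption T g) (f : H) :
    (spectralPVM T).cmeasure (sqrtVec T g) f = ((spectralPVM T).measure g).withDensityᵥ
      (fun x => conj ((MemLp.toLp _ h.mem_sqrt : Lp ℂ 2 ((spectralPVM T).measure g)) x) *
        (spectralPVM T).coeff g f x) := by
  rw [sqrtVec_eq h, PVM.cmeasure_cyc_left]

theorem cmeasure_restrict (h : Assumption T g) (hw : IsWeight T g ρ) (f : H) :
    ((spectralPVM T).cmeasure (sqrtVec T g) f).restrict (Ici (lowestEnergy T)) =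
      (spectralPVM T).cmeasure (sqrtVec T g) f := by
  have hi := PVM.integrable_conj_mul
    (MemLp.toLp _ h.mem_sqrt : Lp ℂ 2 ((spectralPVM T).measure g)) ((spectralPVM T).coeff g f)
  refine VectorMeasure.ext fun B hB => ?_
  rw [VectorMeasure.restrict_apply _ measurableSet_Ici hB, cmeasure_sqrtVec h,
    withDensityᵥ_apply hi hB, withDensityᵥ_apply hi (hB.inter measurableSet_Ici),
    ← Measure.restrict_restrict hB, hw.restrict_Ici]

theorem integrable_kernelVec (h : Assumption T g) (hw : IsWeight T g ρ) {lam : ℝ}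
    (hl : lam ≠ lamC T g) {σ : ℝ} (hσ : σ = 1 ∨ σ = -1) {ε : ℝ} (hε : 0 < ε) (f : H) :
    ((spectralPVM T).cmeasure (sqrtVec T g) f).Integrable (kernelVec T g lam σ ε) := by
  have hi := PVM.integrable_conj_mul
    (MemLp.toLp _ h.mem_sqrt : Lp ℂ 2 ((spectralPVM T).measure g)) ((spectralPVM T).coeff g f)
  obtain ⟨C, hC⟩ := exists_norm_kernelVec_le h hw hl hσ hε
  have hm := aestronglyMeasurable_kernelVec h hw lam hσ hε
  rw [cmeasure_sqrtVec h]
  refine integrable_of_integrable_norm_mul hi hm ?_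
  refine (hi.norm.const_mul C).mono (hm.norm.mul hi.1.norm) ?_
  filter_upwards [hC] with x hx
  refine (norm_mul_le _ _).trans ?_
  rw [norm_norm, norm_norm]
  refine le_trans ?_ (Real.le_norm_self _)
  exact mul_le_mul_of_nonneg_right hx (norm_nonneg _)

theorem inner_kernelVec (h : Assumption T g) (hw : IsWeight T g ρ) (lam : ℝ) {σ : ℝ}
    (hσ : σ = 1 ∨ σ = -1) {ε : ℝ} (hε : 0 < ε) (w : H) (x : ℝ) :
    inner ℂ w (kernelVec T g lam σ ε x) = (Weight.detBdry ρ lam σ (shiftSq T x))⁻¹ *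
      conj (cauchy (mulOp (Weight.root ρ) (hw.restr w))
        ((shiftSq T x : ℝ) + (-(σ * ε) : ℝ) * Complex.I)) := by
  have hκ := sign_mul_ne_zero hσ hε
  rw [kernelVec_eq h hw lam hσ hε, inner_smul_right, ← inner_restr_left, inner_eq_integral,
    conj_cauchy, cauchy]
  congr 1
  refine integral_congr_ae ?_
  filter_upwards [hw.coeFn_rootKernel (im_line hκ (shiftSq T x)),
    coeFn_mulOp hw.weight.memLp_top_root (hw.restr w)] with t h1 h2
  rw [h1, h2, map_mul, Weight.conj_root]
  simp only [map_add, map_mul, map_neg, Complex.conj_ofReal, Complex.conj_I, Complex.ofReal_neg]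
  ring_nf

theorem Reps_eq (h : Assumption T g) (hw : IsWeight T g ρ) {lam : ℝ}
    (hl : lam ≠ lamC T g) {σ : ℝ} (hσ : σ = 1 ∨ σ = -1) {ε : ℝ} (hε : 0 < ε) (f : H) :
    Reps T g lam σ ε f = hw.embed ((lam : ℂ) • mulOp (Weight.root ρ) (lineOp' (-σ * ε)
      (mulOp (Weight.quot ρ lam σ) (hw.restr f)))) := by
  have hκ : -(σ * ε) ≠ 0 := neg_ne_zero.mpr (sign_mul_ne_zero hσ hε)
  have hl' := hl
  rw [lamC_eq h hw] at hl'
  have hq := hw.weight.memLp_top_quot hl' hσ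
  have hi := PVM.integrable_conj_mul
    (MemLp.toLp _ h.mem_sqrt : Lp ℂ 2 ((spectralPVM T).measure g)) ((spectralPVM T).coeff g f)
  have hK := integrable_kernelVec h hw hl hσ hε f
  rw [Reps, cmeasure_restrict h hw]
  rw [cmeasure_sqrtVec h] at hK ⊢
  rw [integral_withDensity hi _ hK]
  refine ext_inner_left ℂ fun w => ?_
  have hI := integrable_apply_density hi hK
    (ContinuousLinearMap.lsmul ℝ ℂ : ℂ →L[ℝ] H →L[ℝ] H).flip
  set N := lineOp hκ (mulOp (Weight.root ρ) (hw.restr w)) with hN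
  have e1 : inner ℂ w (∫ x, (ContinuousLinearMap.lsmul ℝ ℂ : ℂ →L[ℝ] H →L[ℝ] H).flip
      (kernelVec T g lam σ ε x)
      (conj ((MemLp.toLp _ h.mem_sqrt : Lp ℂ 2 ((spectralPVM T).measure g)) x) *
        (spectralPVM T).coeff g f x) ∂(spectralPVM T).measure g) =
      inner ℂ (hw.lift (mulOp (fun t => conj (Weight.quot ρ lam σ t)) N))
        ((spectralPVM T).coeff g f) := by
    rw [← integral_inner hI, PVM.inner_Lp_eq_integral]
    refine integral_congr_ae ?_
    filter_upwards [hw.coeFn_lift (mulOp (fun t => conj (Weight.quot ρ lam σ t)) N),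
      hw.quasiMeasurePreserving.ae (coeFn_mulOp (memLp_top_conj hq) N),
      hw.quasiMeasurePreserving.ae (coeFn_lineOp hκ (mulOp (Weight.root ρ) (hw.restr w))),
      MemLp.coeFn_toLp (show MemLp _ _ _ from h.mem_sqrt), scale_mul_root h hw]
      with x h1 h2 h3 h4 h5
    rw [h1, h2, h3, h4, ← h5, ContinuousLinearMap.flip_apply, ContinuousLinearMap.lsmul_apply,
      inner_smul_right, inner_kernelVec h hw lam hσ hε, Weight.quot]
    simp only [map_mul, Complex.conj_ofReal, Complex.conj_conj, Weight.conj_root]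
    ring
  have e2 : lineOp' (-σ * ε) = lineOp hκ := by rw [neg_mul, lineOp'_eq hκ]
  rw [inner_smul_right, e1, e2, PVM.inner_coeff_right, ← embed_apply, ← hw.inner_restr_right,
    inner_mulOp_left (memLp_top_conj hq), hN, inner_lineOp_left, ← hw.inner_restr_left,
    inner_smul_right, hw.weight.inner_mulOp_root]
  simp only [Complex.conj_conj]
  ring

theorem tendsto_Reps (h : Assumption T g) (hw : IsWeight T g ρ) {lam : ℝ}
    (hl : lam ≠ lamC T g) {σ : ℝ} (hσ : σ = 1 ∨ σ = -1) (f : H) :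
    Tendsto (fun ε : ℝ => Reps T g lam σ ε f) (𝓝[>] 0)
      (𝓝 (hw.embed (Weight.waveOp ρ lam σ hσ (hw.restr f)))) := by
  rw [Weight.waveOp_apply]
  have h1 := tendsto_lineOp' (neg_sign hσ) (mulOp (Weight.quot ρ lam σ) (hw.restr f))
  have h2 := (hw.embed.continuous.tendsto _).comp
    ((((mulOp (Weight.root ρ)).continuous.tendsto _).comp h1).const_smul (lam : ℂ))
  refine h2.congr' ?_
  filter_upwards [self_mem_nhdsWithin] with ε hε
  exact (Reps_eq h hw hl hσ hε f).symm

theorem Rop_eq (h : Assumption T g) (hw : IsWeight T g ρ) {lam : ℝ}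
    (hl : lam ≠ lamC T g) {σ : ℝ} (hσ : σ = 1 ∨ σ = -1) :
    Rop T g lam σ = hw.embed ∘L Weight.waveOp ρ lam σ hσ ∘L hw.restr := by
  have hR : ∃ R : H →L[ℂ] H, ∀ f, Tendsto (fun ε => Reps T g lam σ ε f) (𝓝[>] 0) (𝓝 (R f)) :=
    ⟨hw.embed ∘L Weight.waveOp ρ lam σ hσ ∘L hw.restr, fun f => tendsto_Reps h hw hl hσ f⟩
  rw [Rop, dif_pos hR]
  ext f
  exact tendsto_nhds_unique (hR.choose_spec f) (tendsto_Reps h hw hl hσ f)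

end IsWeight
end PairModel

end

noncomputable section

namespace PairModel
open scoped ComplexConjugate ENNReal NNReal
open CauchyTransform

variable {H : Type*} [NormedAddCommGroup H] [InnerProductSpace ℂ H] [CompleteSpace H]
  {T : H →ₗ.[ℂ] H} {g : H}

theorem norm_apply_of_star_mul {A : H →L[ℂ] H} (hA : star A * A = 1) (f : H) : ‖A f‖ = ‖f‖ :=
  A.norm_map_iff_adjoint_comp_self.mpr hA f

theorem mul_star_eq_one_sub_rankOne {A : H →L[ℂ] H} (hA : star A * A = 1) {b : H}
    (hb : star A b = 0) (hker : ∀ f, star A f = 0 → f = inner ℂ b f • b) :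
    A * star A = 1 - InnerProductSpace.rankOne ℂ b b := by
  ext f
  have h1 : star A (f - A (star A f)) = 0 := by
    have h2 : star A (A (star A f)) = star A f := congrArg (fun B : H →L[ℂ] H => B (star A f)) hA
    rw [map_sub, h2, sub_self]
  have h3 := hker _ h1
  have h4 : inner ℂ b (A (star A f)) = 0 := by
    rw [← ContinuousLinearMap.adjoint_inner_left]
    change inner ℂ (star A b) _ = 0
    rw [hb, inner_zero_left]
  rw [inner_sub_right, h4, sub_zero] at h3
  change A (star A f) = f - inner ℂ b f • b
  rw [← h3, sub_sub_cancel]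

theorem range_eq_of_mul_star {A B : H →L[ℂ] H} (hA : star A * A = 1) (hB : A * star A = B) :
    range A = range B := by
  ext f
  constructor
  · rintro ⟨v, rfl⟩
    refine ⟨A v, ?_⟩
    rw [← hB]
    exact congrArg (fun C : H →L[ℂ] H => A (C v)) hA
  · rintro ⟨v, rfl⟩
    exact ⟨star A v, by rw [← hB]; rfl⟩

namespace IsWeight

variable {ρ : ℝ → ℝ} {lam σ : ℝ}

theorem Omega_apply (h : Assumption T g) (hw : IsWeight T g ρ) (hl : lam ≠ lamC T g)
    (hσ : σ = 1 ∨ σ = -1) (f : H) :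
    Omega T g lam σ f = f + hw.embed (Weight.waveOp ρ lam σ hσ (hw.restr f)) := by
  rw [Omega, Rop_eq h hw hl hσ]
  rfl

theorem star_Omega_apply (h : Assumption T g) (hw : IsWeight T g ρ) (hl : lam ≠ lamC T g)
    (hσ : σ = 1 ∨ σ = -1) (f : H) :
    star (Omega T g lam σ) f = f + hw.embed (Weight.waveAdj ρ lam σ hσ (hw.restr f)) := by
  refine ext_inner_left ℂ fun w => ?_
  rw [ContinuousLinearMap.star_eq_adjoint, ContinuousLinearMap.adjoint_inner_right,
    Omega_apply h hw hl hσ, inner_add_left, inner_add_right, ← hw.inner_restr_right,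
    hw.weight.inner_waveOp_left (by rwa [← lamC_eq h hw]) hσ, hw.inner_restr_left]

theorem star_Omega_mul_Omega (h : Assumption T g) (hw : IsWeight T g ρ) (hl : lam ≠ lamC T g)
    (hσ : σ = 1 ∨ σ = -1) : star (Omega T g lam σ) * Omega T g lam σ = 1 := by
  refine (Omega T g lam σ).norm_map_iff_adjoint_comp_self.mp fun f => ?_
  have h1 := hw.weight.inner_waveOp_add (by rwa [← lamC_eq h hw]) hσ (hw.restr f)
  have h2 := inner_self_eq_ofReal (Omega T g lam σ f)
  rw [Omega_apply h hw hl hσ, inner_add_left, inner_add_right, inner_add_right,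
    ← hw.inner_restr_left, ← hw.inner_restr_right,
    hw.inner_embed _ (hw.weight.coeFn_waveOp_of_nonpos lam hσ _), inner_self_eq_ofReal f] at h2
  have h3 : ((‖f‖ ^ 2 : ℝ) : ℂ) = ((‖Omega T g lam σ f‖ ^ 2 : ℝ) : ℂ) := by
    rw [Omega_apply h hw hl hσ, ← h2]
    linear_combination -h1
  exact (sq_eq_sq₀ (norm_nonneg _) (norm_nonneg _)).mp (Complex.ofReal_injective h3).symm

theorem eq_embed_of_star_Omega (h : Assumption T g) (hw : IsWeight T g ρ) (hl : lam ≠ lamC T g)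
    (hσ : σ = 1 ∨ σ = -1) {f : H} (hf : star (Omega T g lam σ) f = 0) :
    hw.restr f + Weight.waveAdj ρ lam σ hσ (hw.restr f) = 0 ∧ f = hw.embed (hw.restr f) := by
  rw [star_Omega_apply h hw hl hσ] at hf
  have h0 := hw.weight.coeFn_waveAdj_of_nonpos (by rwa [← lamC_eq h hw]) hσ (hw.restr f)
  have h1 : hw.restr f + Weight.waveAdj ρ lam σ hσ (hw.restr f) = 0 := by
    have h2 := congrArg hw.restr hf
    rwa [map_add, map_zero, hw.restr_embed h0] at h2
  refine ⟨h1, ?_⟩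
  rw [eq_neg_of_add_eq_zero_left hf, ← map_neg, ← eq_neg_of_add_eq_zero_left h1,
    hw.restr_embed]
  rw [eq_neg_of_add_eq_zero_left h1]
  filter_upwards [h0, Lp.coeFn_neg (Weight.waveAdj ρ lam σ hσ (hw.restr f))] with t h2 h3 ht
  rw [h3, Pi.neg_apply, h2 ht, neg_zero]

theorem Omega_mul_star_of_gt (h : Assumption T g) (hw : IsWeight T g ρ) (hl : lamC T g < lam)
    (hσ : σ = 1 ∨ σ = -1) : Omega T g lam σ * star (Omega T g lam σ) = 1 := by
  have h1 := mul_star_eq_one_sub_rankOne (b := 0) (star_Omega_mul_Omega h hw hl.ne' hσ)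
    (map_zero _) fun f hf => by
      obtain ⟨h2, h3⟩ := eq_embed_of_star_Omega h hw hl.ne' hσ hf
      rw [smul_zero, h3, hw.weight.eq_zero_of_add_waveAdj (by rwa [← lamC_eq h hw]) hσ h2, map_zero]
  simpa using h1

theorem xZero_spec (h : Assumption T g) (hw : IsWeight T g ρ) (hl : lam < lamC T g) :
    xZero T g lam < 0 ∧ 1 + lam * Weight.stieltjes ρ (xZero T g lam) = 0 := by
  have hx : ∃ x : ℝ, x < 0 ∧ D T g lam x = 0 := by
    obtain ⟨x, hx, hx0⟩ := hw.weight.exists_zero (by rwa [← lamC_eq h hw])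
    refine ⟨x, hx, ?_⟩
    rw [D_eq h hw, Weight.det_ofReal, hx0, Complex.ofReal_zero]
  rw [xZero, dif_pos hx]
  refine ⟨hx.choose_spec.1, ?_⟩
  have h1 := hx.choose_spec.2
  rw [D_eq h hw, Weight.det_ofReal] at h1
  exact_mod_cast h1

theorem D_eq_zero_iff (h : Assumption T g) (hw : IsWeight T g ρ) (hl : lam < lamC T g) {z : ℂ}
    (hz : ∀ t : ℝ, 0 ≤ t → z ≠ t) : D T g lam z = 0 ↔ z = xZero T g lam := by
  obtain ⟨hx, hx0⟩ := xZero_spec h hw hl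
  rw [D_eq h hw]
  constructor
  · intro h0
    have him : z.im = 0 := by
      by_contra him
      exact hw.weight.det_ne_zero_of_im lam him h0
    have hre : z = (z.re : ℝ) := Complex.ext rfl (by simpa using him)
    have hneg : z.re < 0 := by
      by_contra! hneg
      exact hz _ hneg hre
    rw [hre, Weight.det_ofReal, Complex.ofReal_eq_zero] at h0
    rw [hre, hw.weight.zero_unique hneg.le hx.le h0 hx0]
  · rintro rfl
    rw [Weight.det_ofReal, hx0, Complex.ofReal_zero]

theorem bound_of_nonpos (hw : IsWeight T g ρ) {x : ℝ} (hx : x < 0) :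
    ∀ᵐ t, t ≤ 0 → (hw.weight.memLp_bound hx).toLp _ t = 0 := by
  filter_upwards [(hw.weight.memLp_bound hx).coeFn_toLp] with t h1 ht
  rw [h1, Weight.bound, hw.weight.root_of_nonpos ht, zero_mul]

theorem boundState_eq (h : Assumption T g) (hw : IsWeight T g ρ) (hl : lam < lamC T g)
    (hx : xZero T g lam < 0) :
    boundState T g lam = ((‖(hw.weight.memLp_bound hx).toLp _‖⁻¹ : ℝ) : ℂ) •
      hw.embed ((hw.weight.memLp_bound hx).toLp _) := by
  have hlam : lam ≠ 0 := by
    rw [lamC_eq h hw] at hl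
    exact (hl.trans hw.weight.critical_neg).ne
  have hD : D T g lam = Weight.det ρ lam := funext (D_eq h hw lam)
  rw [boundState, hD, (hw.weight.hasDerivAt_det lam hx).deriv, ← Complex.ofReal_mul,
    Complex.ofReal_re, ← hw.weight.norm_bound_sq hx, div_mul_cancel_left₀ hlam, Real.sqrt_inv,
    Real.sqrt_sq (norm_nonneg _), resolv_sqrtVec h hw]
  · right
    rw [← Complex.ofReal_pow, Complex.add_re, Complex.ofReal_re, Complex.ofReal_re]
    linarith
  · filter_upwards [(hw.weight.memLp_bound hx).coeFn_toLp] with t h1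
    rw [h1, Weight.bound, add_sub_cancel_left]
    rcases le_or_gt t 0 with ht | ht
    · rw [hw.weight.root_of_nonpos ht, zero_mul, zero_mul]
    · rw [poleFactor_of_nonneg _ ht.le]

theorem norm_bound_pos (hw : IsWeight T g ρ) {x : ℝ} (hx : x < 0) :
    0 < ‖(hw.weight.memLp_bound hx).toLp _‖ := by
  have h1 := hw.weight.norm_bound_sq hx
  have h2 := hw.weight.integral_div_mul_pos hx.le hx
  rw [← h1] at h2
  exact lt_of_le_of_ne (norm_nonneg _) fun h0 => by simp [← h0] at h2

theorem norm_boundState (h : Assumption T g) (hw : IsWeight T g ρ) (hl : lam < lamC T g) :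
    ‖boundState T g lam‖ = 1 := by
  obtain ⟨hx, -⟩ := xZero_spec h hw hl
  have h1 : ‖hw.embed ((hw.weight.memLp_bound hx).toLp _)‖ =
      ‖(hw.weight.memLp_bound hx).toLp _‖ := by
    have h2 := hw.inner_embed ((hw.weight.memLp_bound hx).toLp _) (hw.bound_of_nonpos hx)
    rw [inner_self_eq_ofReal, inner_self_eq_ofReal] at h2
    exact (sq_eq_sq₀ (norm_nonneg _) (norm_nonneg _)).mp (Complex.ofReal_injective h2)
  rw [boundState_eq h hw hl hx, norm_smul, h1, Complex.norm_real, norm_inv, norm_norm,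
    inv_mul_cancel₀ (hw.norm_bound_pos hx).ne']

theorem Omega_mul_star_of_lt (h : Assumption T g) (hw : IsWeight T g ρ) (hl : lam < lamC T g)
    (hσ : σ = 1 ∨ σ = -1) :
    Omega T g lam σ * star (Omega T g lam σ) = 1 - boundProj T g lam := by
  obtain ⟨hx, hx0⟩ := xZero_spec h hw hl
  have hl' : lam ≠ Weight.critical ρ := by
    rw [← lamC_eq h hw]
    exact hl.ne
  have hB := boundState_eq h hw hl hx
  have hN := (hw.norm_bound_pos hx).ne'
  have hv := hw.bound_of_nonpos hx
  have hw0 := hw.weight.add_waveAdj_bound hl' hx hx0 hσ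
  have hcb := hw.weight.inner_bound hx
  set b := (hw.weight.memLp_bound hx).toLp _ with hb
  refine mul_star_eq_one_sub_rankOne (star_Omega_mul_Omega h hw hl.ne hσ) ?_ fun f hf => ?_
  · rw [hB, map_smul, star_Omega_apply h hw hl.ne hσ, hw.restr_embed hv, ← map_add, hw0, map_zero,
      smul_zero]
  · obtain ⟨h1, h2⟩ := eq_embed_of_star_Omega h hw hl.ne hσ hf
    set u := hw.restr f with hu
    set κ : ℂ := inner ℂ b u * ((‖b‖ ^ 2 : ℝ) : ℂ)⁻¹ with hκ
    have hN2 : ((‖b‖ ^ 2 : ℝ) : ℂ) ≠ 0 := by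
      exact_mod_cast pow_ne_zero 2 hN
    have h3 : u - κ • b = 0 := by
      refine hw.weight.eq_zero_of_add_waveAdj_of_cauchy hl' hx hx0 hσ ?_ ?_
      · rw [map_sub, map_smul, sub_add_sub_comm, ← smul_add, h1, hw0, smul_zero, sub_zero]
      · rw [← hcb, inner_sub_right, inner_smul_right, inner_self_eq_ofReal, hκ, mul_assoc,
          inv_mul_cancel₀ hN2, mul_one, sub_self]
    have h4 : f = κ • hw.embed b := by
      rw [h2, sub_eq_zero.mp h3, map_smul]
    have h5 : inner ℂ (hw.embed b) f = inner ℂ b u := by rw [hu, hw.inner_restr_right]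
    rw [hB, inner_smul_left, h5, smul_smul, Complex.conj_ofReal]
    conv_lhs => rw [h4]
    congr 1
    rw [hκ]
    push_cast
    ring

end IsWeight

theorem heaviside_of_pos {t : ℝ} (ht : 0 < t) : heaviside t = 1 := if_pos ht

theorem heaviside_of_neg {t : ℝ} (ht : t < 0) : heaviside t = 0 := if_neg ht.not_gt

end PairModel

end

open PairModel in
theorem mainTheorem5 {H : Type*} [NormedAddCommGroup H] [InnerProductSpace ℂ H] [CompleteSpace H]
    [TopologicalSpace.SeparableSpace H] (T : H →ₗ.[ℂ] H) (g : H) (hTg : Assumption T g)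
    (lam : ℝ) (hlam : lam ≠ lamC T g) :
    (lam < lamC T g →
      xZero T g lam < 0 ∧
      (∀ z : ℂ, (∀ t : ℝ, 0 ≤ t → z ≠ t) → (D T g lam z = 0 ↔ z = xZero T g lam)) ∧
      ‖boundState T g lam‖ = 1) ∧
    ∀ σ : ℝ, σ = 1 ∨ σ = -1 →
      (∀ s : ℝ, 0 ≤ s →
        Tendsto (fun ε : ℝ => D T g lam (s + σ * ε * Complex.I)) (𝓝[>] 0)
          (𝓝 (Dbdry T g lam σ s)) ∧
        Dbdry T g lam σ s ≠ 0) ∧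
      (∀ ε : ℝ, 0 < ε → ∀ f : H,
        ((spectralPVM T).cmeasure (sqrtVec T g) f).IntegrableOn (kernelVec T g lam σ ε)
          (Ici (lowestEnergy T))) ∧
      (∀ f : H, Tendsto (fun ε : ℝ => Reps T g lam σ ε f) (𝓝[>] 0) (𝓝 (Rop T g lam σ f))) ∧
      star (Omega T g lam σ) * Omega T g lam σ = 1 ∧
      Omega T g lam σ * star (Omega T g lam σ) =
        1 - heaviside (lamC T g - lam) • boundProj T g lam ∧
      (lamC T g < lam → Omega T g lam σ ∈ unitary (H →L[ℂ] H)) ∧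
      (lam < lamC T g → IsPartialIsometry (Omega T g lam σ) ∧
        range (Omega T g lam σ) = range ((1 : H →L[ℂ] H) - boundProj T g lam)) := by
  obtain ⟨ρ, hw⟩ := hTg.exists_weight
  refine ⟨fun hl => ⟨(IsWeight.xZero_spec hTg hw hl).1,
    fun z hz => IsWeight.D_eq_zero_iff hTg hw hl hz, IsWeight.norm_boundState hTg hw hl⟩,
    fun σ hσ => ?_⟩
  have hiso := IsWeight.star_Omega_mul_Omega hTg hw hlam hσ
  refine ⟨fun s hs => ?_, fun ε hε f => ?_, fun f => ?_, hiso, ?_, fun hl => ?_, fun hl => ⟨?_, ?_⟩⟩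
  · rw [IsWeight.Dbdry_eq hTg hw lam hσ]
    exact ⟨IsWeight.tendsto_D hTg hw lam hσ s,
      hw.weight.detBdry_ne_zero_of_nonneg (by rwa [← IsWeight.lamC_eq hTg hw]) hσ hs⟩
  · have h := IsWeight.integrable_kernelVec hTg hw hlam hσ hε f
    rwa [← IsWeight.cmeasure_restrict hTg hw] at h
  · rw [IsWeight.Rop_eq hTg hw hlam hσ]
    exact IsWeight.tendsto_Reps hTg hw hlam hσ f
  · rcases lt_or_gt_of_ne hlam with hl | hl
    · rw [heaviside_of_pos (sub_pos.mpr hl), one_smul, IsWeight.Omega_mul_star_of_lt hTg hw hl hσ]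
    · rw [heaviside_of_neg (sub_neg.mpr hl), zero_smul, sub_zero,
        IsWeight.Omega_mul_star_of_gt hTg hw hl hσ]
  · exact Unitary.mem_iff.mpr ⟨hiso, IsWeight.Omega_mul_star_of_gt hTg hw hl hσ⟩
  · exact fun f _ => norm_apply_of_star_mul hiso f
  · exact range_eq_of_mul_star hiso (IsWeight.Omega_mul_star_of_lt hTg hw hl hσ)
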